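/- Let $d\ge 1$. A $k$-polytope is the convex hull of a finite nonempty set, of affine dimension $k$, in some $\mathbb{R}^n$. Its faces are the empty set, the polytope itself, and its intersections with supporting hyperplanes; a proper face is a face other than the polytope itself. A realization of the $k$-cube (for short, a $k$-cube) is a $k$-polytope whose face lattice is isomorphic to that of $[0,1]^k$. A $d$-polytope is cubical if each of its nonempty proper faces is a $k$-cube for some $k$. A projective transformation of $\mathbb{R}^n$ is a map $x\mapsto \frac{Ax+b}{c^Tx+\alpha}$ with $\det\begin{pmatrix}A&b\\ c^T&\alpha\end{pmatrix}\ne 0$; it is applied only to polytopes on which $c^Tx+\alpha$ has no zero. A polytope $P\subset\mathbb{R}^{d-1}$ is projectively equivalent to a facet $F$ of a $d$-polytope in $\mathbb{R}^d$ if $F$ is the image of $P$ under a projective transformation of $\mathbb{R}^{d-1}$ followed by an injective affine map $\mathbb{R}^{d-1}\to\mathbb{R}^d$. For $d$-polytopes $P,Q\subset\mathbb{R}^d$, we say that $P\cup Q$ is the connected sum of $P$ and $Q$ along $F$ (obtained by stacking $Q$ on the facet $F$ of $P$) if $F=P\cap Q$ is a facet of both $P$ and $Q$, the union $P\cup Q$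 is convex, and the proper faces of $P\cup Q$ are exactly the proper faces of $P$ or $Q$ other than $F$. A $d$-tower of $1$ cube is a $d$-cube with two opposite facets marked as bottom and top. A $d$-tower of $m+1$ cubes is obtained from a $d$-tower of $m$ cubes by stacking a $d$-cube on its top facet; the bottom facet stays the same and the new top facet is the facet of the new cube opposite to the old top facet. (a) (Bounded towers) For any two realizations $C_1,C_2\subset\mathbb{R}^{d-1}$ of the $(d-1)$-cube there is a $d$-tower $C\subset\mathbb{R}^d$ of $m\le 4d$ cubes which is a cubical $d$-polytope and such that $C_1$ and $C_2$ are projectively equivalent to the bottom and the top facet of $C$, respectively. (b) (Cubical connected sum) For any two cubical $d$-polytopes $P_1,P_2\subset\mathbb{R}^d$ and facets $F_i$ of $P_i$ ($i=1,2$) there are a projective transformation $\varphi$ of $\mathbb{R}^d$, defined on $P_2$, and a $d$-tower $T$ of at most $4d$ cubes such that $P:=P_1\cup T\cup\varphi(P_2)$ is convex, and $P_1\cap T=F_1$ and $\varphi(P_2)\cap T=\varphi(F_2)$ are the top and the bottom facet of $T$, respectively. Moreover, $P$ is a cubical $d$-polytope; $P_1\cup T$ is the connected sum of $P_1$ and $T$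 along $F_1$, and $P$ is the connected sum of $P_1\cup T$ and $\varphi(P_2)$ along $\varphi(F_2)$. -/

import Mathlib

namespace CubicalSum

/-- `P ⊆ ℝⁿ` is a `k`-polytope: the convex hull of a finite nonempty set, of affine dimension `k`. -/
def IsPolytope {n : ℕ} (k : ℕ) (P : Set (Fin n → ℝ)) : Prop :=
  (∃ V : Set (Fin n → ℝ), V.Finite ∧ V.Nonempty ∧ P = convexHull ℝ V) ∧
    Module.finrank ℝ (vectorSpan ℝ P) = k

/-- The set of faces of `P`, ordered by inclusion: the empty set, and the subsets of `P` on which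
some linear functional attains its maximum over `P` (so `P` is a face of itself). -/
def faces {n : ℕ} (P : Set (Fin n → ℝ)) : Set (Set (Fin n → ℝ)) :=
  {F | IsExposed ℝ P F}

/-- The proper faces of `P`: all faces other than `P` (the empty face is included). -/
def properFaces {n : ℕ} (P : Set (Fin n → ℝ)) : Set (Set (Fin n → ℝ)) :=
  faces P \ {P}

/-- A facet of `P`: a nonempty face of dimension one less than that of `P`. -/
def IsFacet {n : ℕ} (P F : Set (Fin n → ℝ)) : Prop :=
  F ∈ faces P ∧ F.Nonempty ∧
    Module.finrank ℝ (vectorSpan ℝ F) + 1 = Module.finrank ℝ (vectorSpan ℝ P)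

/-- Combinatorial equivalence: the face lattices are isomorphic. -/
def CombEquiv {n m : ℕ} (P : Set (Fin n → ℝ)) (Q : Set (Fin m → ℝ)) : Prop :=
  Nonempty (↥(faces P) ≃o ↥(faces Q))

/-- `Q` is a realization of the `k`-cube: a `k`-polytope combinatorially equivalent to `[0,1]ᵏ`. -/
def IsCube {n : ℕ} (k : ℕ) (Q : Set (Fin n → ℝ)) : Prop :=
  IsPolytope k Q ∧ CombEquiv Q (Set.Icc (0 : Fin k → ℝ) 1)

/-- A cubical `d`-polytope: every (nonempty) proper face is combinatorially a cube. -/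
def IsCubicalPolytope {n : ℕ} (d : ℕ) (P : Set (Fin n → ℝ)) : Prop :=
  IsPolytope d P ∧ ∀ F ∈ properFaces P, F.Nonempty → ∃ k, IsCube k F

/-- A projective transformation `x ↦ (A x + b) / (cᵀ x + α)` of `ℝⁿ`, with
`det [[A, b], [cᵀ, α]] ≠ 0`. -/
structure ProjTransf (n : ℕ) where
  A : Matrix (Fin n) (Fin n) ℝ
  b : Fin n → ℝ
  c : Fin n → ℝ
  α : ℝ
  det_ne_zero :
    (Matrix.fromBlocks A (Matrix.of fun i (_ : Unit) => b i)
      (Matrix.of fun (_ : Unit) j => c j) (Matrix.of fun (_ _ : Unit) => α)).det ≠ 0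

/-- The denominator `cᵀ x + α`. -/
def ProjTransf.denom {n : ℕ} (φ : ProjTransf n) (x : Fin n → ℝ) : ℝ :=
  dotProduct φ.c x + φ.α

/-- The map `x ↦ (A x + b) / (cᵀ x + α)`; it is only applied to sets on which it is defined. -/
noncomputable def ProjTransf.map {n : ℕ} (φ : ProjTransf n) (x : Fin n → ℝ) : Fin n → ℝ :=
  (φ.denom x)⁻¹ • (φ.A.mulVec x + φ.b)

/-- `φ` is defined on all of `P`: no point of `P` is sent to infinity. -/
def ProjTransf.DefinedOn {n : ℕ} (φ : ProjTransf n) (P : Set (Fin n → ℝ)) : Prop :=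
  ∀ x ∈ P, φ.denom x ≠ 0

/-- A set `P ⊆ ℝᵏ` is projectively equivalent to a set `F` lying in a `k`-dimensional affine
subspace of `ℝⁿ`: for some affine identification `ι` of `ℝᵏ` with such a subspace, `F` is the image
under `ι` of the image of `P` under a projective transformation of `ℝᵏ` that is defined on `P`. -/
def ProjEquiv {k n : ℕ} (P : Set (Fin k → ℝ)) (F : Set (Fin n → ℝ)) : Prop :=
  ∃ φ : ProjTransf k, φ.DefinedOn P ∧
    ∃ ι : (Fin k → ℝ) →ᵃ[ℝ] (Fin n → ℝ), Function.Injective ι ∧ F = ι '' (φ.map '' P)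

/-- `P ∪ Q` is the connected sum of `P` and `Q` along `F`: the set `F = P ∩ Q` is a facet of both,
the union is convex, and its proper faces are exactly the proper faces of `P` or `Q` other
than `F`. -/
structure IsConnectedSum {n : ℕ} (P Q F : Set (Fin n → ℝ)) : Prop where
  facet_left : IsFacet P F
  facet_right : IsFacet Q F
  inter_eq : P ∩ Q = F
  convex : Convex ℝ (P ∪ Q)
  properFaces_eq : properFaces (P ∪ Q) = (properFaces P ∪ properFaces Q) \ {F}

/-- `IsTower d m T B U`: the set `T` is a `d`-tower of `m` cubes with bottom facet `B` and top facet
`U`. For `m = 1` it is a `d`-cube with two opposite (equivalently, disjoint) facets `B` and `U`;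
for larger `m` it arises from a tower of `m - 1` cubes by stacking a `d`-cube on its top facet, the
new top facet being the facet of that cube opposite to the old one. -/
inductive IsTower {n : ℕ} (d : ℕ) :
    ℕ → Set (Fin n → ℝ) → Set (Fin n → ℝ) → Set (Fin n → ℝ) → Prop
  | cube {Q B U : Set (Fin n → ℝ)} (hQ : IsCube d Q) (hB : IsFacet Q B) (hU : IsFacet Q U)
      (hBU : Disjoint B U) : IsTower d 1 Q B U
  | stack {m : ℕ} {T Q B U U' : Set (Fin n → ℝ)} (hT : IsTower d m T B U) (hQ : IsCube d Q)
      (hTQ : IsConnectedSum T Q U) (hU' : IsFacet Q U') (hUU' : Disjoint U U') :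
      IsTower d (m + 1) (T ∪ Q) B U'

end CubicalSum

open CubicalSum

/-!
Two `(d - 1)`-cubes are joined by a tower in three moves: both are cut down to parallelotopes, one
pair of opposite facets at a time, and the parallelotopes, being affinely equivalent to the unit
cube, are joined by a prism.

A full-dimensional cube `X` is given by pairs of inequalities `0 ≤ h i true`, `0 ≤ h i false` such
that opposite constraints are never active together and every choice of one constraint from each
pair is active at some point (`CubeSystem`). Conversely, a compact set with such a description is a
cube (`CubeSystem.isCube_of_isCompact`), since its nonempty faces correspond to the partial choices
of constraints. If `ε > 0` is so small that `h i true = ε` separates the two facets of the `i`-th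
pair, then `X` and its part `h i true ≤ ε` are the bottom and, up to an affine map, the top of a
cube of one dimension more: the set of all `(t, x)` with `x ∈ X`, `0 ≤ t ≤ h i false x` and
`t ≤ h i false x - c * (ε - h i true x)`, for a small `c > 0` (`CubeSystem.exists_cut`). After one cut for
each `i`, what remains is `{x | ∀ i, 0 ≤ h i true x ≤ ε i}`, a parallelotope. For `d = n + 1` this
gives a chain of `n + 1 + n` cubes, consecutive ones having projectively equivalent facets.

Such cubes can be stacked, and the given cubical polytopes attached, by `exists_projective_gluing`:
if facets `F` of `P` and `G` of `Q` are projectively equivalent, then some projective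
transformation carries `G` to `F` and squeezes the rest of `Q` so closely to a relative interior
point of `F` that all inequalities of `P` other than that of `F` hold strictly on the image of `Q`
outside `F`, and conversely. This strictness makes the union a connected sum
(`Glued.isConnectedSum`). Projective maps are handled as linear maps in homogeneous coordinates
with positive denominators (`pmap`, `PosOn`); they preserve faces, dimensions, connected sums and
towers.
-/

namespace CubicalSum

open Set Filter Topology

/-! ### Affine functionals and exposed faces -/

lemma affine_combo {n : ℕ} (a : (Fin n → ℝ) →ᵃ[ℝ] ℝ) (x y : Fin n → ℝ) {s t : ℝ}
    (h : s + t = 1) : a (s • x + t • y) = s * a x + t * a y := by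
  simpa using Convex.combo_affine_apply (f := a) h

lemma affine_extend {n : ℕ} (a : (Fin n → ℝ) →ᵃ[ℝ] ℝ) (x y : Fin n → ℝ) (t : ℝ) :
    a (x + t • (x - y)) = a x + t * (a x - a y) := by
  have h : x + t • (x - y) = (1 + t) • x + (-t) • y := by module
  rw [h, affine_combo a x y (by ring)]
  ring

lemma linear_sub_apply {n : ℕ} (a : (Fin n → ℝ) →ᵃ[ℝ] ℝ) (x y : Fin n → ℝ) :
    a.linear (x - y) = a x - a y := by
  rw [← vsub_eq_sub x y, a.linearMap_vsub, vsub_eq_sub]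

lemma convex_setOf_nonneg {n : ℕ} (a : (Fin n → ℝ) →ᵃ[ℝ] ℝ) : Convex ℝ {x | 0 ≤ a x} :=
  (convex_Ici (0 : ℝ)).affine_preimage a

lemma continuous_affine {n : ℕ} (a : (Fin n → ℝ) →ᵃ[ℝ] ℝ) : Continuous a :=
  a.continuous_of_finiteDimensional

/-- Faces described by affine functionals: the functional `a` is the defect `max l - l` of an
exposing linear functional `l`. A strictly positive `a` gives the empty face. -/
lemma mem_faces_iff {n : ℕ} {P E : Set (Fin n → ℝ)} :
    E ∈ faces P ↔ ∃ a : (Fin n → ℝ) →ᵃ[ℝ] ℝ, (∀ x ∈ P, 0 ≤ a x) ∧ E = {x ∈ P | a x = 0} := by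
  constructor
  · intro hE
    rcases E.eq_empty_or_nonempty with rfl | ⟨x₀, hx₀⟩
    · exact ⟨AffineMap.const ℝ _ 1, by simp, by simp⟩
    · obtain ⟨l, rfl⟩ := hE ⟨x₀, hx₀⟩
      refine ⟨AffineMap.const ℝ _ (l x₀) - l.toLinearMap.toAffineMap, fun x hx => ?_, ?_⟩
      · simpa using hx₀.2 x hx
      · ext x
        simp only [mem_ofPred_eq]
        refine and_congr_right fun hx => ⟨fun h => ?_, fun h y hy => ?_⟩
        · have h1 := h x₀ hx₀.1
          have h2 := hx₀.2 x hx
          simp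
          linarith
        · have h2 := hx₀.2 y hy
          simp at h
          linarith
  · rintro ⟨a, ha, rfl⟩ ⟨x₀, hx₀⟩
    refine ⟨-a.linear.toContinuousLinearMap, ?_⟩
    have key : ∀ x y, a.linear x - a.linear y = a x - a y := fun x y => by
      rw [← map_sub, linear_sub_apply]
    ext x
    simp only [mem_ofPred_eq]
    refine and_congr_right fun hx => ⟨fun h y hy => ?_, fun h => ?_⟩
    · have h1 := key x y
      have h2 := ha y hy
      simp
      linarith
    · have h1 := key x x₀
      have h2 := h x₀ hx₀.1
      have h3 := ha x hx
      have h4 := hx₀.2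
      simp at h2
      linarith

lemma subset_of_mem_faces {n : ℕ} {P E : Set (Fin n → ℝ)} (h : E ∈ faces P) : E ⊆ P := by
  obtain ⟨a, -, rfl⟩ := mem_faces_iff.1 h
  exact sep_subset _ _

lemma self_mem_faces {n : ℕ} (P : Set (Fin n → ℝ)) : P ∈ faces P :=
  mem_faces_iff.2 ⟨0, by simp, by simp⟩

lemma empty_mem_faces {n : ℕ} (P : Set (Fin n → ℝ)) : ∅ ∈ faces P :=
  mem_faces_iff.2 ⟨AffineMap.const ℝ _ 1, by simp, by simp⟩

lemma inter_mem_faces {n : ℕ} {P E E' : Set (Fin n → ℝ)} (h : E ∈ faces P) (h' : E' ∈ faces P) :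
    E ∩ E' ∈ faces P := by
  obtain ⟨a, ha, rfl⟩ := mem_faces_iff.1 h
  obtain ⟨a', ha', rfl⟩ := mem_faces_iff.1 h'
  refine mem_faces_iff.2 ⟨a + a', fun x hx => by simpa using add_nonneg (ha x hx) (ha' x hx), ?_⟩
  ext x
  simp only [mem_inter_iff, mem_ofPred_eq, AffineMap.coe_add, Pi.add_apply]
  constructor
  · rintro ⟨⟨hx, h1⟩, -, h2⟩
    exact ⟨hx, by rw [h1, h2, add_zero]⟩
  · rintro ⟨hx, h1⟩
    have := ha x hx
    have := ha' x hx
    exact ⟨⟨hx, by linarith⟩, hx, by linarith⟩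

lemma convex_of_mem_faces {n : ℕ} {P E : Set (Fin n → ℝ)} (hP : Convex ℝ P) (h : E ∈ faces P) :
    Convex ℝ E := by
  obtain ⟨a, ha, rfl⟩ := mem_faces_iff.1 h
  intro x hx y hy s t hs ht hst
  refine ⟨hP hx.1 hy.1 hs ht hst, ?_⟩
  rw [affine_combo a x y hst, hx.2, hy.2]
  ring

/-- Finitely many affine functionals that are nonnegative on a convex set, each of them positive
somewhere on it, are simultaneously positive at some point. -/
lemma exists_forall_pos {n : ℕ} {K : Type*} [Finite K] {E : Set (Fin n → ℝ)} (hE : Convex ℝ E)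
    (hne : E.Nonempty) (h : K → (Fin n → ℝ) →ᵃ[ℝ] ℝ) (h0 : ∀ k, ∀ x ∈ E, 0 ≤ h k x)
    (hpos : ∀ k, ∃ x ∈ E, 0 < h k x) : ∃ x ∈ E, ∀ k, 0 < h k x := by
  suffices H : ∀ s : Set K, s.Finite → ∃ x ∈ E, ∀ k ∈ s, 0 < h k x by
    obtain ⟨x, hx, H⟩ := H univ finite_univ
    exact ⟨x, hx, fun k => H k (mem_univ k)⟩
  intro s hs
  induction s, hs using Set.Finite.induction_on with
  | empty => obtain ⟨x, hx⟩ := hne; exact ⟨x, hx, by simp⟩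
  | @insert k s _ _ ih =>
    obtain ⟨x, hx, hxs⟩ := ih
    obtain ⟨y, hy, hyk⟩ := hpos k
    refine ⟨(1 / 2 : ℝ) • x + (1 / 2 : ℝ) • y,
      hE hx hy (by norm_num) (by norm_num) (by norm_num), ?_⟩
    intro j hj
    rw [affine_combo _ _ _ (by norm_num)]
    have := h0 j x hx
    have := h0 j y hy
    rcases hj with rfl | hj
    · linarith
    · have := hxs j hj
      linarith

/-- A point at which finitely many functionals are positive can be pushed a little away from
any other point without losing positivity. -/
lemma exists_extend_pos {n : ℕ} {K : Type*} [Finite K] (h : K → (Fin n → ℝ) →ᵃ[ℝ] ℝ)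
    {z : Fin n → ℝ} (hz : ∀ k, 0 < h k z) (y : Fin n → ℝ) :
    ∃ ε : ℝ, 0 < ε ∧ ∀ k, 0 < h k (z + ε • (z - y)) := by
  have H : ∀ᶠ ε in 𝓝[>] (0 : ℝ), ∀ k, 0 < h k (z + ε • (z - y)) := by
    refine eventually_all.2 fun k => ?_
    have hc : Continuous fun ε : ℝ => h k (z + ε • (z - y)) :=
      (continuous_affine (h k)).comp (by fun_prop)
    have ht : Tendsto (fun ε : ℝ => h k (z + ε • (z - y))) (𝓝[>] 0) (𝓝 (h k z)) := by
      have := (hc.tendsto 0).mono_left (nhdsWithin_le_nhds (s := Ioi 0))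
      simpa using this
    exact ht.eventually (lt_mem_nhds (hz k))
  obtain ⟨ε, hε, hε'⟩ := (H.and self_mem_nhdsWithin).exists
  exact ⟨ε, hε', hε⟩

/-- If finitely many functionals are positive at `x`, but not all nonnegative at `y`, then on the
segment from `x` to `y` there is a point where all are nonnegative and one of them vanishes. -/
lemma exists_first_zero {n : ℕ} {K : Type*} [Finite K]
    (o : K → (Fin n → ℝ) →ᵃ[ℝ] ℝ) {x y : Fin n → ℝ} (hx : ∀ k, 0 < o k x)
    (hy : ∃ k, o k y < 0) :
    ∃ t : ℝ, 0 ≤ t ∧ t ≤ 1 ∧ (∀ k, 0 ≤ o k ((1 - t) • x + t • y)) ∧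
      ∃ k, o k ((1 - t) • x + t • y) = 0 := by
  obtain ⟨k₀, hk₀⟩ := hy
  have : Nonempty {k // o k y < 0} := ⟨⟨k₀, hk₀⟩⟩
  obtain ⟨⟨k, hk⟩, hmin⟩ :=
    Finite.exists_min fun k : {k // o k y < 0} => o k x / (o k x - o k y)
  have hxk := hx k
  have hd : 0 < o k x - o k y := by linarith
  refine ⟨o k x / (o k x - o k y), by positivity, ?_, fun j => ?_, k, ?_⟩
  · rw [div_le_one hd]; linarith
  · rw [affine_combo _ _ _ (by ring)]
    have hxj := hx j
    have ht : o k x / (o k x - o k y) ≤ 1 := by rw [div_le_one hd]; linarith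
    have ht0 : 0 ≤ o k x / (o k x - o k y) := by positivity
    rcases lt_or_ge (o j y) 0 with hj | hj
    · have h1 := hmin ⟨j, hj⟩
      simp only at h1
      rw [le_div_iff₀ (by linarith)] at h1
      linarith
    · nlinarith
  · rw [affine_combo _ _ _ (by ring)]
    field_simp
    ring

/-- Nonempty faces of a polyhedron are cut out by the constraints that are active on them: at a
point of the face where every other constraint is slack, the exposing functional cannot decrease
in any direction leading into the set of points with the same active constraints. -/
lemma exists_active_of_mem_faces {n : ℕ} {K : Type*} [Finite K]
    {A : AffineSubspace ℝ (Fin n → ℝ)} {h : K → (Fin n → ℝ) →ᵃ[ℝ] ℝ} {X E : Set (Fin n → ℝ)}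
    (hX : X = {x | x ∈ A ∧ ∀ k, 0 ≤ h k x}) (hE : E ∈ faces X) (hne : E.Nonempty) :
    ∃ S : Set K, E = {x ∈ X | ∀ k ∈ S, h k x = 0} := by
  have hXc : Convex ℝ X := by
    have : X = (A : Set (Fin n → ℝ)) ∩ ⋂ k, {x | 0 ≤ h k x} := by
      rw [hX]; ext; simp
    rw [this]
    exact A.convex.inter (convex_iInter fun k => convex_setOf_nonneg (h k))
  have hXA : ∀ x ∈ X, x ∈ A ∧ ∀ k, 0 ≤ h k x := fun x hx => by rwa [hX] at hx
  obtain ⟨a, ha, hEa⟩ := mem_faces_iff.1 hE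
  have hEX : E ⊆ X := subset_of_mem_faces hE
  let S : Set K := {k | ∀ x ∈ E, h k x = 0}
  obtain ⟨z, hzE, hz⟩ := exists_forall_pos (K := ↥Sᶜ) (convex_of_mem_faces hXc hE) hne
    (fun k => h k) (fun k x hx => (hXA x (hEX hx)).2 k) (fun k => by
      obtain ⟨k, hk⟩ := k
      simp only [S, mem_compl_iff, mem_ofPred_eq, not_forall] at hk
      obtain ⟨x, hx, hkx⟩ := hk
      exact ⟨x, hx, lt_of_le_of_ne ((hXA x (hEX hx)).2 k) (Ne.symm hkx)⟩)
  refine ⟨S, Subset.antisymm (fun x hx => ⟨hEX hx, fun k hk => hk x hx⟩) ?_⟩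
  rintro y ⟨hy, hyS⟩
  obtain ⟨ε, hε, hεk⟩ := exists_extend_pos (fun k : ↥Sᶜ => h k) hz y
  have hmem : z + ε • (z - y) ∈ X := by
    rw [hX]
    refine ⟨?_, fun k => ?_⟩
    · have h1 := AffineMap.lineMap_mem (-ε) (hXA z (hEX hzE)).1 (hXA y hy).1
      have h2 : AffineMap.lineMap z y (-ε) = z + ε • (z - y) := by
        rw [AffineMap.lineMap_apply_module]; module
      rwa [h2] at h1
    · by_cases hk : k ∈ S
      · rw [affine_extend, hk z hzE, hyS k hk]; simp
      · exact (hεk ⟨k, hk⟩).le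
  have h1 := ha _ hmem
  have hz0 : a z = 0 := by rw [hEa] at hzE; exact hzE.2
  rw [affine_extend, hz0] at h1
  rw [hEa]
  refine ⟨hy, le_antisymm ?_ (ha y hy)⟩
  by_contra hcon
  push Not at hcon
  nlinarith [mul_pos hε hcon]

/-- The points at which prescribed nonnegative functionals vanish form a face. -/
lemma setOf_active_mem_faces {n : ℕ} {K : Type*} [Finite K]
    {h : K → (Fin n → ℝ) →ᵃ[ℝ] ℝ} {X : Set (Fin n → ℝ)}
    (hX : ∀ x ∈ X, ∀ k, 0 ≤ h k x) (S : Set K) :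
    {x ∈ X | ∀ k ∈ S, h k x = 0} ∈ faces X := by
  induction S, S.toFinite using Set.Finite.induction_on with
  | empty => simpa using self_mem_faces X
  | @insert k S _ _ ih =>
    have h1 : {x ∈ X | h k x = 0} ∈ faces X := mem_faces_iff.2 ⟨h k, fun x hx => hX x hx k, rfl⟩
    convert inter_mem_faces h1 ih using 1
    ext x
    simp only [mem_insert_iff, forall_eq_or_imp, mem_ofPred_eq, mem_inter_iff]
    tauto

/-! ### Polytopes -/

lemma IsPolytope.isCompact {n k : ℕ} {P : Set (Fin n → ℝ)} (h : IsPolytope k P) :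
    IsCompact P := by
  obtain ⟨⟨V, hV, -, rfl⟩, -⟩ := h
  exact hV.isCompact_convexHull (𝕜 := ℝ)

lemma IsPolytope.convex {n k : ℕ} {P : Set (Fin n → ℝ)} (h : IsPolytope k P) : Convex ℝ P := by
  obtain ⟨⟨V, hV, -, rfl⟩, -⟩ := h
  exact convex_convexHull ℝ V

lemma IsPolytope.nonempty {n k : ℕ} {P : Set (Fin n → ℝ)} (h : IsPolytope k P) :
    P.Nonempty := by
  obtain ⟨⟨V, hV, hne, rfl⟩, -⟩ := h
  exact hne.mono (subset_convexHull ℝ V)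

lemma isPolytope_of_finite_extremePoints {n : ℕ} {X : Set (Fin n → ℝ)} (hc : IsCompact X)
    (hconv : Convex ℝ X) (hne : X.Nonempty) (hfin : (X.extremePoints ℝ).Finite) :
    IsPolytope (Module.finrank ℝ (vectorSpan ℝ X)) X := by
  refine ⟨⟨X.extremePoints ℝ, hfin, hc.extremePoints_nonempty hne, ?_⟩, rfl⟩
  conv_lhs => rw [← closure_convexHull_extremePoints hc hconv]
  exact (hfin.isClosed_convexHull (𝕜 := ℝ)).closure_eq

lemma IsPolytope.finite_extremePoints {n k : ℕ} {P : Set (Fin n → ℝ)} (h : IsPolytope k P) :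
    (P.extremePoints ℝ).Finite := by
  obtain ⟨⟨V, hV, -, rfl⟩, -⟩ := h
  exact hV.subset extremePoints_convexHull_subset

lemma extremePoints_subset_of_mem_faces {n : ℕ} {P E : Set (Fin n → ℝ)} (hE : E ∈ faces P) :
    E.extremePoints ℝ ⊆ P.extremePoints ℝ :=
  (IsExposed.isExtreme (𝕜 := ℝ) hE).extremePoints_subset_extremePoints

lemma isCompact_of_mem_faces {n : ℕ} {P E : Set (Fin n → ℝ)} (hP : IsCompact P)
    (hE : E ∈ faces P) : IsCompact E := by
  obtain ⟨a, -, rfl⟩ := mem_faces_iff.1 hE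
  exact hP.inter_right (isClosed_eq (continuous_affine a) continuous_const)

lemma IsPolytope.of_mem_faces {n k : ℕ} {P E : Set (Fin n → ℝ)} (hP : IsPolytope k P)
    (hE : E ∈ faces P) (hne : E.Nonempty) :
    IsPolytope (Module.finrank ℝ (vectorSpan ℝ E)) E :=
  isPolytope_of_finite_extremePoints (isCompact_of_mem_faces hP.isCompact hE)
    (convex_of_mem_faces hP.convex hE) hne
    (hP.finite_extremePoints.subset (extremePoints_subset_of_mem_faces hE))

lemma IsPolytope.finite_faces {n k : ℕ} {P : Set (Fin n → ℝ)} (hP : IsPolytope k P) :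
    (faces P).Finite := by
  refine Set.Finite.of_injOn (f := fun E => E.extremePoints ℝ)
    (t := 𝒫 (P.extremePoints ℝ)) ?_ ?_ hP.finite_extremePoints.finite_subsets
  · intro E hE
    exact extremePoints_subset_of_mem_faces hE
  · intro E hE E' hE' h
    have hh := fun (E : Set (Fin n → ℝ)) (hE : E ∈ faces P) =>
      closure_convexHull_extremePoints (isCompact_of_mem_faces hP.isCompact hE)
        (convex_of_mem_faces hP.convex hE)
    rw [← hh E hE, ← hh E' hE']
    simp only at h
    rw [h]

/-- The functional exposing `E` is constant on the affine hull of `E`, but not on `E'`. -/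
lemma finrank_lt_of_mem_faces {n : ℕ} {X E E' : Set (Fin n → ℝ)} (hE : E ∈ faces X)
    (hne : E.Nonempty) (hE' : E' ⊆ X) (hlt : E ⊂ E') :
    Module.finrank ℝ (vectorSpan ℝ E) < Module.finrank ℝ (vectorSpan ℝ E') := by
  obtain ⟨a, ha, hEa⟩ := mem_faces_iff.1 hE
  obtain ⟨x₀, hx₀⟩ := hne
  have hle : vectorSpan ℝ E ≤ vectorSpan ℝ E' := vectorSpan_mono ℝ hlt.1
  refine lt_of_le_of_ne (Submodule.finrank_mono hle) fun heq => hlt.2 fun x hx => ?_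
  have hspan := Submodule.eq_of_le_of_finrank_eq hle heq
  have h0 : ∀ v ∈ vectorSpan ℝ E, a.linear v = 0 := by
    intro v hv
    have : vectorSpan ℝ E ≤ LinearMap.ker a.linear := by
      rw [vectorSpan_def, Submodule.span_le]
      rintro _ ⟨p, hp, q, hq, rfl⟩
      rw [hEa] at hp hq
      change a.linear (p - q) = 0
      rw [linear_sub_apply, hp.2, hq.2, sub_zero]
    exact this hv
  have h1 : x -ᵥ x₀ ∈ vectorSpan ℝ E := by
    rw [hspan]; exact vsub_mem_vectorSpan ℝ hx (hlt.1 hx₀)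
  have h2 := h0 _ h1
  rw [a.linearMap_vsub, vsub_eq_sub] at h2
  rw [hEa] at hx₀ ⊢
  exact ⟨hE' hx, by rw [hx₀.2] at h2; linarith⟩

lemma IsFacet.ne {n : ℕ} {P F : Set (Fin n → ℝ)} (h : IsFacet P F) : F ≠ P := by
  rintro rfl
  have := h.2.2
  omega

lemma IsFacet.mem_properFaces {n : ℕ} {P F : Set (Fin n → ℝ)} (h : IsFacet P F) :
    F ∈ properFaces P := ⟨h.1, h.ne⟩

/-- Facets are maximal proper faces. -/
lemma IsFacet.eq_of_subset {n : ℕ} {P F E : Set (Fin n → ℝ)} (h : IsFacet P F)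
    (hE : E ∈ properFaces P) (hFE : F ⊆ E) : E = F := by
  by_contra hne
  have h1 := finrank_lt_of_mem_faces h.1 h.2.1 (subset_of_mem_faces hE.1)
    (hFE.ssubset_of_ne (Ne.symm hne))
  have h2 := finrank_lt_of_mem_faces hE.1 (h.2.1.mono hFE) subset_rfl
    ((subset_of_mem_faces hE.1).ssubset_of_ne hE.2)
  have := h.2.2
  omega

lemma vectorSpan_eq_top_of_finrank {n : ℕ} {P : Set (Fin n → ℝ)}
    (h : Module.finrank ℝ (vectorSpan ℝ P) = n) : vectorSpan ℝ P = ⊤ :=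
  Submodule.eq_top_of_finrank_eq (by simpa using h)

lemma IsPolytope.affineSpan_eq_top {n : ℕ} {P : Set (Fin n → ℝ)} (h : IsPolytope n P) :
    affineSpan ℝ P = ⊤ :=
  (AffineSubspace.affineSpan_eq_top_iff_vectorSpan_eq_top_of_nonempty ℝ _ _ h.nonempty).2
    (vectorSpan_eq_top_of_finrank h.2)

lemma IsPolytope.interior_nonempty {n : ℕ} {P : Set (Fin n → ℝ)} (h : IsPolytope n P) :
    (interior P).Nonempty :=
  h.convex.interior_nonempty_iff_affineSpan_eq_top.2 h.affineSpan_eq_top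

lemma affine_eq_zero_of_affineSpan {n : ℕ} {P : Set (Fin n → ℝ)} (h : affineSpan ℝ P = ⊤)
    (a : (Fin n → ℝ) →ᵃ[ℝ] ℝ) (ha : ∀ x ∈ P, a x = 0) : a = 0 := by
  ext x
  have hx : x ∈ affineSpan ℝ P := by rw [h]; trivial
  induction hx using affineSpan_induction' with
  | mem y hy => simpa using ha y hy
  | smul_vsub_vadd c u hu v hv w hw ihu ihv ihw =>
    simp only [AffineMap.coe_zero, Pi.zero_apply] at *
    rw [a.map_vadd, map_smul, a.linearMap_vsub, ihu, ihv, ihw]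
    simp

/-- A point of a full-dimensional convex set that is not an interior point lies in a proper face. -/
lemma exists_properFace_of_notMem_interior {n : ℕ} {X : Set (Fin n → ℝ)} (hc : Convex ℝ X)
    (hint : (interior X).Nonempty) {z : Fin n → ℝ} (hz : z ∈ X) (hzi : z ∉ interior X) :
    ∃ E ∈ properFaces X, z ∈ E := by
  obtain ⟨f, hf⟩ := geometric_hahn_banach_open_point hc.interior isOpen_interior hzi
  have hle : ∀ x ∈ X, f x ≤ f z := by
    intro x hx
    have hx' : x ∈ closure (interior X) := by
      rw [hc.closure_interior_eq_closure_of_nonempty_interior hint]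
      exact subset_closure hx
    have : closure (interior X) ⊆ {x | f x ≤ f z} :=
      closure_minimal (fun y hy => (hf y hy).le) (isClosed_le f.continuous continuous_const)
    exact this hx'
  refine ⟨{x ∈ X | ∀ y ∈ X, f y ≤ f x}, ⟨fun _ => ⟨f, rfl⟩, fun h => ?_⟩, hz, hle⟩
  obtain ⟨x, hx⟩ := hint
  have hx' : x ∈ {x ∈ X | ∀ y ∈ X, f y ≤ f x} := by rw [h]; exact interior_subset hx
  exact absurd (hf x hx) (not_lt.2 (hx'.2 z hz))

/-- A family of valid inequalities describes a full-dimensional compact convex set as soon as every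
nonempty proper face lies in the zero set of one of them: a ray leaving the set crosses the zero set
of a functional which is positive at the starting point. -/
lemma eq_setOf_nonneg_of_cover {n : ℕ} {K : Type*} {X : Set (Fin n → ℝ)}
    (hX : IsCompact X) (hc : Convex ℝ X) (hint : (interior X).Nonempty)
    (h : K → (Fin n → ℝ) →ᵃ[ℝ] ℝ) (h0 : ∀ x ∈ X, ∀ k, 0 ≤ h k x)
    {x₀ : Fin n → ℝ} (hx₀ : x₀ ∈ X) (hpos : ∀ k, 0 < h k x₀)
    (hcov : ∀ E ∈ properFaces X, E.Nonempty → ∃ k, ∀ x ∈ E, h k x = 0) :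
    X = {x | ∀ k, 0 ≤ h k x} := by
  refine Subset.antisymm (fun x hx => h0 x hx) fun y hy => ?_
  by_contra hyX
  let γ : ℝ → Fin n → ℝ := fun t => (1 - t) • x₀ + t • y
  have hγ : Continuous γ := by fun_prop
  have hcomp : IsCompact (Icc (0 : ℝ) 1 ∩ γ ⁻¹' X) :=
    isCompact_Icc.inter_right (hX.isClosed.preimage hγ)
  obtain ⟨t, ⟨⟨ht0, ht1⟩, htX⟩, htmax⟩ := hcomp.exists_isGreatest ⟨0, by simp [γ, hx₀]⟩
  have htlt : t < 1 := by
    refine lt_of_le_of_ne ht1 ?_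
    rintro rfl
    exact hyX (by simpa [γ] using htX)
  have hni : γ t ∉ interior X := by
    intro hi
    have h1 : ∀ᶠ s in 𝓝[>] t, γ s ∈ X ∧ s < 1 := by
      refine Filter.Eventually.and ?_ (mem_nhdsWithin_of_mem_nhds (Iio_mem_nhds htlt))
      have := (hγ.tendsto t).mono_left (nhdsWithin_le_nhds (s := Ioi t))
      exact this.eventually (mem_interior_iff_mem_nhds.1 hi)
    obtain ⟨s, ⟨hsX, hs1⟩, hst⟩ := (h1.and self_mem_nhdsWithin).exists
    have := htmax ⟨⟨ht0.trans (le_of_lt hst), hs1.le⟩, hsX⟩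
    exact absurd hst (not_lt.2 this)
  obtain ⟨E, hE, hzE⟩ := exists_properFace_of_notMem_interior hc hint htX hni
  obtain ⟨k, hk⟩ := hcov E hE ⟨_, hzE⟩
  have h1 := hk _ hzE
  simp only [γ] at h1
  rw [affine_combo _ _ _ (by ring)] at h1
  have h2 := hpos k
  have h3 := hy k
  have h4 : 0 < (1 - t) * h k x₀ := mul_pos (by linarith) h2
  have h5 : 0 ≤ t * h k y := mul_nonneg ht0 h3
  linarith

/-! ### Systems of inequalities describing cubes -/

/-- `CubeSystem A h X`: the set `X` is cut out of the affine subspace `A` by inequalities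
`0 ≤ h i b`, grouped into pairs `h i true`, `h i false` of opposite constraints, in the pattern of
the cube: opposite constraints are never active simultaneously, and every choice of one constraint
out of each pair is active at some point of `X`. -/
structure CubeSystem {n : ℕ} {ι : Type*} (A : AffineSubspace ℝ (Fin n → ℝ))
    (h : ι → Bool → (Fin n → ℝ) →ᵃ[ℝ] ℝ) (X : Set (Fin n → ℝ)) : Prop where
  eq : X = {x | x ∈ A ∧ ∀ i b, 0 ≤ h i b x}
  disj : ∀ x ∈ X, ∀ i, h i true x = 0 → h i false x ≠ 0
  vert : ∀ σ : ι → Bool, ∃ x ∈ X, ∀ i, h i (σ i) x = 0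

/-- The points of `X` at which the constraints selected by the partial choice `s` are active. -/
def cubeFace {n : ℕ} {ι : Type*} (h : ι → Bool → (Fin n → ℝ) →ᵃ[ℝ] ℝ) (X : Set (Fin n → ℝ))
    (s : ι → Option Bool) : Set (Fin n → ℝ) :=
  {x ∈ X | ∀ i b, s i = some b → h i b x = 0}

namespace CubeSystem

variable {n : ℕ} {ι : Type*} {A : AffineSubspace ℝ (Fin n → ℝ)}
  {h : ι → Bool → (Fin n → ℝ) →ᵃ[ℝ] ℝ} {X : Set (Fin n → ℝ)}

lemma nonneg (H : CubeSystem A h X) {x : Fin n → ℝ} (hx : x ∈ X) (i : ι) (b : Bool) :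
    0 ≤ h i b x := by
  rw [H.eq] at hx
  exact hx.2 i b

lemma mem_subspace (H : CubeSystem A h X) {x : Fin n → ℝ} (hx : x ∈ X) : x ∈ A := by
  rw [H.eq] at hx
  exact hx.1

lemma pos_of_eq_zero (H : CubeSystem A h X) {x : Fin n → ℝ} (hx : x ∈ X) {i : ι} {b : Bool}
    (h0 : h i b x = 0) : 0 < h i (!b) x := by
  refine lt_of_le_of_ne (H.nonneg hx _ _) fun h1 => ?_
  cases b
  · exact H.disj x hx i h1.symm h0
  · exact H.disj x hx i h0 h1.symm

lemma nonempty (H : CubeSystem A h X) : X.Nonempty := by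
  obtain ⟨x, hx, -⟩ := H.vert fun _ => true
  exact ⟨x, hx⟩

lemma convex (H : CubeSystem ⊤ h X) : Convex ℝ X := by
  have : X = ⋂ i, ⋂ b, {x | 0 ≤ h i b x} := by
    conv_lhs => rw [H.eq]
    ext; simp
  rw [this]
  exact convex_iInter fun i => convex_iInter fun b => convex_setOf_nonneg _

lemma exists_vertex (H : CubeSystem A h X) (s : ι → Option Bool) (d : ι → Bool) :
    ∃ x ∈ cubeFace h X s, ∀ i, s i = none → h i (d i) x = 0 := by
  obtain ⟨x, hx, h0⟩ := H.vert fun i => (s i).getD (d i)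
  refine ⟨x, ⟨hx, fun i b hib => ?_⟩, fun i hi => ?_⟩
  · simpa [hib] using h0 i
  · simpa [hi] using h0 i

lemma cubeFace_nonempty (H : CubeSystem A h X) (s : ι → Option Bool) :
    (cubeFace h X s).Nonempty := by
  obtain ⟨x, hx, -⟩ := H.exists_vertex s fun _ => true
  exact ⟨x, hx⟩

lemma cubeFace_subset_iff (H : CubeSystem A h X) {s t : ι → Option Bool} :
    cubeFace h X s ⊆ cubeFace h X t ↔ ∀ i b, t i = some b → s i = some b := by
  constructor
  · intro hst i b hi
    -- a vertex of the smaller face avoiding the constraint `h i b`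
    obtain ⟨x, hx, h0⟩ := H.exists_vertex s fun _ => !b
    have hib : h i b x = 0 := (hst hx).2 i b hi
    have hpos := H.pos_of_eq_zero hx.1 hib
    cases hs : s i with
    | none => exact absurd (h0 i hs) hpos.ne'
    | some c =>
      by_cases hc : c = b
      · rw [hc]
      · have : c = !b := by cases b <;> cases c <;> simp_all
        subst this
        exact absurd (hx.2 i _ hs) hpos.ne'
  · intro hst x hx
    exact ⟨hx.1, fun i b hi => hx.2 i b (hst i b hi)⟩

variable [Finite ι]

lemma cubeFace_mem_faces (H : CubeSystem A h X) (s : ι → Option Bool) :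
    cubeFace h X s ∈ faces X := by
  have := setOf_active_mem_faces (K := ι × Bool) (h := fun k => h k.1 k.2) (X := X)
    (fun x hx k => H.nonneg hx k.1 k.2) {k | s k.1 = some k.2}
  convert this using 1
  ext x
  simp [cubeFace]

lemma exists_cubeFace (H : CubeSystem A h X) {E : Set (Fin n → ℝ)} (hE : E ∈ faces X)
    (hne : E.Nonempty) : ∃ s, E = cubeFace h X s := by
  classical
  have heq : X = {x | x ∈ A ∧ ∀ k : ι × Bool, 0 ≤ h k.1 k.2 x} := by
    conv_lhs => rw [H.eq]
    ext x
    simp only [mem_ofPred_eq, Prod.forall]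
  obtain ⟨S, hS⟩ := exists_active_of_mem_faces heq hE hne
  obtain ⟨x₀, hx₀⟩ := hne
  rw [hS] at hx₀
  refine ⟨fun i => if (i, true) ∈ S then some true else
    if (i, false) ∈ S then some false else none, ?_⟩
  rw [hS]
  ext x
  simp only [cubeFace, mem_ofPred_eq]
  refine and_congr_right fun hx => ⟨fun hk i b hi => ?_, fun hk ⟨i, b⟩ hi => ?_⟩
  · split_ifs at hi with h1 h2
    · simp only [Option.some.injEq] at hi; subst hi; exact hk _ h1
    · simp only [Option.some.injEq] at hi; subst hi; exact hk _ h2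
  · refine hk i b ?_
    cases b
    · have h1 : (i, true) ∉ S := fun h1 =>
        H.disj x₀ hx₀.1 i (hx₀.2 _ h1) (hx₀.2 _ hi)
      simp [h1, hi]
    · simp [hi]

end CubeSystem

lemma nonempty_orderIso_of_surjective {C α β : Type*} [PartialOrder α] [PartialOrder β]
    (g : C → α) (g' : C → β) (hg : Function.Surjective g) (hg' : Function.Surjective g')
    (h : ∀ c c', g c ≤ g c' ↔ g' c ≤ g' c') : Nonempty (α ≃o β) := by
  refine ⟨⟨⟨fun a => g' (Function.surjInv hg a), fun b => g (Function.surjInv hg' b), fun a => ?_,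
    fun b => ?_⟩, fun {a a'} => ?_⟩⟩
  · have h1 := Function.surjInv_eq hg' (g' (Function.surjInv hg a))
    have h2 := Function.surjInv_eq hg a
    refine le_antisymm ?_ ?_
    · conv_rhs => rw [← h2]
      exact (h _ _).2 h1.le
    · conv_lhs => rw [← h2]
      exact (h _ _).2 h1.ge
  · have h1 := Function.surjInv_eq hg (g (Function.surjInv hg' b))
    have h2 := Function.surjInv_eq hg' b
    refine le_antisymm ?_ ?_
    · conv_rhs => rw [← h2]
      exact (h _ _).1 h1.le
    · conv_lhs => rw [← h2]
      exact (h _ _).1 h1.ge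
  · change g' _ ≤ g' _ ↔ _
    rw [← h, Function.surjInv_eq hg, Function.surjInv_eq hg]

namespace CubeSystem

/-- The face lattice of a set given by a cube system depends only on the index set: its nonempty
faces correspond to the partial choices of one constraint out of each pair. -/
lemma combEquiv {n m : ℕ} {ι : Type*} [Finite ι] {A : AffineSubspace ℝ (Fin n → ℝ)}
    {h : ι → Bool → (Fin n → ℝ) →ᵃ[ℝ] ℝ} {X : Set (Fin n → ℝ)}
    {A' : AffineSubspace ℝ (Fin m → ℝ)}
    {h' : ι → Bool → (Fin m → ℝ) →ᵃ[ℝ] ℝ} {X' : Set (Fin m → ℝ)}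
    (H : CubeSystem A h X) (H' : CubeSystem A' h' X') : CombEquiv X X' := by
  let g : Option (ι → Option Bool) → faces X := fun c =>
    c.elim ⟨∅, empty_mem_faces X⟩ fun s => ⟨cubeFace h X s, H.cubeFace_mem_faces s⟩
  let g' : Option (ι → Option Bool) → faces X' := fun c =>
    c.elim ⟨∅, empty_mem_faces X'⟩ fun s => ⟨cubeFace h' X' s, H'.cubeFace_mem_faces s⟩
  refine nonempty_orderIso_of_surjective g g' ?_ ?_ ?_
  · rintro ⟨E, hE⟩
    rcases E.eq_empty_or_nonempty with rfl | hne
    · exact ⟨none, rfl⟩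
    · obtain ⟨s, rfl⟩ := H.exists_cubeFace hE hne
      exact ⟨some s, rfl⟩
  · rintro ⟨E, hE⟩
    rcases E.eq_empty_or_nonempty with rfl | hne
    · exact ⟨none, rfl⟩
    · obtain ⟨s, rfl⟩ := H'.exists_cubeFace hE hne
      exact ⟨some s, rfl⟩
  · rintro (_ | s) (_ | t)
    · simp [g, g']
    · simp [g, g']
    · simp only [g, g', Option.elim, Subtype.mk_le_mk, subset_empty_iff]
      exact ⟨fun h0 => absurd h0 (H.cubeFace_nonempty s).ne_empty,
        fun h0 => absurd h0 (H'.cubeFace_nonempty s).ne_empty⟩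
    · exact H.cubeFace_subset_iff.trans H'.cubeFace_subset_iff.symm

lemma reindex {n : ℕ} {ι κ : Type*} {A : AffineSubspace ℝ (Fin n → ℝ)}
    {h : ι → Bool → (Fin n → ℝ) →ᵃ[ℝ] ℝ} {X : Set (Fin n → ℝ)} (H : CubeSystem A h X)
    (e : κ ≃ ι) : CubeSystem A (fun k => h (e k)) X where
  eq := by
    conv_lhs => rw [H.eq]
    ext x
    simp only [mem_ofPred_eq, ← e.forall_congr_right (q := fun i => ∀ b, 0 ≤ h i b x)]
  disj x hx k := H.disj x hx (e k)
  vert σ := by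
    obtain ⟨x, hx, h0⟩ := H.vert fun i => σ (e.symm i)
    exact ⟨x, hx, fun k => by simpa using h0 (e k)⟩

end CubeSystem

/-- The inequalities `0 ≤ x i` and `0 ≤ 1 - x i` of the unit cube. -/
noncomputable def unitCubeIneq (k : ℕ) (i : Fin k) (b : Bool) : (Fin k → ℝ) →ᵃ[ℝ] ℝ :=
  if b then (LinearMap.proj i).toAffineMap
  else AffineMap.const ℝ _ 1 - (LinearMap.proj i).toAffineMap

@[simp] lemma unitCubeIneq_true {k : ℕ} (i : Fin k) (x : Fin k → ℝ) :
    unitCubeIneq k i true x = x i := by simp [unitCubeIneq]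

@[simp] lemma unitCubeIneq_false {k : ℕ} (i : Fin k) (x : Fin k → ℝ) :
    unitCubeIneq k i false x = 1 - x i := by simp [unitCubeIneq]

lemma cubeSystem_unitCube (k : ℕ) : CubeSystem ⊤ (unitCubeIneq k) (Icc 0 1) where
  eq := by
    ext x
    simp only [mem_Icc, Pi.le_def, mem_ofPred_eq, AffineSubspace.mem_top, true_and,
      Bool.forall_bool, unitCubeIneq_true,
      unitCubeIneq_false, Pi.zero_apply, Pi.one_apply, sub_nonneg]
    rw [forall_and, and_comm]
  disj x _ i h := by simp only [unitCubeIneq_true] at h; simp [h]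
  vert σ := by
    refine ⟨fun i => if σ i then 0 else 1, ?_, fun i => ?_⟩
    · constructor <;> intro i <;> simp only [Pi.zero_apply, Pi.one_apply] <;> split_ifs <;> norm_num
    · cases h : σ i <;> simp [h]

namespace CubeSystem

variable {n : ℕ} {ι : Type*} {A : AffineSubspace ℝ (Fin n → ℝ)}
  {h : ι → Bool → (Fin n → ℝ) →ᵃ[ℝ] ℝ} {X : Set (Fin n → ℝ)}

/-- A cube system for a face: the selected constraints become equations, and their opposites can be
dropped, since no point of `X` can be reached at which such an opposite constraint turns active. -/
lemma cubeSystem_cubeFace [Finite ι] (H : CubeSystem A h X) (s : ι → Option Bool) :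
    ∃ A', CubeSystem A' (fun i : {i // s i = none} => h i) (cubeFace h X s) := by
  let A' : AffineSubspace ℝ (Fin n → ℝ) :=
    { carrier := {x | x ∈ A ∧ ∀ i b, s i = some b → h i b x = 0}
      smul_vsub_vadd_mem' := by
        intro c p q r hp hq hr
        refine ⟨A.smul_vsub_vadd_mem c hp.1 hq.1 hr.1, fun i b hi => ?_⟩
        rw [AffineMap.map_vadd, map_smul, AffineMap.linearMap_vsub, hp.2 i b hi, hq.2 i b hi,
          hr.2 i b hi]
        simp }
  refine ⟨A', ?_, fun x hx i => H.disj x hx.1 i, fun σ => ?_⟩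
  · refine Subset.antisymm (fun x hx =>
      ⟨⟨H.mem_subspace hx.1, hx.2⟩, fun i b => H.nonneg hx.1 i b⟩) ?_
    rintro y ⟨hyA, hy⟩
    obtain ⟨x, hx⟩ := H.cubeFace_nonempty s
    let o : {k : ι × Bool // s k.1 = some k.2} → (Fin n → ℝ) →ᵃ[ℝ] ℝ := fun k => h k.1.1 (!k.1.2)
    have hmem : ∀ z, z ∈ A' → (∀ i : {i // s i = none}, ∀ b, 0 ≤ h i b z) → (∀ k, 0 ≤ o k z) →
        z ∈ cubeFace h X s := by
      intro z hzA hz ho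
      refine ⟨?_, hzA.2⟩
      rw [H.eq]
      refine ⟨hzA.1, fun i b => ?_⟩
      cases hi : s i with
      | none => exact hz ⟨i, hi⟩ b
      | some c =>
        by_cases hc : b = c
        · subst hc; exact (hzA.2 i b hi).ge
        · have : b = !c := by cases b <;> cases c <;> simp_all
          subst this
          exact ho ⟨(i, c), hi⟩
    by_cases hneg : ∃ k, o k y < 0
    · exfalso
      obtain ⟨t, ht0, ht1, hto, k, hk⟩ := exists_first_zero o
        (fun k => H.pos_of_eq_zero hx.1 (hx.2 _ _ k.2)) hneg
      have hxA : x ∈ A' := ⟨H.mem_subspace hx.1, hx.2⟩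
      have hz : (1 - t) • x + t • y ∈ A' := by
        have := AffineMap.lineMap_mem t hxA hyA
        rwa [AffineMap.lineMap_apply_module] at this
      have hz' := hmem _ hz (fun i b => by
        rw [affine_combo _ _ _ (by ring)]
        have h1 := H.nonneg hx.1 i b
        have h2 := hy i b
        have : 0 ≤ 1 - t := by linarith
        positivity) hto
      exact (H.pos_of_eq_zero hz'.1 (hz'.2 _ _ k.2)).ne' hk
    · push Not at hneg
      exact hmem y hyA hy hneg
  · classical
    obtain ⟨x, hx, h0⟩ := H.exists_vertex s fun i => if hi : s i = none then σ ⟨i, hi⟩ else true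
    exact ⟨x, hx, fun i => by simpa [i.2] using h0 i i.2⟩

lemma cubeFace_update_ssubset [DecidableEq ι] (H : CubeSystem A h X) {s : ι → Option Bool} {i : ι}
    (hi : s i = none) (b : Bool) :
    cubeFace h X (Function.update s i (some b)) ⊂ cubeFace h X s := by
  refine ⟨H.cubeFace_subset_iff.2 fun j c hj => ?_, fun hsub => ?_⟩
  · rw [Function.update_of_ne]
    · exact hj
    · rintro rfl; simp [hi] at hj
  · have := H.cubeFace_subset_iff.1 hsub i b (by simp)
    simp [hi] at this

/-- The dimension of a face grows with the number of unselected pairs. -/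
lemma card_le_finrank [Fintype ι] (H : CubeSystem A h X) (s : ι → Option Bool) :
    (Finset.univ.filter fun i => s i = none).card ≤
      Module.finrank ℝ (vectorSpan ℝ (cubeFace h X s)) := by
  classical
  induction hk : (Finset.univ.filter fun i => s i = none).card generalizing s with
  | zero => exact Nat.zero_le _
  | succ k ih =>
    obtain ⟨i, hi⟩ : (Finset.univ.filter fun i => s i = none).Nonempty := by
      rw [← Finset.card_pos]; omega
    have hi' : s i = none := by simpa using hi
    have hcard :
        (Finset.univ.filter fun j => Function.update s i (some true) j = none).card = k := by
      have : (Finset.univ.filter fun j => Function.update s i (some true) j = none) =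
          (Finset.univ.filter fun j => s j = none).erase i := by
        ext j
        by_cases hj : j = i
        · subst hj; simp
        · simp [hj]
      rw [this, Finset.card_erase_of_mem hi]
      omega
    have h1 := ih _ hcard
    have h2 := finrank_lt_of_mem_faces (H.cubeFace_mem_faces _) (H.cubeFace_nonempty _)
      (subset_of_mem_faces (H.cubeFace_mem_faces s)) (H.cubeFace_update_ssubset hi' true)
    omega

lemma finrank_add_card_le [Fintype ι] (H : CubeSystem A h X) (s : ι → Option Bool) :
    Module.finrank ℝ (vectorSpan ℝ (cubeFace h X s)) +
      (Finset.univ.filter fun i => s i ≠ none).card ≤ Module.finrank ℝ (vectorSpan ℝ X) := by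
  classical
  induction hk : (Finset.univ.filter fun i => s i ≠ none).card generalizing s with
  | zero => exact Submodule.finrank_mono (vectorSpan_mono ℝ fun x hx => hx.1)
  | succ k ih =>
    obtain ⟨i, hi⟩ : (Finset.univ.filter fun i => s i ≠ none).Nonempty := by
      rw [← Finset.card_pos]; omega
    have hi' : s i ≠ none := by simpa using hi
    obtain ⟨b, hb⟩ := Option.ne_none_iff_exists'.1 hi'
    set s' := Function.update s i none with hs'
    have hss : s = Function.update s' i (some b) := by simp [hs', ← hb]
    have hcard : (Finset.univ.filter fun j => s' j ≠ none).card = k := by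
      have : (Finset.univ.filter fun j => s' j ≠ none) =
          (Finset.univ.filter fun j => s j ≠ none).erase i := by
        ext j
        by_cases hj : j = i
        · subst hj; simp [hs']
        · simp [hs', hj]
      rw [this, Finset.card_erase_of_mem hi]
      omega
    have h1 := ih _ hcard
    have h2 := finrank_lt_of_mem_faces (H.cubeFace_mem_faces s) (H.cubeFace_nonempty s)
      (subset_of_mem_faces (H.cubeFace_mem_faces s'))
      (by conv_lhs => rw [hss]
          exact H.cubeFace_update_ssubset (by simp [hs']) b)
    omega

/-- A polytope of the right dimension described by a cube system is a cube. -/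
lemma isCube {k : ℕ} [Fintype ι] (H : CubeSystem A h X) (hk : Fintype.card ι = k)
    (hX : IsPolytope k X) : IsCube k X := by
  let e : Fin k ≃ ι := (Fintype.equivFinOfCardEq hk).symm
  exact ⟨hX, (H.reindex e).combEquiv (cubeSystem_unitCube k)⟩

lemma exists_isCube_of_mem_faces [Fintype ι] {d : ℕ} (H : CubeSystem A h X)
    (hd : Fintype.card ι = d) (hX : IsPolytope d X) {E : Set (Fin n → ℝ)} (hE : E ∈ faces X)
    (hne : E.Nonempty) : ∃ k, IsCube k E := by
  classical
  obtain ⟨s, rfl⟩ := H.exists_cubeFace hE hne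
  obtain ⟨A', H'⟩ := H.cubeSystem_cubeFace s
  refine ⟨_, H'.isCube ?_ (hX.of_mem_faces hE hne)⟩
  rw [Fintype.card_subtype]
  have h1 := H.card_le_finrank s
  have h2 := H.finrank_add_card_le s
  have h3 := Finset.card_filter_add_card_filter_not (s := (Finset.univ : Finset ι))
    (fun i => s i = none)
  rw [hX.2] at h2
  rw [Finset.card_univ, hd] at h3
  simp only [ne_eq] at h2
  omega

end CubeSystem

/-- A full-dimensional cube is described by a cube system: the two functionals of a pair expose
faces corresponding to opposite facets of the unit cube. -/
lemma IsCube.exists_cubeSystem {n : ℕ} {X : Set (Fin n → ℝ)} (hX : IsCube n X) :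
    ∃ h : Fin n → Bool → (Fin n → ℝ) →ᵃ[ℝ] ℝ, CubeSystem ⊤ h X := by
  obtain ⟨hP, ⟨e⟩⟩ := hX
  have H₀ := cubeSystem_unitCube n
  set u := unitCubeIneq n
  let Q : Set (Fin n → ℝ) := Icc 0 1
  let fc : (Fin n → Option Bool) → faces Q := fun s => ⟨cubeFace u Q s, H₀.cubeFace_mem_faces s⟩
  let sg : Fin n → Bool → Fin n → Option Bool := fun i b =>
    Function.update (fun _ => none) i (some b)
  have hbot : ∀ E : faces X, (E : Set (Fin n → ℝ)) = ∅ ↔ (e E : Set (Fin n → ℝ)) = ∅ := by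
    intro E
    constructor
    · intro h
      have h1 : E ≤ e.symm ⟨∅, empty_mem_faces _⟩ := by
        change (E : Set (Fin n → ℝ)) ⊆ _
        rw [h]; exact empty_subset _
      exact subset_empty_iff.1 ((e.le_symm_apply).1 h1)
    · intro h
      have h1 : e E ≤ e ⟨∅, empty_mem_faces _⟩ := by
        change (e E : Set (Fin n → ℝ)) ⊆ _
        rw [h]; exact empty_subset _
      exact subset_empty_iff.1 (e.le_iff_le.1 h1)
  have hex : ∀ i b, ∃ a : (Fin n → ℝ) →ᵃ[ℝ] ℝ, (∀ x ∈ X, 0 ≤ a x) ∧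
      (e.symm (fc (sg i b)) : Set (Fin n → ℝ)) = {x ∈ X | a x = 0} := fun i b =>
    mem_faces_iff.1 (e.symm (fc (sg i b))).2
  choose h h0 hE using hex
  have hdisj : ∀ x ∈ X, ∀ i, h i true x = 0 → h i false x ≠ 0 := by
    intro x hx i h1 h2
    let E : faces X := ⟨_, inter_mem_faces (e.symm (fc (sg i true))).2 (e.symm (fc (sg i false))).2⟩
    have hxE : x ∈ (E : Set (Fin n → ℝ)) := by
      change x ∈ (_ ∩ _ : Set (Fin n → ℝ))
      rw [hE, hE]
      exact ⟨⟨hx, h1⟩, hx, h2⟩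
    have hEne : (e E : Set (Fin n → ℝ)).Nonempty := by
      rw [nonempty_iff_ne_empty, ne_eq, ← hbot]
      exact (nonempty_iff_ne_empty.1 ⟨x, hxE⟩)
    have hle : ∀ b, e E ≤ fc (sg i b) := by
      intro b
      rw [← e.le_symm_apply]
      cases b
      · exact inter_subset_right
      · exact inter_subset_left
    obtain ⟨y, hy⟩ := hEne
    have hy1 : y ∈ cubeFace u Q (sg i true) := hle true hy
    have hy2 : y ∈ cubeFace u Q (sg i false) := hle false hy
    exact H₀.disj y hy1.1 i (hy1.2 i true (by simp [sg])) (hy2.2 i false (by simp [sg]))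
  have hvert : ∀ σ : Fin n → Bool, ∃ x ∈ X, ∀ i, h i (σ i) x = 0 := by
    intro σ
    let E : faces X := e.symm (fc fun i => some (σ i))
    have hEne : (E : Set (Fin n → ℝ)).Nonempty := by
      rw [nonempty_iff_ne_empty, ne_eq, hbot]
      simp only [E, OrderIso.apply_symm_apply]
      exact (H₀.cubeFace_nonempty _).ne_empty
    obtain ⟨x, hx⟩ := hEne
    refine ⟨x, subset_of_mem_faces E.2 hx, fun i => ?_⟩
    have hle : E ≤ e.symm (fc (sg i (σ i))) := by
      refine e.symm.monotone ?_
      change cubeFace u Q _ ⊆ cubeFace u Q _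
      rw [H₀.cubeFace_subset_iff]
      intro j b hj
      by_cases hji : j = i
      · subst hji; simpa [sg] using hj
      · simp [sg, hji] at hj
    have := hle hx
    change x ∈ (e.symm (fc (sg i (σ i))) : Set (Fin n → ℝ)) at this
    rw [hE] at this
    exact this.2
  have hcov : ∀ E ∈ properFaces X, E.Nonempty → ∃ k : Fin n × Bool, ∀ x ∈ E, h k.1 k.2 x = 0 := by
    rintro E ⟨hEf, hEX⟩ hne
    let E' : faces X := ⟨E, hEf⟩
    have hne' : (e E' : Set (Fin n → ℝ)).Nonempty := by
      rw [nonempty_iff_ne_empty, ne_eq, ← hbot]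
      exact hne.ne_empty
    obtain ⟨s, hs⟩ := H₀.exists_cubeFace (e E').2 hne'
    have hs' : e E' = fc s := Subtype.ext hs
    obtain ⟨i, hi⟩ : ∃ i, s i ≠ none := by
      by_contra hcon
      push Not at hcon
      refine hEX (Subset.antisymm (subset_of_mem_faces hEf) ?_)
      have h1 : (⟨X, self_mem_faces X⟩ : faces X) ≤ E' := by
        rw [← e.le_iff_le, hs']
        change _ ⊆ cubeFace u Q s
        refine (subset_of_mem_faces (e _).2).trans fun x hx => ⟨hx, fun i b hib => ?_⟩
        simp [hcon i] at hib
      exact h1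
    obtain ⟨b, hb⟩ := Option.ne_none_iff_exists'.1 hi
    refine ⟨(i, b), fun x hx => ?_⟩
    have hle : E' ≤ e.symm (fc (sg i b)) := by
      rw [e.le_symm_apply, hs']
      change cubeFace u Q _ ⊆ cubeFace u Q _
      rw [H₀.cubeFace_subset_iff]
      intro j c hj
      by_cases hji : j = i
      · subst hji; simp [sg] at hj; rw [hb, hj]
      · simp [sg, hji] at hj
    have := hle hx
    change x ∈ (e.symm (fc (sg i b)) : Set (Fin n → ℝ)) at this
    rw [hE] at this
    exact this.2
  obtain ⟨x₀, hx₀, hpos⟩ := exists_forall_pos (K := Fin n × Bool) hP.convex hP.nonempty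
    (fun k => h k.1 k.2) (fun k x hx => h0 k.1 k.2 x hx) (fun ⟨i, b⟩ => by
      obtain ⟨x, hx, hv⟩ := hvert fun _ => !b
      refine ⟨x, hx, lt_of_le_of_ne (h0 i b x hx) fun hb => ?_⟩
      have h1 := hdisj x hx i
      have h2 := hv i
      cases b
      · exact h1 h2 hb.symm
      · exact h1 hb.symm h2)
  refine ⟨h, ?_, hdisj, hvert⟩
  have := eq_setOf_nonneg_of_cover hP.isCompact hP.convex hP.interior_nonempty
    (fun k : Fin n × Bool => h k.1 k.2) (fun x hx k => h0 k.1 k.2 x hx) hx₀ hpos hcov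
  conv_lhs => rw [this]
  ext x
  simp

lemma IsCube.isCubicalPolytope {n : ℕ} {X : Set (Fin n → ℝ)} (hX : IsCube n X) :
    IsCubicalPolytope n X := by
  obtain ⟨h, H⟩ := hX.exists_cubeSystem
  exact ⟨hX.1, fun F hF hne => H.exists_isCube_of_mem_faces (by simp) hX.1 hF.1 hne⟩

/-- A compact set with interior described by a cube system is a cube; its extreme points are finite
in number since each is determined by the set of its active constraints. -/
lemma CubeSystem.isCube_of_isCompact {n : ℕ} {h : Fin n → Bool → (Fin n → ℝ) →ᵃ[ℝ] ℝ}
    {X : Set (Fin n → ℝ)} (H : CubeSystem ⊤ h X) (hc : IsCompact X) : IsCube n X := by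
  have hfin : (X.extremePoints ℝ).Finite := by
    refine Set.Finite.of_injOn (f := fun x => {k : Fin n × Bool | h k.1 k.2 x = 0}) (t := univ)
      (fun _ _ => mem_univ _) ?_ finite_univ
    intro x hx y hy hxy
    simp only at hxy
    have hact : ∀ i b, h i b x = 0 → h i b y = 0 := fun i b hib => by
      have : (i, b) ∈ {k : Fin n × Bool | h k.1 k.2 y = 0} := by rw [← hxy]; exact hib
      exact this
    obtain ⟨ε, hε, hpos⟩ := exists_extend_pos
      (fun k : {k : Fin n × Bool // h k.1 k.2 x ≠ 0} => h k.1.1 k.1.2)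
      (z := x) (fun k => lt_of_le_of_ne (H.nonneg hx.1 _ _) (Ne.symm k.2)) y
    have hmem : x + ε • (x - y) ∈ X := by
      rw [H.eq]
      refine ⟨trivial, fun i b => ?_⟩
      by_cases hib : h i b x = 0
      · rw [affine_extend, hib, hact i b hib]; simp
      · exact (hpos ⟨(i, b), hib⟩).le
    have hseg : x ∈ openSegment ℝ y (x + ε • (x - y)) := by
      refine ⟨ε / (1 + ε), 1 / (1 + ε), by positivity, by positivity, by field_simp; ring, ?_⟩
      have h1 : 1 + ε ≠ 0 := by positivity
      have : (ε / (1 + ε)) • y + (1 / (1 + ε)) • (x + ε • (x - y)) =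
          ((1 / (1 + ε)) * (1 + ε)) • x := by
        match_scalars <;> field_simp
        ring
      rw [this, one_div, inv_mul_cancel₀ h1, one_smul]
    exact (hx.2 hy.1 hmem hseg).symm
  have hP := isPolytope_of_finite_extremePoints hc H.convex H.nonempty hfin
  have hdim : Module.finrank ℝ (vectorSpan ℝ X) = n := by
    refine le_antisymm ?_ ?_
    · simpa using Submodule.finrank_le (vectorSpan ℝ X)
    · have := H.card_le_finrank fun _ => none
      have heq : cubeFace h X (fun _ => none) = X :=
        Subset.antisymm (fun x hx => hx.1) fun x hx => ⟨hx, fun i b hib => by cases hib⟩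
      rw [heq] at this
      simpa using this
  rw [hdim] at hP
  exact H.isCube (by simp) hP

/-! ### Projective maps in homogeneous coordinates -/

/-- The homogeneous linear functional `(x, t) ↦ t * a (x / t)` of an affine functional `a`. -/
noncomputable def homog {n : ℕ} (a : (Fin n → ℝ) →ᵃ[ℝ] ℝ) : (Fin n → ℝ) × ℝ →ₗ[ℝ] ℝ :=
  a.linear.comp (LinearMap.fst ℝ _ _) + a 0 • LinearMap.snd ℝ _ _

/-- The restriction of a linear functional to the affine hyperplane of points `(x, 1)`. -/
noncomputable def dehomog {n : ℕ} (η : (Fin n → ℝ) × ℝ →ₗ[ℝ] ℝ) : (Fin n → ℝ) →ᵃ[ℝ] ℝ :=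
  (η.comp (LinearMap.inl ℝ _ _)).toAffineMap + AffineMap.const ℝ _ (η (0, 1))

@[simp] lemma homog_mk_one {n : ℕ} (a : (Fin n → ℝ) →ᵃ[ℝ] ℝ) (x : Fin n → ℝ) :
    homog a (x, 1) = a x := by
  have := linear_sub_apply a x 0
  simp only [sub_zero] at this
  simp [homog, this]

@[simp] lemma dehomog_apply {n : ℕ} (η : (Fin n → ℝ) × ℝ →ₗ[ℝ] ℝ) (x : Fin n → ℝ) :
    dehomog η x = η (x, 1) := by
  simp [dehomog, ← map_add]

/-- The linear map `L` has positive denominator at the points of `S`. -/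
def PosOn {n m : ℕ} (L : (Fin n → ℝ) × ℝ →ₗ[ℝ] (Fin m → ℝ) × ℝ) (S : Set (Fin n → ℝ)) : Prop :=
  ∀ x ∈ S, 0 < (L (x, 1)).2

/-- The (partial) projective map `ℝⁿ → ℝᵐ` given by a linear map in homogeneous coordinates. -/
noncomputable def pmap {n m : ℕ} (L : (Fin n → ℝ) × ℝ →ₗ[ℝ] (Fin m → ℝ) × ℝ)
    (x : Fin n → ℝ) : Fin m → ℝ :=
  (L (x, 1)).2⁻¹ • (L (x, 1)).1

lemma PosOn.mono {n m : ℕ} {L : (Fin n → ℝ) × ℝ →ₗ[ℝ] (Fin m → ℝ) × ℝ} {S S' : Set (Fin n → ℝ)}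
    (h : PosOn L S) (hS : S' ⊆ S) : PosOn L S' := fun x hx => h x (hS hx)

lemma pmap_homogeneous {n m : ℕ} {L : (Fin n → ℝ) × ℝ →ₗ[ℝ] (Fin m → ℝ) × ℝ} {x : Fin n → ℝ}
    (h : 0 < (L (x, 1)).2) : L (x, 1) = (L (x, 1)).2 • (pmap L x, (1 : ℝ)) := by
  ext1
  · simp [pmap, smul_smul, mul_inv_cancel₀ h.ne']
  · simp

lemma mk_pmap {n m : ℕ} {L : (Fin n → ℝ) × ℝ →ₗ[ℝ] (Fin m → ℝ) × ℝ} {x : Fin n → ℝ}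
    (h : 0 < (L (x, 1)).2) : (pmap L x, (1 : ℝ)) = (L (x, 1)).2⁻¹ • L (x, 1) := by
  conv_rhs => rw [pmap_homogeneous h]
  simp [smul_smul, inv_mul_cancel₀ h.ne']

lemma linear_pmap {n m : ℕ} {L : (Fin n → ℝ) × ℝ →ₗ[ℝ] (Fin m → ℝ) × ℝ} {x : Fin n → ℝ}
    (h : 0 < (L (x, 1)).2) (a : (Fin m → ℝ) →ᵃ[ℝ] ℝ) :
    homog a (L (x, 1)) = (L (x, 1)).2 * a (pmap L x) := by
  conv_lhs => rw [pmap_homogeneous h]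
  rw [map_smul, homog_mk_one, smul_eq_mul]

lemma pmap_eq_of_smul {n m : ℕ} {L : (Fin n → ℝ) × ℝ →ₗ[ℝ] (Fin m → ℝ) × ℝ} {x : Fin n → ℝ}
    {y : Fin m → ℝ} {c : ℝ} (hc : 0 < c) (h : L (x, 1) = c • (y, (1 : ℝ))) :
    0 < (L (x, 1)).2 ∧ pmap L x = y := by
  have h1 : (L (x, 1)).2 = c := by rw [h]; simp
  refine ⟨by rw [h1]; exact hc, ?_⟩
  rw [pmap, h1, h]
  simp [smul_smul, inv_mul_cancel₀ hc.ne']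

section comp

variable {n m k : ℕ} {L : (Fin n → ℝ) × ℝ →ₗ[ℝ] (Fin m → ℝ) × ℝ}
  {L' : (Fin m → ℝ) × ℝ →ₗ[ℝ] (Fin k → ℝ) × ℝ} {S : Set (Fin n → ℝ)}

lemma comp_apply_pmap {x : Fin n → ℝ} (h : 0 < (L (x, 1)).2) :
    L' (pmap L x, 1) = (L (x, 1)).2⁻¹ • L' (L (x, 1)) := by
  rw [mk_pmap h, map_smul]

lemma PosOn.comp (h : PosOn L S) (h' : PosOn L' (pmap L '' S)) : PosOn (L' ∘ₗ L) S := by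
  intro x hx
  have h1 := h x hx
  have h2 := h' _ (mem_image_of_mem _ hx)
  rw [comp_apply_pmap h1] at h2
  simp only [Prod.smul_snd, smul_eq_mul] at h2
  exact (pos_iff_pos_of_mul_pos h2).1 (inv_pos.2 h1)

lemma pmap_comp (h : PosOn L S) {x : Fin n → ℝ} (hx : x ∈ S) :
    pmap (L' ∘ₗ L) x = pmap L' (pmap L x) := by
  have h1 := h x hx
  have h3 : (L (x, 1)).2 ≠ 0 := h1.ne'
  conv_rhs => rw [pmap, comp_apply_pmap h1]
  simp only [pmap, LinearMap.comp_apply, Prod.smul_snd, Prod.smul_fst, smul_eq_mul, smul_smul]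
  congr 1
  rw [mul_inv, inv_inv]
  field_simp

lemma PosOn.of_leftInverse {L' : (Fin m → ℝ) × ℝ →ₗ[ℝ] (Fin n → ℝ) × ℝ} (h : PosOn L S)
    (hL : L' ∘ₗ L = LinearMap.id) : PosOn L' (pmap L '' S) := by
  rintro _ ⟨x, hx, rfl⟩
  have h1 := h x hx
  rw [comp_apply_pmap h1, ← LinearMap.comp_apply, hL]
  simpa using h1

lemma pmap_leftInverse {L' : (Fin m → ℝ) × ℝ →ₗ[ℝ] (Fin n → ℝ) × ℝ} (h : PosOn L S)
    (hL : L' ∘ₗ L = LinearMap.id) {x : Fin n → ℝ} (hx : x ∈ S) : pmap L' (pmap L x) = x := by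
  rw [← pmap_comp h hx, hL]
  simp [pmap]

lemma image_pmap_leftInverse {L' : (Fin m → ℝ) × ℝ →ₗ[ℝ] (Fin n → ℝ) × ℝ} (h : PosOn L S)
    (hL : L' ∘ₗ L = LinearMap.id) : pmap L' '' (pmap L '' S) = S := by
  rw [image_image]
  conv_rhs => rw [← image_id S]
  exact image_congr fun x hx => pmap_leftInverse h hL hx

end comp

section transport

variable {n m : ℕ} {L : (Fin n → ℝ) × ℝ →ₗ[ℝ] (Fin m → ℝ) × ℝ} {S : Set (Fin n → ℝ)}

lemma exists_leftInverse (hL : Function.Injective L) :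
    ∃ L' : (Fin m → ℝ) × ℝ →ₗ[ℝ] (Fin n → ℝ) × ℝ, L' ∘ₗ L = LinearMap.id :=
  L.exists_leftInverse_of_injective (LinearMap.ker_eq_bot.2 hL)

lemma injOn_pmap (hL : Function.Injective L) (h : PosOn L S) : InjOn (pmap L) S := by
  obtain ⟨L', hL'⟩ := exists_leftInverse hL
  intro x hx y hy hxy
  rw [← pmap_leftInverse h hL' hx, hxy, pmap_leftInverse h hL' hy]

/-- Affine functionals are transported along `L` through their homogeneous versions; the positive
denominators preserve signs. -/
lemma image_pmap_mem_faces (hL : Function.Injective L) (h : PosOn L S) {E : Set (Fin n → ℝ)}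
    (hE : E ∈ faces S) : pmap L '' E ∈ faces (pmap L '' S) := by
  obtain ⟨L', hL'⟩ := exists_leftInverse hL
  obtain ⟨a, ha, rfl⟩ := mem_faces_iff.1 hE
  have key : ∀ x ∈ S, dehomog (homog a ∘ₗ L') (pmap L x) = (L (x, 1)).2⁻¹ * a x := by
    intro x hx
    have h1 := h x hx
    rw [dehomog_apply, LinearMap.comp_apply, comp_apply_pmap h1, ← LinearMap.comp_apply L' L, hL',
      map_smul, LinearMap.id_apply, homog_mk_one, smul_eq_mul]
  refine mem_faces_iff.2 ⟨dehomog (homog a ∘ₗ L'), ?_, ?_⟩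
  · rintro _ ⟨x, hx, rfl⟩
    rw [key x hx]
    exact mul_nonneg (inv_nonneg.2 (h x hx).le) (ha x hx)
  · ext y
    constructor
    · rintro ⟨x, ⟨hx, h0⟩, rfl⟩
      exact ⟨⟨x, hx, rfl⟩, by rw [key x hx, h0, mul_zero]⟩
    · rintro ⟨⟨x, hx, rfl⟩, h0⟩
      rw [key x hx] at h0
      exact ⟨x, ⟨hx, (mul_eq_zero.1 h0).resolve_left (inv_ne_zero (h x hx).ne')⟩, rfl⟩

lemma exists_of_mem_faces_image (h : PosOn L S) {E : Set (Fin m → ℝ)}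
    (hE : E ∈ faces (pmap L '' S)) : ∃ E' ∈ faces S, E = pmap L '' E' := by
  obtain ⟨a, ha, rfl⟩ := mem_faces_iff.1 hE
  have key : ∀ x ∈ S, dehomog (homog a ∘ₗ L) x = (L (x, 1)).2 * a (pmap L x) := by
    intro x hx
    rw [dehomog_apply, LinearMap.comp_apply, linear_pmap (h x hx)]
  refine ⟨{x ∈ S | dehomog (homog a ∘ₗ L) x = 0}, mem_faces_iff.2 ⟨_, fun x hx => ?_, rfl⟩, ?_⟩
  · rw [key x hx]
    exact mul_nonneg (h x hx).le (ha _ (mem_image_of_mem _ hx))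
  · ext y
    constructor
    · rintro ⟨⟨x, hx, rfl⟩, h0⟩
      exact ⟨x, ⟨hx, by rw [key x hx, h0, mul_zero]⟩, rfl⟩
    · rintro ⟨x, ⟨hx, h0⟩, rfl⟩
      rw [key x hx] at h0
      exact ⟨⟨x, hx, rfl⟩, (mul_eq_zero.1 h0).resolve_left (h x hx).ne'⟩

lemma image_pmap_subset_iff (hL : Function.Injective L) (h : PosOn L S) {E E' : Set (Fin n → ℝ)}
    (hE : E ⊆ S) (hE' : E' ⊆ S) : pmap L '' E ⊆ pmap L '' E' ↔ E ⊆ E' :=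
  (injOn_pmap hL h).image_subset_image_iff hE hE'

lemma properFaces_image_pmap (hL : Function.Injective L) (h : PosOn L S) :
    properFaces (pmap L '' S) = (fun E => pmap L '' E) '' properFaces S := by
  ext E
  constructor
  · rintro ⟨hE, hne⟩
    obtain ⟨E', hE', rfl⟩ := exists_of_mem_faces_image h hE
    exact ⟨E', ⟨hE', fun h => hne (by rw [show E' = S from h]; rfl)⟩, rfl⟩
  · rintro ⟨E', ⟨hE', hne⟩, rfl⟩
    refine ⟨image_pmap_mem_faces hL h hE', fun heq => hne ?_⟩
    refine Subset.antisymm (subset_of_mem_faces hE') ?_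
    exact (image_pmap_subset_iff hL h subset_rfl (subset_of_mem_faces hE')).1 (Eq.ge heq)

lemma combEquiv_image_pmap (hL : Function.Injective L) (h : PosOn L S) :
    CombEquiv S (pmap L '' S) := by
  refine nonempty_orderIso_of_surjective (C := faces S) id
    (fun E => ⟨pmap L '' E, image_pmap_mem_faces hL h E.2⟩) Function.surjective_id ?_ ?_
  · rintro ⟨E, hE⟩
    obtain ⟨E', hE', rfl⟩ := exists_of_mem_faces_image h hE
    exact ⟨⟨E', hE'⟩, rfl⟩
  · intro E E'
    exact (image_pmap_subset_iff hL h (subset_of_mem_faces E.2) (subset_of_mem_faces E'.2)).symm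

/-- The dimension of the linear hull of the cone over `S`. -/
lemma finrank_span_homogeneous (hne : S.Nonempty) :
    Module.finrank ℝ (Submodule.span ℝ ((fun x => (x, (1 : ℝ))) '' S)) =
      Module.finrank ℝ (vectorSpan ℝ S) + 1 := by
  obtain ⟨x₀, hx₀⟩ := hne
  let T : (Fin n → ℝ) × ℝ →ₗ[ℝ] (Fin n → ℝ) × ℝ :=
    (LinearMap.fst ℝ _ _ - (LinearMap.snd ℝ _ _).smulRight x₀).prod (LinearMap.snd ℝ _ _)
  have hT : ∀ p, T p = (p.1 - p.2 • x₀, p.2) := fun p => by simp [T]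
  have hTinj : Function.Injective T := by
    intro p q hpq
    rw [hT, hT, Prod.mk.injEq] at hpq
    obtain ⟨h1, h2⟩ := hpq
    rw [h2] at h1
    exact Prod.ext (sub_left_injective h1) h2
  have hmap : (Submodule.span ℝ ((fun x => (x, (1 : ℝ))) '' S)).map T =
      (vectorSpan ℝ S).prod ⊤ := by
    apply le_antisymm
    · rw [Submodule.map_span, Submodule.span_le]
      rintro _ ⟨_, ⟨x, hx, rfl⟩, rfl⟩
      rw [hT]
      simp only [one_smul]
      exact ⟨vsub_mem_vectorSpan ℝ hx hx₀, trivial⟩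
    · rintro ⟨v, t⟩ ⟨hv, -⟩
      have h1 : (vectorSpan ℝ S).map (LinearMap.inl ℝ (Fin n → ℝ) ℝ) ≤
          (Submodule.span ℝ ((fun x => (x, (1 : ℝ))) '' S)).map T := by
        rw [vectorSpan_eq_span_vsub_set_right ℝ hx₀, Submodule.map_span, Submodule.span_le]
        rintro _ ⟨_, ⟨x, hx, rfl⟩, rfl⟩
        refine ⟨(x, 1) - (x₀, 1), Submodule.sub_mem _ (Submodule.subset_span ⟨x, hx, rfl⟩)
          (Submodule.subset_span ⟨x₀, hx₀, rfl⟩), ?_⟩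
        rw [hT]; simp
      have h2 : ((0 : Fin n → ℝ), t) ∈
          (Submodule.span ℝ ((fun x => (x, (1 : ℝ))) '' S)).map T := by
        refine ⟨t • (x₀, 1), Submodule.smul_mem _ _ (Submodule.subset_span ⟨x₀, hx₀, rfl⟩), ?_⟩
        rw [hT]; simp
      have h3 := Submodule.add_mem _ (h1 ⟨v, hv, rfl⟩) h2
      simpa using h3
  have h1 := (Submodule.equivMapOfInjective T hTinj
    (Submodule.span ℝ ((fun x => (x, (1 : ℝ))) '' S))).finrank_eq
  let e : ((vectorSpan ℝ S).prod (⊤ : Submodule ℝ ℝ)) ≃ₗ[ℝ] vectorSpan ℝ S × ℝ :=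
    { toFun := fun p => (⟨p.1.1, p.2.1⟩, p.1.2)
      invFun := fun q => ⟨(q.1, q.2), ⟨q.1.2, trivial⟩⟩
      map_add' := fun _ _ => rfl
      map_smul' := fun _ _ => rfl
      left_inv := fun _ => rfl
      right_inv := fun _ => rfl }
  rw [h1, hmap, e.finrank_eq]
  simp

lemma span_image_pmap (h : PosOn L S) :
    Submodule.span ℝ ((fun x => (x, (1 : ℝ))) '' (pmap L '' S)) =
      (Submodule.span ℝ ((fun x => (x, (1 : ℝ))) '' S)).map L := by
  apply le_antisymm
  · rw [Submodule.span_le]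
    rintro _ ⟨_, ⟨x, hx, rfl⟩, rfl⟩
    change (pmap L x, (1 : ℝ)) ∈ _
    rw [mk_pmap (h x hx)]
    exact Submodule.smul_mem _ _ ⟨_, Submodule.subset_span ⟨x, hx, rfl⟩, rfl⟩
  · rw [Submodule.map_span, Submodule.span_le]
    rintro _ ⟨_, ⟨x, hx, rfl⟩, rfl⟩
    rw [pmap_homogeneous (h x hx)]
    exact Submodule.smul_mem _ _ (Submodule.subset_span ⟨_, ⟨x, hx, rfl⟩, rfl⟩)

lemma finrank_vectorSpan_image_pmap (hL : Function.Injective L) (h : PosOn L S) :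
    Module.finrank ℝ (vectorSpan ℝ (pmap L '' S)) = Module.finrank ℝ (vectorSpan ℝ S) := by
  rcases S.eq_empty_or_nonempty with rfl | hne
  · rw [image_empty, vectorSpan_empty, vectorSpan_empty, finrank_bot, finrank_bot]
  have h1 := finrank_span_homogeneous hne
  have h2 := finrank_span_homogeneous (hne.image (pmap L))
  rw [span_image_pmap h] at h2
  have h3 := (Submodule.equivMapOfInjective L hL
    (Submodule.span ℝ ((fun x => (x, (1 : ℝ))) '' S))).finrank_eq
  omega

lemma convex_image_pmap (hS : Convex ℝ S) (h : PosOn L S) : Convex ℝ (pmap L '' S) := by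
  rintro _ ⟨x, hx, rfl⟩ _ ⟨y, hy, rfl⟩ s t hs ht hst
  have hx1 := h x hx
  have hy1 := h y hy
  set p := (L (x, 1)).2
  set q := (L (y, 1)).2
  have hc : 0 < s / p + t / q := by
    rcases hs.eq_or_lt with rfl | hs'
    · have : t = 1 := by linarith
      subst this; simpa using hy1
    · have : 0 ≤ t / q := by positivity
      have : 0 < s / p := by positivity
      linarith
  set c := s / p + t / q
  refine ⟨(s / p / c) • x + (t / q / c) • y,
    hS hx hy (by positivity) (by positivity) (by rw [← add_div]; exact div_self hc.ne'), ?_⟩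
  refine (pmap_eq_of_smul (inv_pos.2 hc) ?_).2
  have h1 : ((s / p / c) • x + (t / q / c) • y, (1 : ℝ)) =
      c⁻¹ • ((s / p) • (x, (1 : ℝ)) + (t / q) • (y, (1 : ℝ))) := by
    ext1
    · simp only [Prod.smul_fst, Prod.fst_add]
      module
    · simp only [Prod.smul_snd, Prod.snd_add, smul_eq_mul, mul_one]
      exact (inv_mul_cancel₀ hc.ne').symm
  rw [h1, map_smul, map_add, map_smul, map_smul, pmap_homogeneous hx1, pmap_homogeneous hy1,
    smul_smul, smul_smul, div_mul_cancel₀ _ hx1.ne', div_mul_cancel₀ _ hy1.ne']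
  congr 1
  ext1
  · simp
  · simp [hst]

lemma PosOn.convexHull (h : PosOn L S) : PosOn L (convexHull ℝ S) := by
  have hc : Convex ℝ {x : Fin n → ℝ | 0 < dehomog (LinearMap.snd ℝ _ _ ∘ₗ L) x} :=
    (convex_Ioi (0 : ℝ)).affine_preimage _
  intro x hx
  have h1 := convexHull_min (fun y hy => by simpa using h y hy) hc hx
  simpa using h1

lemma image_pmap_convexHull (h : PosOn L S) :
    pmap L '' convexHull ℝ S = convexHull ℝ (pmap L '' S) := by
  apply Subset.antisymm
  · rintro _ ⟨x, hx, rfl⟩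
    have hconv : Convex ℝ {x | x ∈ convexHull ℝ S ∧ pmap L x ∈ convexHull ℝ (pmap L '' S)} := by
      intro x hx y hy s t hs ht hst
      refine ⟨convex_convexHull ℝ S hx.1 hy.1 hs ht hst, ?_⟩
      have hx1 := h.convexHull x hx.1
      have hy1 := h.convexHull y hy.1
      set p := (L (x, 1)).2
      set q := (L (y, 1)).2
      have hc : 0 < s * p + t * q := by
        rcases hs.eq_or_lt with rfl | hs'
        · have : t = 1 := by linarith
          subst this; simpa using hy1
        · have : 0 ≤ t * q := by positivity
          have : 0 < s * p := by positivity
          linarith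
      set c := s * p + t * q
      have h1 : (s • x + t • y, (1 : ℝ)) = s • (x, (1 : ℝ)) + t • (y, (1 : ℝ)) := by
        ext1
        · simp
        · simp [hst]
      have h2 : L (s • x + t • y, 1) =
          c • ((s * p / c) • pmap L x + (t * q / c) • pmap L y, (1 : ℝ)) := by
        rw [h1, map_add, map_smul, map_smul, pmap_homogeneous hx1, pmap_homogeneous hy1]
        ext1
        · simp only [Prod.smul_fst, Prod.fst_add, smul_add, smul_smul]
          rw [mul_div_cancel₀ _ hc.ne', mul_div_cancel₀ _ hc.ne']
        · simp [c]; rfl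
      rw [(pmap_eq_of_smul hc h2).2]
      exact convex_convexHull ℝ _ hx.2 hy.2 (by positivity) (by positivity)
        (by rw [← add_div]; exact div_self hc.ne')
    have hsub : S ⊆ {x | x ∈ convexHull ℝ S ∧ pmap L x ∈ convexHull ℝ (pmap L '' S)} :=
      fun y hy => ⟨subset_convexHull ℝ S hy, subset_convexHull ℝ _ (mem_image_of_mem _ hy)⟩
    exact (convexHull_min hsub hconv hx).2
  · exact convexHull_min (image_mono (subset_convexHull ℝ S))
      (convex_image_pmap (convex_convexHull ℝ S) h.convexHull)

lemma IsPolytope.image_pmap {k : ℕ} (hS : IsPolytope k S) (hL : Function.Injective L)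
    (h : PosOn L S) : IsPolytope k (pmap L '' S) := by
  refine ⟨?_, by rw [finrank_vectorSpan_image_pmap hL h, hS.2]⟩
  obtain ⟨⟨V, hV, hne, rfl⟩, -⟩ := hS
  exact ⟨pmap L '' V, hV.image _, hne.image _,
    image_pmap_convexHull (h.mono (subset_convexHull ℝ V))⟩

lemma CombEquiv.symm {P : Set (Fin n → ℝ)} {Q : Set (Fin m → ℝ)} (h : CombEquiv P Q) :
    CombEquiv Q P := h.map OrderIso.symm

lemma CombEquiv.trans {k : ℕ} {P : Set (Fin n → ℝ)} {Q : Set (Fin m → ℝ)} {R : Set (Fin k → ℝ)}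
    (h : CombEquiv P Q) (h' : CombEquiv Q R) : CombEquiv P R := by
  obtain ⟨e⟩ := h
  obtain ⟨e'⟩ := h'
  exact ⟨e.trans e'⟩

lemma IsCube.image_pmap {k : ℕ} (hS : IsCube k S) (hL : Function.Injective L)
    (h : PosOn L S) : IsCube k (pmap L '' S) :=
  ⟨hS.1.image_pmap hL h, (combEquiv_image_pmap hL h).symm.trans hS.2⟩

lemma IsFacet.image_pmap {F : Set (Fin n → ℝ)} (hF : IsFacet S F) (hL : Function.Injective L)
    (h : PosOn L S) : IsFacet (pmap L '' S) (pmap L '' F) := by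
  refine ⟨image_pmap_mem_faces hL h hF.1, hF.2.1.image _, ?_⟩
  rw [finrank_vectorSpan_image_pmap hL h,
    finrank_vectorSpan_image_pmap hL (h.mono (subset_of_mem_faces hF.1)), hF.2.2]

lemma IsCubicalPolytope.image_pmap {k : ℕ} (hS : IsCubicalPolytope k S)
    (hL : Function.Injective L) (h : PosOn L S) : IsCubicalPolytope k (pmap L '' S) := by
  refine ⟨hS.1.image_pmap hL h, fun E hE hne => ?_⟩
  rw [properFaces_image_pmap hL h] at hE
  obtain ⟨E', hE', rfl⟩ := hE
  obtain ⟨j, hj⟩ := hS.2 E' hE' hne.of_image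
  exact ⟨j, hj.image_pmap hL (h.mono (subset_of_mem_faces hE'.1))⟩

lemma IsConnectedSum.image_pmap {P Q F : Set (Fin n → ℝ)} (hS : IsConnectedSum P Q F)
    (hL : Function.Injective L) (h : PosOn L (P ∪ Q)) :
    IsConnectedSum (pmap L '' P) (pmap L '' Q) (pmap L '' F) where
  facet_left := hS.facet_left.image_pmap hL (h.mono subset_union_left)
  facet_right := hS.facet_right.image_pmap hL (h.mono subset_union_right)
  inter_eq := by
    rw [← hS.inter_eq, ← (injOn_pmap hL h).image_inter subset_union_left subset_union_right]
  convex := by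
    rw [← image_union]
    exact convex_image_pmap hS.convex h
  properFaces_eq := by
    have hinj : InjOn (fun E => pmap L '' E) (𝒫 (P ∪ Q)) := (injOn_pmap hL h).image
    have hP : properFaces P ⊆ 𝒫 (P ∪ Q) := fun E hE =>
      (subset_of_mem_faces hE.1).trans subset_union_left
    have hQ : properFaces Q ⊆ 𝒫 (P ∪ Q) := fun E hE =>
      (subset_of_mem_faces hE.1).trans subset_union_right
    have hF : F ∈ 𝒫 (P ∪ Q) := hP hS.facet_left.mem_properFaces
    rw [← image_union, properFaces_image_pmap hL h, hS.properFaces_eq,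
      properFaces_image_pmap hL (h.mono subset_union_left),
      properFaces_image_pmap hL (h.mono subset_union_right), ← image_union]
    ext E
    constructor
    · rintro ⟨E', ⟨hE', hne⟩, rfl⟩
      exact ⟨⟨E', hE', rfl⟩, fun heq => hne (hinj (union_subset hP hQ hE') hF heq)⟩
    · rintro ⟨⟨E', hE', rfl⟩, hne⟩
      exact ⟨E', ⟨hE', fun heq => hne (by rw [show E' = F from heq]; rfl)⟩, rfl⟩

lemma disjoint_image_pmap {E E' : Set (Fin n → ℝ)} (hL : Function.Injective L) (h : PosOn L S)
    (hE : E ⊆ S) (hE' : E' ⊆ S) (hd : Disjoint E E') : Disjoint (pmap L '' E) (pmap L '' E') := by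
  rw [disjoint_iff_inter_eq_empty, ← (injOn_pmap hL h).image_inter hE hE', hd.inter_eq, image_empty]

lemma IsTower.image_pmap {d k : ℕ} {T B U : Set (Fin n → ℝ)} (hT : IsTower d k T B U)
    (hL : Function.Injective L) (h : PosOn L T) :
    IsTower d k (pmap L '' T) (pmap L '' B) (pmap L '' U) := by
  induction hT with
  | cube hQ hB hU hBU =>
    refine .cube (hQ.image_pmap hL h) (hB.image_pmap hL h) (hU.image_pmap hL h) ?_
    exact disjoint_image_pmap hL h (subset_of_mem_faces hB.1) (subset_of_mem_faces hU.1) hBU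
  | stack hT hQ hTQ hU' hUU' ih =>
    have hQpos := h.mono subset_union_right
    rw [image_union]
    refine .stack (ih (h.mono subset_union_left)) (hQ.image_pmap hL hQpos) (hTQ.image_pmap hL h)
      (hU'.image_pmap hL hQpos) ?_
    exact disjoint_image_pmap hL hQpos (subset_of_mem_faces hTQ.facet_right.1)
      (subset_of_mem_faces hU'.1) hUU'

end transport

/-! ### Projective equivalence -/

/-- `T` is the image of `S` under an injective projective map, written in homogeneous coordinates
and with positive denominators on `S`. -/
def HomEquiv {n m : ℕ} (S : Set (Fin n → ℝ)) (T : Set (Fin m → ℝ)) : Prop :=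
  ∃ L : (Fin n → ℝ) × ℝ →ₗ[ℝ] (Fin m → ℝ) × ℝ,
    Function.Injective L ∧ PosOn L S ∧ T = pmap L '' S

lemma HomEquiv.trans {n m k : ℕ} {S : Set (Fin n → ℝ)} {T : Set (Fin m → ℝ)}
    {R : Set (Fin k → ℝ)} (h : HomEquiv S T) (h' : HomEquiv T R) : HomEquiv S R := by
  obtain ⟨L, hL, hS, rfl⟩ := h
  obtain ⟨L', hL', hT, rfl⟩ := h'
  refine ⟨L' ∘ₗ L, hL'.comp hL, hS.comp hT, ?_⟩
  rw [image_image]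
  exact image_congr fun x hx => (pmap_comp hS hx).symm

lemma HomEquiv.refl {n : ℕ} (S : Set (Fin n → ℝ)) : HomEquiv S S :=
  ⟨LinearMap.id, Function.injective_id, fun _ _ => zero_lt_one (α := ℝ), by
    have : pmap (LinearMap.id : (Fin n → ℝ) × ℝ →ₗ[ℝ] (Fin n → ℝ) × ℝ) = id := by
      ext1 x; simp [pmap]
    rw [this, image_id]⟩

lemma HomEquiv.symm {n : ℕ} {S T : Set (Fin n → ℝ)} (h : HomEquiv S T) : HomEquiv T S := by
  obtain ⟨L, hL, hS, rfl⟩ := h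
  let e := LinearEquiv.ofInjectiveEndo L hL
  have he : e.symm.toLinearMap ∘ₗ L = LinearMap.id :=
    LinearMap.ext fun p => e.symm_apply_apply p
  exact ⟨e.symm.toLinearMap, e.symm.injective, hS.of_leftInverse he,
    (image_pmap_leftInverse hS he).symm⟩

lemma HomEquiv.image_pmap {n m k : ℕ} {S : Set (Fin n → ℝ)} {T : Set (Fin m → ℝ)}
    (h : HomEquiv S T) {L : (Fin m → ℝ) × ℝ →ₗ[ℝ] (Fin k → ℝ) × ℝ} (hL : Function.Injective L)
    (hT : PosOn L T) : HomEquiv S (pmap L '' T) :=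
  h.trans ⟨L, hL, hT, rfl⟩

lemma HomEquiv.of_affine {n m : ℕ} (ι : (Fin n → ℝ) →ᵃ[ℝ] (Fin m → ℝ))
    (hι : Function.Injective ι) (S : Set (Fin n → ℝ)) : HomEquiv S (ι '' S) := by
  let L : (Fin n → ℝ) × ℝ →ₗ[ℝ] (Fin m → ℝ) × ℝ :=
    (ι.linear.comp (LinearMap.fst ℝ _ _) + (LinearMap.snd ℝ _ _).smulRight (ι 0)).prod
      (LinearMap.snd ℝ _ _)
  have hL : ∀ x t, L (x, t) = (ι.linear x + t • ι 0, t) := fun x t => by simp [L]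
  have hL1 : ∀ x, L (x, 1) = (ι x, 1) := fun x => by
    rw [hL, one_smul, Prod.mk.injEq]
    refine ⟨?_, rfl⟩
    conv_rhs => rw [← add_zero x, ← vadd_eq_add, AffineMap.map_vadd, vadd_eq_add]
  refine ⟨L, ?_, fun x _ => by simp [hL1], ?_⟩
  · rintro ⟨x, s⟩ ⟨y, t⟩ hxy
    rw [hL, hL, Prod.mk.injEq] at hxy
    obtain ⟨h1, rfl⟩ := hxy
    have h2 := (AffineMap.linear_injective_iff ι).2 hι (add_right_cancel h1)
    rw [h2]
  · refine image_congr fun x _ => ?_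
    simp [pmap, hL1]

/-- Every invertible linear map in homogeneous coordinates is given by a block matrix. -/
lemma exists_projTransf {n : ℕ} {L : (Fin n → ℝ) × ℝ →ₗ[ℝ] (Fin n → ℝ) × ℝ}
    (hL : Function.Injective L) :
    ∃ φ : ProjTransf n, (∀ x, φ.denom x = (L (x, 1)).2) ∧ φ.map = pmap L := by
  classical
  let A : Matrix (Fin n) (Fin n) ℝ := LinearMap.toMatrix'
    ((LinearMap.fst ℝ _ _).comp (L.comp (LinearMap.inl ℝ _ _)))
  let b := (L (0, 1)).1
  let c : Fin n → ℝ := fun j => (L (Pi.single j 1, 0)).2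
  let α := (L (0, 1)).2
  have hA : ∀ x, A.mulVec x = (L (x, 0)).1 := fun x => by
    rw [← Matrix.toLin'_apply, Matrix.toLin'_toMatrix']; simp
  have hc : ∀ x, dotProduct c x = (L (x, 0)).2 := fun x => by
    have h1 : ((LinearMap.snd ℝ _ _).comp (L.comp (LinearMap.inl ℝ _ _))) x = (L (x, 0)).2 := by
      simp
    rw [← h1, LinearMap.pi_apply_eq_sum_univ]
    simp only [dotProduct, c, smul_eq_mul]
    refine Finset.sum_congr rfl fun i _ => ?_
    rw [mul_comm]
    congr 1
    simp only [LinearMap.comp_apply, LinearMap.inl_apply, LinearMap.snd_apply]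
    congr 3
    ext j
    simp [Pi.single_apply, eq_comm]
  have hLx : ∀ x t, L (x, t) = (A.mulVec x + t • b, dotProduct c x + t * α) := fun x t => by
    have h1 : (x, t) = (x, (0 : ℝ)) + t • ((0 : Fin n → ℝ), (1 : ℝ)) := by simp
    rw [h1, map_add, map_smul, hA, hc]
    rfl
  refine ⟨⟨A, b, c, α, ?_⟩, fun x => ?_, ?_⟩
  · intro hdet
    obtain ⟨v, hv, h0⟩ := Matrix.exists_mulVec_eq_zero_iff.2 hdet
    refine hv ?_
    rw [Matrix.fromBlocks_mulVec] at h0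
    have h1 : L (v ∘ Sum.inl, v (Sum.inr ())) = 0 := by
      rw [hLx]
      ext i
      · have := congrFun h0 (Sum.inl i)
        simpa [Matrix.mulVec, dotProduct, mul_comm] using this
      · have := congrFun h0 (Sum.inr ())
        simpa [Matrix.mulVec, dotProduct, mul_comm] using this
    rw [← map_zero L] at h1
    have h2 := hL h1
    rw [Prod.mk_eq_zero] at h2
    ext (i | i)
    · exact congrFun h2.1 i
    · exact h2.2
  · simp [ProjTransf.denom, hLx]
  · ext1 x
    simp [ProjTransf.map, pmap, ProjTransf.denom, hLx]

/-- A linear map from `ℝⁿ × ℝ` into `ℝᵐ × ℝ` factors through a projective transformation of `ℝⁿ` with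
the same denominator; what remains preserves the last coordinate, hence is affine. -/
lemma HomEquiv.projEquiv {n m : ℕ} {X : Set (Fin n → ℝ)} {F : Set (Fin m → ℝ)}
    (h : HomEquiv X F) (hne : X.Nonempty) : ProjEquiv X F := by
  obtain ⟨L, hL, hX, rfl⟩ := h
  obtain ⟨x₀, hx₀⟩ := hne
  -- a projective transformation with the same denominator as `L`
  let M : (Fin n → ℝ) × ℝ →ₗ[ℝ] (Fin n → ℝ) × ℝ :=
    (LinearMap.fst ℝ _ _ - (LinearMap.snd ℝ _ _).smulRight x₀).prod (LinearMap.snd ℝ _ _ ∘ₗ L)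
  have hM : ∀ p, M p = (p.1 - p.2 • x₀, (L p).2) := fun p => by simp [M]
  have hMinj : Function.Injective M := by
    rw [injective_iff_map_eq_zero]
    rintro ⟨x, t⟩ h0
    rw [hM, Prod.mk_eq_zero] at h0
    obtain ⟨h1, h2⟩ := h0
    simp only at h1 h2
    have hx : (x, t) = t • (x₀, (1 : ℝ)) := by
      rw [sub_eq_zero.1 h1]; simp
    rw [hx, map_smul, Prod.smul_snd, smul_eq_mul] at h2
    rw [hx, (mul_eq_zero.1 h2).resolve_right (hX x₀ hx₀).ne', zero_smul]
  obtain ⟨φ, hφ, hφmap⟩ := exists_projTransf hMinj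
  let e := LinearEquiv.ofInjectiveEndo M hMinj
  let N := L ∘ₗ e.symm.toLinearMap
  have hN : ∀ p, N (M p) = L p := fun p => congrArg L (e.symm_apply_apply p)
  have hN2 : ∀ p, (N p).2 = p.2 := fun p => by
    obtain ⟨q, rfl⟩ := e.surjective p
    change (N (M q)).2 = (M q).2
    rw [hN, hM]
  let ι : (Fin n → ℝ) →ᵃ[ℝ] (Fin m → ℝ) :=
    (LinearMap.fst ℝ _ _ ∘ₗ N ∘ₗ LinearMap.inl ℝ _ _).toAffineMap +
      AffineMap.const ℝ _ (N (0, 1)).1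
  have hι : ∀ x, (ι x, (1 : ℝ)) = N (x, 1) := fun x => by
    ext1
    · have : (x, (1 : ℝ)) = (x, 0) + (0, 1) := by simp
      rw [this, map_add]
      simp [ι]
    · exact (hN2 (x, 1)).symm
  refine ⟨φ, fun x hx => ?_, ι, fun x y hxy => ?_, ?_⟩
  · rw [hφ, hM]; exact (hX x hx).ne'
  · have h1 : N (x, 1) = N (y, 1) := by rw [← hι, ← hι, hxy]
    have h2 := e.symm.injective (hL h1)
    exact (Prod.mk.inj h2).1
  · rw [hφmap, image_image]
    refine image_congr fun x hx => ?_
    have hpos : 0 < (M (x, 1)).2 := by rw [hM]; exact hX x hx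
    have h1 : (ι (pmap M x), (1 : ℝ)) = (pmap L x, 1) := by
      rw [hι, mk_pmap hpos, map_smul, hN, hM, mk_pmap (hX x hx)]
    exact (Prod.mk.inj h1).1.symm

/-- A cube of dimension `n` in any space is affinely equivalent to a full-dimensional one. -/
lemma IsCube.exists_chart {n m : ℕ} {F : Set (Fin m → ℝ)} (hF : IsCube n F) :
    ∃ C : Set (Fin n → ℝ), IsCube n C ∧ HomEquiv C F := by
  obtain ⟨x₀, hx₀⟩ := hF.1.nonempty
  let e : (Fin n → ℝ) ≃ₗ[ℝ] vectorSpan ℝ F :=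
    LinearEquiv.ofFinrankEq _ _ (by rw [hF.1.2]; simp)
  let ι : (Fin n → ℝ) →ᵃ[ℝ] (Fin m → ℝ) :=
    ((vectorSpan ℝ F).subtype ∘ₗ e.toLinearMap).toAffineMap + AffineMap.const ℝ _ x₀
  have hιx : ∀ x, ι x = (e x : Fin m → ℝ) + x₀ := fun x => by simp [ι]
  have hι : Function.Injective ι := fun x y hxy => by
    rw [hιx, hιx] at hxy
    exact e.injective (Subtype.ext (add_right_cancel hxy))
  have hFι : F = ι '' (ι ⁻¹' F) := by
    rw [image_preimage_eq_of_subset]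
    intro y hy
    refine ⟨e.symm ⟨y -ᵥ x₀, vsub_mem_vectorSpan ℝ hy hx₀⟩, ?_⟩
    rw [hιx]; simp
  have hCF : HomEquiv (ι ⁻¹' F) F := by
    have := HomEquiv.of_affine ι hι (ι ⁻¹' F)
    rwa [← hFι] at this
  refine ⟨ι ⁻¹' F, ?_, hCF⟩
  obtain ⟨L, hL, hpos, hFL⟩ := hCF
  obtain ⟨L', hL'⟩ := exists_leftInverse hL
  have hpos' : PosOn L' F := by
    rw [hFL]; exact hpos.of_leftInverse hL'
  have hC : ι ⁻¹' F = pmap L' '' F := by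
    conv_rhs => rw [hFL]
    rw [image_pmap_leftInverse hpos hL']
  have hdim := finrank_vectorSpan_image_pmap hL hpos
  have hcomb := combEquiv_image_pmap hL hpos
  rw [← hFL] at hdim hcomb
  refine ⟨⟨?_, hdim.symm.trans hF.1.2⟩, hcomb.trans hF.2⟩
  obtain ⟨⟨V, hV, hne, hFV⟩, -⟩ := hF.1
  refine ⟨pmap L' '' V, hV.image _, hne.image _, ?_⟩
  rw [hC, hFV, image_pmap_convexHull]
  exact hpos'.mono (hFV ▸ subset_convexHull ℝ V)

/-! ### Connected sums -/

/-- Two polyhedra on opposite sides of the hyperplane `f = 0` with the same section `F` by it, such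
that the remaining inequalities of each of them hold strictly on the other one outside `F`. The
last two fields ask for a point off the hyperplane in each of them. -/
structure Glued {n : ℕ} {J K : Type*} (f : (Fin n → ℝ) →ᵃ[ℝ] ℝ) (h : J → (Fin n → ℝ) →ᵃ[ℝ] ℝ)
    (k : K → (Fin n → ℝ) →ᵃ[ℝ] ℝ) (P Q F : Set (Fin n → ℝ)) : Prop where
  mem_left : ∀ x, x ∈ P ↔ f x ≤ 0 ∧ ∀ j, 0 ≤ h j x
  mem_right : ∀ x, x ∈ Q ↔ 0 ≤ f x ∧ ∀ i, 0 ≤ k i x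
  face_left : F = {x ∈ P | f x = 0}
  face_right : F = {x ∈ Q | f x = 0}
  pos_left : ∀ x ∈ P, f x < 0 → ∀ i, 0 < k i x
  pos_right : ∀ x ∈ Q, 0 < f x → ∀ j, 0 < h j x
  exists_left : ∃ x ∈ P, f x < 0
  exists_right : ∃ x ∈ Q, 0 < f x

namespace Glued

variable {n : ℕ} {J K : Type*} {f : (Fin n → ℝ) →ᵃ[ℝ] ℝ} {h : J → (Fin n → ℝ) →ᵃ[ℝ] ℝ}
    {k : K → (Fin n → ℝ) →ᵃ[ℝ] ℝ} {P Q F : Set (Fin n → ℝ)}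

lemma symm (H : Glued f h k P Q F) : Glued (-f) k h Q P F where
  mem_left x := by rw [H.mem_right]; simp
  mem_right x := by rw [H.mem_left]; simp
  face_left := by simpa using H.face_right
  face_right := by simpa using H.face_left
  pos_left x hx hf := H.pos_right x hx (by simpa using hf)
  pos_right x hx hf := H.pos_left x hx (by simpa using hf)
  exists_left := by simpa using H.exists_right
  exists_right := by simpa using H.exists_left

lemma mem_union (H : Glued f h k P Q F) (x : Fin n → ℝ) :
    x ∈ P ∪ Q ↔ (∀ j, 0 ≤ h j x) ∧ ∀ i, 0 ≤ k i x := by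
  constructor
  · rintro (hx | hx)
    · have hx' := (H.mem_left x).1 hx
      refine ⟨hx'.2, fun i => ?_⟩
      rcases hx'.1.lt_or_eq with hf | hf
      · exact (H.pos_left x hx hf i).le
      · have hxF : x ∈ F := by rw [H.face_left]; exact ⟨hx, hf⟩
        rw [H.face_right] at hxF
        exact ((H.mem_right x).1 hxF.1).2 i
    · have hx' := (H.mem_right x).1 hx
      refine ⟨fun j => ?_, hx'.2⟩
      rcases hx'.1.lt_or_eq with hf | hf
      · exact (H.pos_right x hx hf j).le
      · have hxF : x ∈ F := by rw [H.face_right]; exact ⟨hx, hf.symm⟩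
        rw [H.face_left] at hxF
        exact ((H.mem_left x).1 hxF.1).2 j
  · rintro ⟨h1, h2⟩
    rcases le_total (f x) 0 with hf | hf
    · exact Or.inl ((H.mem_left x).2 ⟨hf, h1⟩)
    · exact Or.inr ((H.mem_right x).2 ⟨hf, h2⟩)

lemma convex_union (H : Glued f h k P Q F) : Convex ℝ (P ∪ Q) := by
  have : P ∪ Q = (⋂ j, {x | 0 ≤ h j x}) ∩ ⋂ i, {x | 0 ≤ k i x} := by
    ext x
    rw [H.mem_union]
    simp
  rw [this]
  exact (convex_iInter fun j => convex_setOf_nonneg _).inter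
    (convex_iInter fun i => convex_setOf_nonneg _)

lemma inter_eq (H : Glued f h k P Q F) : P ∩ Q = F := by
  apply Subset.antisymm
  · rintro x ⟨hP, hQ⟩
    rw [H.face_left]
    exact ⟨hP, le_antisymm ((H.mem_left x).1 hP).1 ((H.mem_right x).1 hQ).1⟩
  · intro x hx
    constructor
    · rw [H.face_left] at hx; exact hx.1
    · rw [H.face_right] at hx; exact hx.1

/-- The point at which a segment joining the two sides crosses the hyperplane is an interior point
of the union. -/
lemma exists_crossing (H : Glued f h k P Q F) {p q : Fin n → ℝ} (hp : p ∈ P) (hq : q ∈ Q)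
    (hfp : f p < 0) (hfq : 0 < f q) : ∃ s t : ℝ, 0 ≤ s ∧ 0 ≤ t ∧ s + t = 1 ∧
      s • p + t • q ∈ F ∧ (∀ j, 0 < h j (s • p + t • q)) ∧ ∀ i, 0 < k i (s • p + t • q) := by
  have hd : 0 < f q - f p := by linarith
  have hs : 0 < f q / (f q - f p) := by positivity
  have ht : 0 < -f p / (f q - f p) := div_pos (by linarith) hd
  have hst : f q / (f q - f p) + -f p / (f q - f p) = 1 := by field_simp; ring
  have hf : f ((f q / (f q - f p)) • p + (-f p / (f q - f p)) • q) = 0 := by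
    rw [affine_combo f _ _ hst]; field_simp; ring
  have hh : ∀ j, 0 < h j ((f q / (f q - f p)) • p + (-f p / (f q - f p)) • q) := fun j => by
    rw [affine_combo _ _ _ hst]
    have h1 := ((H.mem_left p).1 hp).2 j
    have h2 := H.pos_right q hq hfq j
    positivity
  refine ⟨_, _, hs.le, ht.le, hst, ?_, hh, fun i => ?_⟩
  · rw [H.face_left]
    exact ⟨(H.mem_left _).2 ⟨hf.le, fun j => (hh j).le⟩, hf⟩
  · rw [affine_combo _ _ _ hst]
    have h1 := H.pos_left p hp hfp i
    have h2 := ((H.mem_right q).1 hq).2 i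
    positivity

variable [Finite J] [Finite K]

/-- A face of the union through an interior point is the whole union. -/
lemma eq_union_of_mem (H : Glued f h k P Q F) {E : Set (Fin n → ℝ)} (hE : E ∈ faces (P ∪ Q))
    {z : Fin n → ℝ} (hz : z ∈ E) (hh : ∀ j, 0 < h j z) (hk : ∀ i, 0 < k i z) : E = P ∪ Q := by
  refine Subset.antisymm (subset_of_mem_faces hE) fun y hy => ?_
  obtain ⟨a, ha, rfl⟩ := mem_faces_iff.1 hE
  obtain ⟨ε, hε, hpos⟩ := exists_extend_pos (K := J ⊕ K) (Sum.elim h k) (z := z)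
    (by rintro (j | i); exacts [hh j, hk i]) y
  have hmem : z + ε • (z - y) ∈ P ∪ Q :=
    (H.mem_union _).2 ⟨fun j => (hpos (Sum.inl j)).le, fun i => (hpos (Sum.inr i)).le⟩
  have h1 := ha _ hmem
  rw [affine_extend, hz.2] at h1
  refine ⟨hy, le_antisymm ?_ (ha y hy)⟩
  by_contra hcon
  push Not at hcon
  nlinarith [mul_pos hε hcon]

lemma mem_properFaces_of_subset (H : Glued f h k P Q F) {E : Set (Fin n → ℝ)}
    (hE : E ∈ properFaces (P ∪ Q)) (hEP : E ⊆ P) : E ∈ properFaces P \ {F} := by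
  obtain ⟨p, hp, hfp⟩ := H.exists_left
  obtain ⟨q, hq, hfq⟩ := H.exists_right
  obtain ⟨s, t, -, -, -, hzF, hzh, hzk⟩ := H.exists_crossing hp hq hfp hfq
  have hFP : F ⊆ P := by rw [← H.inter_eq]; exact inter_subset_left
  refine ⟨⟨?_, fun h => ?_⟩, fun h => ?_⟩
  · obtain ⟨a, ha, rfl⟩ := mem_faces_iff.1 hE.1
    refine mem_faces_iff.2 ⟨a, fun x hx => ha x (Or.inl hx), ?_⟩
    exact Subset.antisymm (fun x hx => ⟨hEP hx, hx.2⟩) fun x hx => ⟨Or.inl hx.1, hx.2⟩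
  · rw [mem_singleton_iff] at h
    exact hE.2 (H.eq_union_of_mem hE.1 (by rw [h]; exact hFP hzF) hzh hzk)
  · rw [mem_singleton_iff] at h
    exact hE.2 (H.eq_union_of_mem hE.1 (by rw [h]; exact hzF) hzh hzk)

lemma subset_or_subset (H : Glued f h k P Q F) {E : Set (Fin n → ℝ)}
    (hE : E ∈ properFaces (P ∪ Q)) : E ⊆ P ∨ E ⊆ Q := by
  by_contra hcon
  push Not at hcon
  obtain ⟨⟨q, hqE, hqP⟩, p, hpE, hpQ⟩ := And.imp not_subset.1 not_subset.1 hcon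
  have hq : q ∈ Q := (subset_of_mem_faces hE.1 hqE).resolve_left hqP
  have hp : p ∈ P := (subset_of_mem_faces hE.1 hpE).resolve_right hpQ
  have hFP : F ⊆ P := by rw [← H.inter_eq]; exact inter_subset_left
  have hFQ : F ⊆ Q := by rw [← H.inter_eq]; exact inter_subset_right
  have hfq : 0 < f q := by
    refine lt_of_le_of_ne ((H.mem_right q).1 hq).1 fun h0 => hqP (hFP ?_)
    rw [H.face_right]; exact ⟨hq, h0.symm⟩
  have hfp : f p < 0 := by
    refine lt_of_le_of_ne ((H.mem_left p).1 hp).1 fun h0 => hpQ (hFQ ?_)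
    rw [H.face_left]; exact ⟨hp, h0⟩
  obtain ⟨s, t, hs, ht, hst, -, hzh, hzk⟩ := H.exists_crossing hp hq hfp hfq
  exact hE.2 (H.eq_union_of_mem hE.1
    (convex_of_mem_faces H.convex_union hE.1 hpE hqE hs ht hst) hzh hzk)

/-- A proper face of one part, other than the common facet, is a face of the union. A face inside
the common facet is exposed in the union only by combining inequalities of both parts. -/
lemma mem_properFaces_union (H : Glued f h k P Q F) {E : Set (Fin n → ℝ)}
    (hE : E ∈ properFaces P) (hEF : E ≠ F) : E ∈ properFaces (P ∪ Q) := by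
  have hEP := subset_of_mem_faces hE.1
  obtain ⟨q, hq, hfq⟩ := H.exists_right
  have hqP : q ∉ P := fun hqP => absurd ((H.mem_left q).1 hqP).1 (not_le.2 hfq)
  refine ⟨?_, fun heq => hqP (hEP (by rw [show E = P ∪ Q from heq]; exact Or.inr hq))⟩
  rcases E.eq_empty_or_nonempty with rfl | hne
  · exact empty_mem_faces _
  have hnonneg : ∀ x ∈ P ∪ Q, ∀ c : J ⊕ K, 0 ≤ Sum.elim h k c x := by
    rintro x hx (j | i)
    exacts [((H.mem_union x).1 hx).1 j, ((H.mem_union x).1 hx).2 i]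
  by_cases hsub : E ⊆ F
  · have hFE : E ∈ faces F := by
      obtain ⟨a, ha, hEa⟩ := mem_faces_iff.1 hE.1
      rw [H.face_left] at hsub ⊢
      refine mem_faces_iff.2 ⟨a, fun x hx => ha x hx.1, ?_⟩
      rw [hEa] at hsub ⊢
      exact Subset.antisymm (fun x hx => ⟨hsub hx, hx.2⟩) fun x hx => ⟨hx.1.1, hx.2⟩
    let A : AffineSubspace ℝ (Fin n → ℝ) :=
      { carrier := {x | f x = 0}
        smul_vsub_vadd_mem' := by
          intro c p q r hp hq hr
          simp only [mem_ofPred_eq] at hp hq hr ⊢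
          rw [AffineMap.map_vadd, map_smul, AffineMap.linearMap_vsub, hp, hq, hr]
          simp }
    have hF1 : F = {x | x ∈ A ∧ ∀ j, 0 ≤ h j x} := by
      ext x
      rw [H.face_left]
      constructor
      · rintro ⟨hx, hf⟩; exact ⟨hf, ((H.mem_left x).1 hx).2⟩
      · rintro ⟨hf, hx⟩; exact ⟨(H.mem_left x).2 ⟨le_of_eq hf, hx⟩, hf⟩
    have hF2 : F = {x | x ∈ A ∧ ∀ i, 0 ≤ k i x} := by
      ext x
      rw [H.face_right]
      constructor
      · rintro ⟨hx, hf⟩; exact ⟨hf, ((H.mem_right x).1 hx).2⟩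
      · rintro ⟨hf, hx⟩; exact ⟨(H.mem_right x).2 ⟨ge_of_eq hf, hx⟩, hf⟩
    obtain ⟨S, hS⟩ := exists_active_of_mem_faces hF1 hFE hne
    obtain ⟨T, hT⟩ := exists_active_of_mem_faces hF2 hFE hne
    have hSne : ∃ j, j ∈ S := by
      by_contra hcon
      push Not at hcon
      exact hEF (by rw [hS]; ext x; simp [hcon])
    have hTne : ∃ i, i ∈ T := by
      by_contra hcon
      push Not at hcon
      exact hEF (by rw [hT]; ext x; simp [hcon])
    have hmem := setOf_active_mem_faces hnonneg (Sum.inl '' S ∪ Sum.inr '' T)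
    convert hmem using 1
    ext x
    constructor
    · intro hx
      refine ⟨Or.inl (hEP hx), ?_⟩
      rintro _ (⟨j, hj, rfl⟩ | ⟨i, hi, rfl⟩)
      · rw [hS] at hx; exact hx.2 j hj
      · rw [hT] at hx; exact hx.2 i hi
    · rintro ⟨hx, h0⟩
      have hxF : x ∈ F := by
        obtain ⟨j, hj⟩ := hSne
        obtain ⟨i, hi⟩ := hTne
        have hj0 := h0 (Sum.inl j) (Or.inl ⟨j, hj, rfl⟩)
        have hi0 := h0 (Sum.inr i) (Or.inr ⟨i, hi, rfl⟩)
        rcases hx with hx | hx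
        · rw [H.face_left]
          refine ⟨hx, le_antisymm ((H.mem_left x).1 hx).1 (not_lt.1 fun hlt => ?_)⟩
          exact (H.pos_left x hx hlt i).ne' hi0
        · rw [H.face_right]
          refine ⟨hx, le_antisymm (not_lt.1 fun hlt => ?_) ((H.mem_right x).1 hx).1⟩
          exact (H.pos_right x hx hlt j).ne' hj0
      rw [hS]
      exact ⟨hxF, fun j hj => h0 (Sum.inl j) (Or.inl ⟨j, hj, rfl⟩)⟩
  · have hP : P = {x | x ∈ (⊤ : AffineSubspace ℝ (Fin n → ℝ)) ∧
        ∀ c : Option J, 0 ≤ Option.elim c (-f) h x} := by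
      ext x
      rw [H.mem_left]
      simp [Option.forall]
    obtain ⟨S, hS⟩ := exists_active_of_mem_faces hP hE.1 hne
    have hnone : none ∉ S := fun hn => hsub fun x hx => by
      rw [hS] at hx
      rw [H.face_left]
      exact ⟨hx.1, by simpa using hx.2 none hn⟩
    have hSne : ∃ j, some j ∈ S := by
      by_contra hcon
      push Not at hcon
      refine hE.2 ?_
      rw [mem_singleton_iff, hS]
      ext x
      refine ⟨fun hx => hx.1, fun hx => ⟨hx, ?_⟩⟩
      rintro (_ | j) hj
      exacts [absurd hj hnone, absurd hj (hcon j)]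
    have hmem := setOf_active_mem_faces hnonneg (Sum.inl '' {j | some j ∈ S})
    convert hmem using 1
    ext x
    constructor
    · intro hx
      refine ⟨Or.inl (hEP hx), ?_⟩
      rintro _ ⟨j, hj, rfl⟩
      rw [hS] at hx
      exact hx.2 (some j) hj
    · rintro ⟨hx, h0⟩
      have hxP : x ∈ P := by
        obtain ⟨j, hj⟩ := hSne
        have hj0 := h0 (Sum.inl j) ⟨j, hj, rfl⟩
        rcases hx with hx | hx
        · exact hx
        · refine (H.mem_left x).2 ⟨not_lt.1 fun hlt => ?_, ((H.mem_union x).1 (Or.inr hx)).1⟩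
          exact (H.pos_right x hx hlt j).ne' hj0
      rw [hS]
      refine ⟨hxP, ?_⟩
      rintro (_ | j) hj
      · exact absurd hj hnone
      · exact h0 (Sum.inl j) ⟨j, hj, rfl⟩

lemma isConnectedSum (H : Glued f h k P Q F) (hP : IsFacet P F) (hQ : IsFacet Q F) :
    IsConnectedSum P Q F where
  facet_left := hP
  facet_right := hQ
  inter_eq := H.inter_eq
  convex := H.convex_union
  properFaces_eq := by
    ext E
    constructor
    · intro hE
      rcases H.subset_or_subset hE with hsub | hsub
      · have := H.mem_properFaces_of_subset hE hsub
        exact ⟨Or.inl this.1, this.2⟩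
      · have := H.symm.mem_properFaces_of_subset (by rwa [union_comm]) hsub
        exact ⟨Or.inr this.1, this.2⟩
    · rintro ⟨hE | hE, hEF⟩
      · exact H.mem_properFaces_union hE hEF
      · rw [union_comm]
        exact H.symm.mem_properFaces_union hE hEF

end Glued

/-! ### Projective gluing along projectively equivalent facets -/

/-- The facet description of a polytope, with the inequality `0 ≤ f` of a given facet `F` singled
out. The other inequalities do not vanish identically on `F`, hence are simultaneously positive at
some point of it. -/
lemma IsPolytope.exists_facet_ineq {n : ℕ} {P F : Set (Fin n → ℝ)} (hP : IsPolytope n P)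
    (hF : IsFacet P F) :
    ∃ (K : Type) (_ : Finite K) (f : (Fin n → ℝ) →ᵃ[ℝ] ℝ) (h : K → (Fin n → ℝ) →ᵃ[ℝ] ℝ),
      (∀ x ∈ P, 0 ≤ f x) ∧ F = {x ∈ P | f x = 0} ∧ (∀ x ∈ P, ∀ k, 0 ≤ h k x) ∧
      (∀ E ∈ properFaces P, E.Nonempty → ∃ k : Option K, ∀ x ∈ E, Option.elim k f h x = 0) ∧
      (∃ x ∈ F, ∀ k, 0 < h k x) := by
  let K : Type := {E // E ∈ properFaces P ∧ E.Nonempty ∧ E ≠ F}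
  have hK : Finite K := (hP.finite_faces.subset fun E hE => hE.1.1 :
    {E | E ∈ properFaces P ∧ E.Nonempty ∧ E ≠ F}.Finite)
  obtain ⟨f, hf, hFf⟩ := mem_faces_iff.1 hF.1
  have hex : ∀ E : K, ∃ a : (Fin n → ℝ) →ᵃ[ℝ] ℝ, (∀ x ∈ P, 0 ≤ a x) ∧
      (E : Set (Fin n → ℝ)) = {x ∈ P | a x = 0} := fun E => mem_faces_iff.1 E.2.1.1
  choose h h0 hE using hex
  refine ⟨K, hK, f, h, hf, hFf, fun x hx k => h0 k x hx, fun E hEP hne => ?_, ?_⟩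
  · by_cases hEF : E = F
    · refine ⟨none, fun x hx => ?_⟩
      rw [hEF, hFf] at hx
      exact hx.2
    · refine ⟨some ⟨E, hEP, hne, hEF⟩, fun x hx => ?_⟩
      have := hE ⟨E, hEP, hne, hEF⟩
      simp only at this
      rw [this] at hx
      exact hx.2
  · have hFP := subset_of_mem_faces hF.1
    refine exists_forall_pos (convex_of_mem_faces hP.convex hF.1) hF.2.1 h
      (fun k x hx => h0 k x (hFP hx)) fun k => ?_
    by_contra hcon
    push Not at hcon
    refine k.2.2.2 (hF.eq_of_subset k.2.1 fun x hx => ?_)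
    rw [hE k]
    exact ⟨hFP hx, le_antisymm (hcon x hx) (h0 k x (hFP hx))⟩

lemma eq_setOf_facet_ineq {n : ℕ} {P F : Set (Fin n → ℝ)} (hP : IsPolytope n P) {K : Type*}
    [Finite K] {f : (Fin n → ℝ) →ᵃ[ℝ] ℝ} {h : K → (Fin n → ℝ) →ᵃ[ℝ] ℝ} (hf : ∀ x ∈ P, 0 ≤ f x)
    (hF : F = {x ∈ P | f x = 0}) (hFP : F ≠ P) (h0 : ∀ x ∈ P, ∀ k, 0 ≤ h k x)
    (hcov : ∀ E ∈ properFaces P, E.Nonempty → ∃ k : Option K, ∀ x ∈ E, Option.elim k f h x = 0)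
    (hpos : ∃ x ∈ F, ∀ k, 0 < h k x) : ∀ x, x ∈ P ↔ 0 ≤ f x ∧ ∀ k, 0 ≤ h k x := by
  obtain ⟨z, hz, hzpos⟩ := hpos
  have hzP : z ∈ P := by rw [hF] at hz; exact hz.1
  have h0' : ∀ x ∈ P, ∀ k : Option K, 0 ≤ Option.elim k f h x := by
    rintro x hx (_ | k)
    exacts [hf x hx, h0 x hx k]
  obtain ⟨x₀, hx₀, hx₀pos⟩ := exists_forall_pos hP.convex hP.nonempty
    (fun k : Option K => Option.elim k f h) (fun k x hx => h0' x hx k) (by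
      rintro (_ | k)
      · by_contra hcon
        push Not at hcon
        refine hFP ?_
        rw [hF]
        exact Subset.antisymm (sep_subset _ _) fun x hx =>
          ⟨hx, le_antisymm (hcon x hx) (hf x hx)⟩
      · exact ⟨z, hzP, hzpos k⟩)
  have := eq_setOf_nonneg_of_cover hP.isCompact hP.convex hP.interior_nonempty
    (fun k : Option K => Option.elim k f h) h0' hx₀ hx₀pos hcov
  intro x
  conv_lhs => rw [this]
  simp [Option.forall]

lemma linear_eq_zero_of_affineSpan {n : ℕ} {X : Set (Fin n → ℝ)} (hX : affineSpan ℝ X = ⊤)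
    (η : (Fin n → ℝ) × ℝ →ₗ[ℝ] ℝ) (h : ∀ x ∈ X, η (x, 1) = 0) : η = 0 := by
  have h1 := affine_eq_zero_of_affineSpan hX (dehomog η) (by simpa using h)
  have h2 : ∀ x, η (x, 1) = 0 := fun x => by rw [← dehomog_apply, h1]; rfl
  refine LinearMap.ext fun ⟨x, t⟩ => ?_
  have h3 : (x, t) = (x, (1 : ℝ)) + (t - 1) • ((0 : Fin n → ℝ), (1 : ℝ)) := by ext1 <;> simp
  rw [h3, map_add, map_smul, h2, h2]
  simp

/-- The linear isomorphism `(y, s) ↦ L y + s • u` for a hyperplane parametrized by `L` and a vector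
`u` off this hyperplane. -/
lemma exists_splitting {n : ℕ} {L : (Fin n → ℝ) × ℝ →ₗ[ℝ] (Fin (n + 1) → ℝ) × ℝ}
    (hL : Function.Injective L) {η : (Fin (n + 1) → ℝ) × ℝ →ₗ[ℝ] ℝ} (hη : η ∘ₗ L = 0)
    {u : (Fin (n + 1) → ℝ) × ℝ} (hu : η u ≠ 0) :
    ∃ e : (((Fin n → ℝ) × ℝ) × ℝ) ≃ₗ[ℝ] (Fin (n + 1) → ℝ) × ℝ, ∀ y s, e (y, s) = L y + s • u := by
  let Ψ : (((Fin n → ℝ) × ℝ) × ℝ) →ₗ[ℝ] (Fin (n + 1) → ℝ) × ℝ :=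
    L.coprod (LinearMap.toSpanSingleton ℝ _ u)
  have hΨ : ∀ y s, Ψ (y, s) = L y + s • u := fun y s => by simp [Ψ]
  have hηL : ∀ y, η (L y) = 0 := fun y => LinearMap.congr_fun hη y
  have hinj : Function.Injective Ψ := by
    rw [injective_iff_map_eq_zero]
    rintro ⟨y, s⟩ h0
    rw [hΨ] at h0
    have h1 := congrArg η h0
    rw [map_add, map_smul, hηL, map_zero, zero_add, smul_eq_mul] at h1
    have hs := (mul_eq_zero.1 h1).resolve_right hu
    rw [hs, zero_smul, add_zero, ← map_zero L] at h0
    rw [hL h0, hs]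
    rfl
  refine ⟨LinearEquiv.ofInjectiveOfFinrankEq Ψ hinj (by simp), fun y s => ?_⟩
  exact hΨ y s

/-- The effect of a large shear. The maps `N τ` send the facet `pmap L₂ '' X` of `Q` to
`pmap L₁ '' X` and move the rest of `Q` by a large multiple of `L₁ w`; hence a functional `η` that is
nonnegative on the new facet and positive at `L₁ w` becomes positive off the facet. It suffices
to check this at the finitely many vertices of `Q`. -/
lemma eventually_le_shear {n : ℕ} {L₁ L₂ : (Fin n → ℝ) × ℝ →ₗ[ℝ] (Fin (n + 1) → ℝ) × ℝ}
    {u v : (Fin (n + 1) → ℝ) × ℝ} {w : (Fin n → ℝ) × ℝ}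
    {N : ℝ → (Fin (n + 1) → ℝ) × ℝ →ₗ[ℝ] (Fin (n + 1) → ℝ) × ℝ}
    (hN : ∀ τ y s, N τ (L₂ y + s • v) = L₁ y + s • u + (s * τ) • L₁ w)
    {X : Set (Fin n → ℝ)} {Q : Set (Fin (n + 1) → ℝ)} {k : ℕ} (hQ : IsPolytope k Q)
    {g : (Fin (n + 1) → ℝ) →ᵃ[ℝ] ℝ} (hg : ∀ x ∈ Q, 0 ≤ g x)
    (hsplit : ∀ x, ∃ y, (x, (1 : ℝ)) = L₂ y + g x • v)
    (hpos : PosOn L₂ X) (hX : pmap L₂ '' X = {x ∈ Q | g x = 0})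
    {η : (Fin (n + 1) → ℝ) × ℝ →ₗ[ℝ] ℝ} (hη : ∀ x ∈ X, 0 ≤ η (L₁ (x, 1))) (hηw : 0 < η (L₁ w)) :
    ∀ᶠ τ in atTop, ∀ q ∈ Q, g q ≤ η (N τ (q, 1)) := by
  obtain ⟨⟨V, hV, -, hQV⟩, -⟩ := hQ
  have hVQ : V ⊆ Q := hQV ▸ subset_convexHull ℝ V
  have hvert : ∀ᶠ τ in atTop, ∀ q ∈ V, g q ≤ η (N τ (q, 1)) := by
    refine (hV.eventually_all).2 fun q hq => ?_
    rcases (hg q (hVQ hq)).eq_or_lt with h0 | hlt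
    · refine Eventually.of_forall fun τ => ?_
      have hqX : q ∈ pmap L₂ '' X := by rw [hX]; exact ⟨hVQ hq, h0.symm⟩
      obtain ⟨x, hx, rfl⟩ := hqX
      have h1 := hN τ (x, 1) 0
      simp only [zero_smul, add_zero, zero_mul] at h1
      rw [← h0, mk_pmap (hpos x hx), map_smul, h1, map_smul, smul_eq_mul]
      exact mul_nonneg (inv_nonneg.2 (hpos x hx).le) (hη x hx)
    · obtain ⟨y, hy⟩ := hsplit q
      have h1 : Tendsto (fun τ : ℝ => η (L₁ y + g q • u) + (g q * η (L₁ w)) * τ) atTop atTop :=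
        tendsto_atTop_add_const_left _ _ (tendsto_id.const_mul_atTop (mul_pos hlt hηw))
      filter_upwards [h1.eventually_ge_atTop (g q)] with τ hτ
      rw [hy, hN, map_add _ (L₁ y + g q • u), map_smul, smul_eq_mul]
      linarith
  filter_upwards [hvert] with τ hτ q hq
  have hc := convex_setOf_nonneg (dehomog (η ∘ₗ N τ) - g)
  have hmem := convexHull_min (fun q hq => by simpa using hτ q hq) hc (hQV ▸ hq)
  simpa using hmem

/-- Polytopes with projectively equivalent facets can be glued along them after a projective
transformation of one of them. The transformation squeezes `Q` towards a relative interior point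
of the facet, so that `F` becomes the only facet of `P` visible from the image of `Q`, and
conversely. -/
lemma exists_projective_gluing {n : ℕ} {X : Set (Fin n → ℝ)} {P Q F G : Set (Fin (n + 1) → ℝ)}
    (hX : affineSpan ℝ X = ⊤) (hP : IsPolytope (n + 1) P) (hQ : IsPolytope (n + 1) Q)
    (hF : IsFacet P F) (hG : IsFacet Q G) (hXF : HomEquiv X F) (hXG : HomEquiv X G) :
    ∃ M : (Fin (n + 1) → ℝ) × ℝ →ₗ[ℝ] (Fin (n + 1) → ℝ) × ℝ, Function.Injective M ∧ PosOn M Q ∧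
      pmap M '' G = F ∧ IsConnectedSum P (pmap M '' Q) F := by
  obtain ⟨L₁, hL₁, hpos₁, hF₁⟩ := hXF
  obtain ⟨L₂, hL₂, hpos₂, hG₂⟩ := hXG
  obtain ⟨J, hJ, f, h, hf, hFf, hh, hcovP, hrelF⟩ := hP.exists_facet_ineq hF
  obtain ⟨K, hK, g, k, hg, hGg, hk, hcovQ, hrelG⟩ := hQ.exists_facet_ineq hG
  have hmemP := eq_setOf_facet_ineq hP hf hFf hF.ne hh hcovP hrelF
  -- points of the two polytopes off the common hyperplane
  have hoff : ∀ {R H : Set (Fin (n + 1) → ℝ)} {a : (Fin (n + 1) → ℝ) →ᵃ[ℝ] ℝ},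
      (∀ x ∈ R, 0 ≤ a x) → H = {x ∈ R | a x = 0} → H ≠ R → ∃ x ∈ R, 0 < a x := by
    intro R H a ha hH hne
    by_contra hcon
    push Not at hcon
    refine hne ?_
    rw [hH]
    exact Subset.antisymm (sep_subset _ _) fun x hx => ⟨hx, le_antisymm (hcon x hx) (ha x hx)⟩
  obtain ⟨p, hp, hfp⟩ := hoff hf hFf hF.ne
  obtain ⟨q, hq, hgq⟩ := hoff hg hGg hG.ne
  have hker : ∀ {L : (Fin n → ℝ) × ℝ →ₗ[ℝ] (Fin (n + 1) → ℝ) × ℝ}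
      {R : Set (Fin (n + 1) → ℝ)} {a : (Fin (n + 1) → ℝ) →ᵃ[ℝ] ℝ}, PosOn L X →
      pmap L '' X = {x ∈ R | a x = 0} → homog a ∘ₗ L = 0 := by
    intro L R a hpos hLX
    refine linear_eq_zero_of_affineSpan hX _ fun x hx => ?_
    have h1 : pmap L x ∈ {x ∈ R | a x = 0} := hLX ▸ mem_image_of_mem _ hx
    rw [LinearMap.comp_apply, linear_pmap (hpos x hx), h1.2, mul_zero]
  have hFX : pmap L₁ '' X = {x ∈ P | f x = 0} := hF₁ ▸ hFf
  have hGX : pmap L₂ '' X = {x ∈ Q | g x = 0} := hG₂ ▸ hGg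
  have hfL := hker hpos₁ hFX
  have hgL := hker hpos₂ hGX
  have hfL' : ∀ y, homog f (L₁ y) = 0 := fun y => LinearMap.congr_fun hfL y
  have hgL' : ∀ y, homog g (L₂ y) = 0 := fun y => LinearMap.congr_fun hgL y
  obtain ⟨u, hfu⟩ : ∃ u, homog f u = -1 := ⟨-(f p)⁻¹ • (p, (1 : ℝ)), by
    rw [map_smul, homog_mk_one, smul_eq_mul, neg_mul, inv_mul_cancel₀ hfp.ne']⟩
  obtain ⟨v, hgv⟩ : ∃ v, homog g v = 1 := ⟨(g q)⁻¹ • (q, (1 : ℝ)), by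
    rw [map_smul, homog_mk_one, smul_eq_mul, inv_mul_cancel₀ hgq.ne']⟩
  -- a vector in the cone over the facet at which all other inequalities are strict
  obtain ⟨x₁, hx₁, hx₁pos⟩ : ∃ x ∈ X, ∀ j, 0 < homog (h j) (L₁ (x, 1)) := by
    obtain ⟨z, hz, hzpos⟩ := hrelF
    rw [hF₁] at hz
    obtain ⟨x, hx, rfl⟩ := hz
    exact ⟨x, hx, fun j => by
      rw [linear_pmap (hpos₁ x hx)]; exact mul_pos (hpos₁ x hx) (hzpos j)⟩
  obtain ⟨x₂, hx₂, hx₂pos⟩ : ∃ x ∈ X, ∀ i, 0 < homog (k i) (L₂ (x, 1)) := by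
    obtain ⟨z, hz, hzpos⟩ := hrelG
    rw [hG₂] at hz
    obtain ⟨x, hx, rfl⟩ := hz
    exact ⟨x, hx, fun j => by
      rw [linear_pmap (hpos₂ x hx)]; exact mul_pos (hpos₂ x hx) (hzpos j)⟩
  have hhX : ∀ x ∈ X, ∀ j, 0 ≤ homog (h j) (L₁ (x, 1)) := fun x hx j => by
    have h1 : pmap L₁ x ∈ {x ∈ P | f x = 0} := hFX ▸ mem_image_of_mem _ hx
    rw [linear_pmap (hpos₁ x hx)]
    exact mul_nonneg (hpos₁ x hx).le (hh _ h1.1 j)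
  have hkX : ∀ x ∈ X, ∀ i, 0 ≤ homog (k i) (L₂ (x, 1)) := fun x hx i => by
    have h1 : pmap L₂ x ∈ {x ∈ Q | g x = 0} := hGX ▸ mem_image_of_mem _ hx
    rw [linear_pmap (hpos₂ x hx)]
    exact mul_nonneg (hpos₂ x hx).le (hk _ h1.1 i)
  obtain ⟨w, hhw, hkw, hw⟩ : ∃ w, (∀ j, 0 < homog (h j) (L₁ w)) ∧ (∀ i, 0 < homog (k i) (L₂ w)) ∧
      0 < LinearMap.snd ℝ _ _ (L₁ w) := by
    refine ⟨(x₁, 1) + (x₂, 1), fun j => ?_, fun i => ?_, ?_⟩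
    · rw [map_add, map_add]; exact add_pos_of_pos_of_nonneg (hx₁pos j) (hhX x₂ hx₂ j)
    · rw [map_add, map_add]; exact add_pos_of_nonneg_of_pos (hkX x₁ hx₁ i) (hx₂pos i)
    · rw [map_add, map_add]; exact add_pos (hpos₁ x₁ hx₁) (hpos₁ x₂ hx₂)
  obtain ⟨e₂, he₂⟩ := exists_splitting hL₂ hgL (u := v) (by rw [hgv]; exact one_ne_zero)
  have hex : ∀ τ : ℝ, ∃ e : (((Fin n → ℝ) × ℝ) × ℝ) ≃ₗ[ℝ] (Fin (n + 1) → ℝ) × ℝ,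
      ∀ y s, e (y, s) = L₁ y + s • (u + τ • L₁ w) := fun τ =>
    exists_splitting hL₁ hfL (by rw [map_add, map_smul, hfL', hfu]; simp)
  choose e₁ he₁ using hex
  let M : ℝ → (((Fin (n + 1) → ℝ) × ℝ) ≃ₗ[ℝ] ((Fin (n + 1) → ℝ) × ℝ)) := fun τ =>
    e₂.symm.trans (e₁ τ)
  have hM : ∀ τ y s, (M τ).toLinearMap (L₂ y + s • v) = L₁ y + s • u + (s * τ) • L₁ w := by
    intro τ y s
    change e₁ τ (e₂.symm _) = _
    rw [← he₂, LinearEquiv.symm_apply_apply, he₁]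
    module
  have hMsymm : ∀ τ y s, (M τ).symm.toLinearMap (L₁ y + s • (-u)) =
      L₂ y + s • (-v) + (s * τ) • L₂ w := by
    intro τ y s
    change (M τ).symm _ = _
    rw [LinearEquiv.symm_apply_eq]
    have h1 := hM τ (y + (s * τ) • w) (-s)
    have h2 : L₂ y + s • (-v) + (s * τ) • L₂ w = L₂ (y + (s * τ) • w) + (-s) • v := by
      rw [map_add, map_smul]; module
    rw [h2]
    change _ = (M τ).toLinearMap _
    rw [h1, map_add, map_smul]
    module
  have hsplit₂ : ∀ x, ∃ y, (x, (1 : ℝ)) = L₂ y + g x • v := by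
    intro x
    obtain ⟨⟨y, s⟩, hys⟩ := e₂.surjective (x, 1)
    rw [he₂] at hys
    refine ⟨y, ?_⟩
    have := congrArg (homog g) hys
    rw [map_add, map_smul, hgL', hgv, homog_mk_one] at this
    rw [← hys, ← this]; simp
  have hsplit₁ : ∀ x, ∃ y, (x, (1 : ℝ)) = L₁ y + f x • (-u) := by
    intro x
    obtain ⟨⟨y, s⟩, hys⟩ := (e₁ 0).surjective (x, 1)
    rw [he₁, zero_smul, add_zero] at hys
    refine ⟨y, ?_⟩
    have := congrArg (homog f) hys
    rw [map_add, map_smul, hfL', hfu, homog_mk_one] at this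
    rw [← hys, ← this]; simp
  have hev₁ := eventually_le_shear (N := fun τ => (M τ).toLinearMap) hM hQ hg hsplit₂ hpos₂ hGX
    (η := LinearMap.snd ℝ _ _) (fun x hx => (hpos₁ x hx).le) hw
  have hev₂ := eventually_all.2 fun j => eventually_le_shear (N := fun τ => (M τ).toLinearMap) hM
    hQ hg hsplit₂ hpos₂ hGX (η := homog (h j)) (fun x hx => hhX x hx j) (hhw j)
  have hev₃ := eventually_all.2 fun i => eventually_le_shear
    (N := fun τ => (M τ).symm.toLinearMap) hMsymm
    hP hf hsplit₁ hpos₁ hFX (η := homog (k i)) (fun x hx => hkX x hx i) (hkw i)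
  obtain ⟨τ, hτ₁, hτ₂, hτ₃⟩ := (hev₁.and (hev₂.and hev₃)).exists
  set T := (M τ).toLinearMap with hT
  have hTinj : Function.Injective T := (M τ).injective
  have hTL : ∀ y, T (L₂ y) = L₁ y := fun y => by
    have := hM τ y 0
    rw [zero_mul, zero_smul, zero_smul, zero_smul, add_zero, add_zero, add_zero] at this
    exact this
  have hTpos : PosOn T Q := by
    intro x hx
    rcases (hg x hx).eq_or_lt with h0 | hlt
    · have hxX : x ∈ pmap L₂ '' X := by rw [hGX]; exact ⟨hx, h0.symm⟩
      obtain ⟨y, hy, rfl⟩ := hxX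
      rw [mk_pmap (hpos₂ y hy), map_smul, hTL]
      exact mul_pos (inv_pos.2 (hpos₂ y hy)) (hpos₁ y hy)
    · exact hlt.trans_le (hτ₁ x hx)
  have hTG : pmap T '' G = F := by
    rw [hG₂, hF₁, image_image]
    refine image_congr fun x hx => ?_
    rw [← pmap_comp hpos₂ hx]
    have : T ∘ₗ L₂ = L₁ := LinearMap.ext hTL
    rw [this]
  refine ⟨T, hTinj, hTpos, hTG, ?_⟩
  have hfT : ∀ z, homog f (T z) = -homog g z := by
    intro z
    obtain ⟨⟨y, s⟩, rfl⟩ := e₂.surjective z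
    rw [he₂, hM, map_add, map_add, map_smul, map_smul, hfL', hfL', hfu, map_add, map_smul, hgL',
      hgv]
    simp
  have hfimg : ∀ x ∈ Q, (-f) (pmap T x) = (T (x, 1)).2⁻¹ * g x := fun x hx => by
    have h1 := linear_pmap (hTpos x hx) f
    rw [hfT, homog_mk_one] at h1
    have := (hTpos x hx).ne'
    simp only [AffineMap.coe_neg, Pi.neg_apply]
    field_simp
    linarith
  let k' : K → (Fin (n + 1) → ℝ) →ᵃ[ℝ] ℝ := fun i => dehomog (homog (k i) ∘ₗ (M τ).symm.toLinearMap)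
  have hkimg : ∀ x ∈ Q, ∀ i, k' i (pmap T x) = (T (x, 1)).2⁻¹ * k i x := fun x hx i => by
    simp only [k', dehomog_apply, LinearMap.comp_apply]
    rw [mk_pmap (hTpos x hx), map_smul, map_smul]
    have : (M τ).symm.toLinearMap (T (x, 1)) = (x, 1) := (M τ).symm_apply_apply _
    rw [this, homog_mk_one, smul_eq_mul]
  have hFQ : F = {x ∈ pmap T '' Q | (-f) x = 0} := by
    rw [← hTG]
    ext y
    constructor
    · rintro ⟨x, hx, rfl⟩
      rw [hGg] at hx
      exact ⟨⟨x, hx.1, rfl⟩, by rw [hfimg x hx.1, hx.2, mul_zero]⟩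
    · rintro ⟨⟨x, hx, rfl⟩, h0⟩
      rw [hfimg x hx] at h0
      refine ⟨x, ?_, rfl⟩
      rw [hGg]
      exact ⟨hx, (mul_eq_zero.1 h0).resolve_left (inv_ne_zero (hTpos x hx).ne')⟩
  have hfacet : IsFacet (pmap T '' Q) F := hTG ▸ hG.image_pmap hTinj hTpos
  have hmemQ := eq_setOf_facet_ineq (hQ.image_pmap hTinj hTpos) (f := -f) (h := k')
    (by rintro _ ⟨x, hx, rfl⟩
        rw [hfimg x hx]
        exact mul_nonneg (inv_nonneg.2 (hTpos x hx).le) (hg x hx))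
    hFQ hfacet.ne
    (by rintro _ ⟨x, hx, rfl⟩ i
        rw [hkimg x hx]
        exact mul_nonneg (inv_nonneg.2 (hTpos x hx).le) (hk x hx i))
    (by rintro E hE hne
        rw [properFaces_image_pmap hTinj hTpos] at hE
        obtain ⟨E', hE', rfl⟩ := hE
        obtain ⟨c, hc⟩ := hcovQ E' hE' hne.of_image
        refine ⟨c, ?_⟩
        rintro _ ⟨x, hx, rfl⟩
        have hxQ := subset_of_mem_faces hE'.1 hx
        have h0 := hc x hx
        cases c with
        | none => exact (hfimg x hxQ).trans (by rw [show g x = 0 from h0, mul_zero])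
        | some i => exact (hkimg x hxQ i).trans (by rw [show k i x = 0 from h0, mul_zero]))
    (by obtain ⟨z, hz, hzpos⟩ := hrelG
        have hzQ := subset_of_mem_faces hG.1 hz
        refine ⟨pmap T z, hTG ▸ mem_image_of_mem _ hz, fun i => ?_⟩
        rw [hkimg z hzQ]
        exact mul_pos (inv_pos.2 (hTpos z hzQ)) (hzpos i))
  have hglued : Glued (-f) h k' P (pmap T '' Q) F :=
    { mem_left := fun x => by rw [hmemP]; simp
      mem_right := hmemQ
      face_left := by simpa using hFf
      face_right := hFQ
      pos_left := fun x hx hlt i => by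
        have h1 := hτ₃ i x hx
        simp only [AffineMap.coe_neg, Pi.neg_apply, Left.neg_neg_iff] at hlt
        simp only [k', dehomog_apply, LinearMap.comp_apply]
        exact hlt.trans_le h1
      pos_right := by
        rintro _ ⟨x, hx, rfl⟩ hlt j
        rw [hfimg x hx] at hlt
        have hinv := inv_pos.2 (hTpos x hx)
        have hgx : 0 < g x := (pos_iff_pos_of_mul_pos hlt).1 hinv
        have h1 := hgx.trans_le (hτ₂ j x hx)
        change 0 < homog (h j) (T (x, 1)) at h1
        rw [linear_pmap (hTpos x hx)] at h1
        exact (pos_iff_pos_of_mul_pos h1).1 (hTpos x hx)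
      exists_left := ⟨p, hp, by simpa using hfp⟩
      exists_right := ⟨pmap T q, mem_image_of_mem _ hq, by
        rw [hfimg q hq]; exact mul_pos (inv_pos.2 (hTpos q hq)) hgq⟩ }
  exact hglued.isConnectedSum hF hfacet

/-! ### Cubes with prescribed bottom and top -/

/-- There is an `(n + 1)`-cube with two opposite facets projectively equivalent to `X` and `Y`. -/
def Step {n : ℕ} (X Y : Set (Fin n → ℝ)) : Prop :=
  ∃ W B U : Set (Fin (n + 1) → ℝ), IsCube (n + 1) W ∧ IsFacet W B ∧ IsFacet W U ∧ Disjoint B U ∧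
    HomEquiv X B ∧ HomEquiv Y U

lemma Step.symm {n : ℕ} {X Y : Set (Fin n → ℝ)} (h : Step X Y) : Step Y X := by
  obtain ⟨W, B, U, hW, hB, hU, hd, hX, hY⟩ := h
  exact ⟨W, U, B, hW, hU, hB, hd.symm, hY, hX⟩

lemma Step.trans_homEquiv {n : ℕ} {X Y Z : Set (Fin n → ℝ)} (h : Step X Y) (h' : HomEquiv Y Z) :
    Step X Z := by
  obtain ⟨W, B, U, hW, hB, hU, hd, hX, hY⟩ := h
  exact ⟨W, B, U, hW, hB, hU, hd, hX, h'.symm.trans hY⟩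

/-- The affine embedding `x ↦ (l x, x)` of `ℝⁿ` as the graph of `l` in `ℝⁿ⁺¹`. -/
noncomputable def graphMap {n : ℕ} (l : (Fin n → ℝ) →ᵃ[ℝ] ℝ) :
    (Fin n → ℝ) →ᵃ[ℝ] (Fin (n + 1) → ℝ) :=
  AffineMap.pi fun i => Fin.cases l (fun j => (LinearMap.proj j).toAffineMap) i

@[simp] lemma graphMap_zero {n : ℕ} (l : (Fin n → ℝ) →ᵃ[ℝ] ℝ) (x : Fin n → ℝ) :
    graphMap l x 0 = l x := rfl

@[simp] lemma graphMap_succ {n : ℕ} (l : (Fin n → ℝ) →ᵃ[ℝ] ℝ) (x : Fin n → ℝ) (j : Fin n) :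
    graphMap l x j.succ = x j := rfl

lemma graphMap_injective {n : ℕ} (l : (Fin n → ℝ) →ᵃ[ℝ] ℝ) : Function.Injective (graphMap l) :=
  fun x y h => funext fun j => by
    have := congrFun h j.succ
    simpa using this

/-- Precomposition of an affine functional with the projection `(t, x) ↦ x`. -/
noncomputable def liftTail {n : ℕ} (a : (Fin n → ℝ) →ᵃ[ℝ] ℝ) : (Fin (n + 1) → ℝ) →ᵃ[ℝ] ℝ :=
  a.comp (LinearMap.funLeft ℝ ℝ Fin.succ).toAffineMap

@[simp] lemma liftTail_apply {n : ℕ} (a : (Fin n → ℝ) →ᵃ[ℝ] ℝ) (y : Fin (n + 1) → ℝ) :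
    liftTail a y = a (Fin.tail y) := rfl

@[simp] lemma tail_graphMap {n : ℕ} (l : (Fin n → ℝ) →ᵃ[ℝ] ℝ) (x : Fin n → ℝ) :
    Fin.tail (graphMap l x) = x := rfl

lemma eq_graphMap {n : ℕ} {l : (Fin n → ℝ) →ᵃ[ℝ] ℝ} {y : Fin (n + 1) → ℝ}
    (h : y 0 = l (Fin.tail y)) : graphMap l (Fin.tail y) = y := by
  ext i
  refine Fin.cases ?_ (fun j => ?_) i
  · rw [graphMap_zero, h]
  · rfl

lemma finrank_vectorSpan_of_homEquiv {n m : ℕ} {X : Set (Fin n → ℝ)} {Y : Set (Fin m → ℝ)}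
    (h : HomEquiv X Y) : Module.finrank ℝ (vectorSpan ℝ Y) = Module.finrank ℝ (vectorSpan ℝ X) := by
  obtain ⟨L, hL, hX, rfl⟩ := h
  exact finrank_vectorSpan_image_pmap hL hX

lemma step_of_cubeSystem {n : ℕ} {h : Fin (n + 1) → Bool → (Fin (n + 1) → ℝ) →ᵃ[ℝ] ℝ}
    {W : Set (Fin (n + 1) → ℝ)} (H : CubeSystem ⊤ h W) (hW : IsCompact W) {X Y : Set (Fin n → ℝ)}
    (hX : Module.finrank ℝ (vectorSpan ℝ X) = n) (hY : Module.finrank ℝ (vectorSpan ℝ Y) = n)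
    (hXB : HomEquiv X {y ∈ W | h 0 true y = 0}) (hYU : HomEquiv Y {y ∈ W | h 0 false y = 0}) :
    Step X Y := by
  have hcube := H.isCube_of_isCompact hW
  have hfacet : ∀ b {Z : Set (Fin n → ℝ)}, Module.finrank ℝ (vectorSpan ℝ Z) = n →
      HomEquiv Z {y ∈ W | h 0 b y = 0} → IsFacet W {y ∈ W | h 0 b y = 0} := by
    intro b Z hZ hZb
    refine ⟨mem_faces_iff.2 ⟨h 0 b, fun x hx => H.nonneg hx 0 b, rfl⟩, ?_, ?_⟩
    · obtain ⟨x, hx, h0⟩ := H.vert fun _ => b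
      exact ⟨x, hx, h0 0⟩
    · rw [finrank_vectorSpan_of_homEquiv hZb, hZ, hcube.1.2]
  refine ⟨W, _, _, hcube, hfacet true hX hXB, hfacet false hY hYU, ?_, hXB, hYU⟩
  rw [disjoint_left]
  rintro y ⟨hy, h1⟩ ⟨-, h2⟩
  exact H.disj y hy 0 h1 h2

lemma isCube_unitCube (n : ℕ) : IsCube n (Icc (0 : Fin n → ℝ) 1) :=
  (cubeSystem_unitCube n).isCube_of_isCompact isCompact_Icc

lemma step_unitCube (n : ℕ) : Step (Icc (0 : Fin n → ℝ) 1) (Icc (0 : Fin n → ℝ) 1) := by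
  have hgraph : ∀ c : ℝ, 0 ≤ c → c ≤ 1 → ∀ p : (Fin (n + 1) → ℝ) → Prop, (∀ y, p y ↔ y 0 = c) →
      HomEquiv (Icc (0 : Fin n → ℝ) 1) {y ∈ Icc (0 : Fin (n + 1) → ℝ) 1 | p y} := by
    intro c hc0 hc1 p hp
    have h1 := HomEquiv.of_affine (graphMap (AffineMap.const ℝ (Fin n → ℝ) c))
      (graphMap_injective _) (Icc 0 1)
    convert h1 using 1
    ext y
    simp only [mem_ofPred_eq, hp, mem_image]
    constructor
    · rintro ⟨⟨h0, h1⟩, hy⟩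
      exact ⟨Fin.tail y, ⟨fun j => h0 j.succ, fun j => h1 j.succ⟩, eq_graphMap (by simpa using hy)⟩
    · rintro ⟨x, ⟨h0, h1⟩, rfl⟩
      refine ⟨⟨fun i => ?_, fun i => ?_⟩, by simp⟩
      · refine Fin.cases ?_ (fun j => ?_) i
        exacts [hc0, h0 j]
      · refine Fin.cases ?_ (fun j => ?_) i
        exacts [hc1, h1 j]
  refine step_of_cubeSystem (cubeSystem_unitCube (n + 1)) isCompact_Icc
    (isCube_unitCube n).1.2 (isCube_unitCube n).1.2 (hgraph 0 le_rfl zero_le_one _ fun y => ?_)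
    (hgraph 1 zero_le_one le_rfl _ fun y => ?_)
  · rw [unitCubeIneq_true]
  · rw [unitCubeIneq_false, sub_eq_zero, eq_comm]

/-- Replace the constraint `h i false` by `h i true ≤ ε`. -/
noncomputable def cutSystem {n : ℕ} (h : Fin n → Bool → (Fin n → ℝ) →ᵃ[ℝ] ℝ) (i : Fin n) (ε : ℝ) :
    Fin n → Bool → (Fin n → ℝ) →ᵃ[ℝ] ℝ :=
  fun j b => if j = i ∧ b = false then AffineMap.const ℝ _ ε - h i true else h j b

lemma cutSystem_self {n : ℕ} (h : Fin n → Bool → (Fin n → ℝ) →ᵃ[ℝ] ℝ) (i : Fin n) (ε : ℝ) :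
    cutSystem h i ε i false = AffineMap.const ℝ _ ε - h i true := by
  simp [cutSystem]

lemma cutSystem_true {n : ℕ} (h : Fin n → Bool → (Fin n → ℝ) →ᵃ[ℝ] ℝ) (i j : Fin n) (ε : ℝ) :
    cutSystem h i ε j true = h j true := by
  simp [cutSystem]

lemma cutSystem_of_ne {n : ℕ} (h : Fin n → Bool → (Fin n → ℝ) →ᵃ[ℝ] ℝ) {i j : Fin n} (ε : ℝ)
    (hij : j ≠ i) (b : Bool) : cutSystem h i ε j b = h j b := by
  simp [cutSystem, hij]

section cut

variable {n : ℕ} {h : Fin n → Bool → (Fin n → ℝ) →ᵃ[ℝ] ℝ} {X : Set (Fin n → ℝ)}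

/-- If the slice `h i true = ε` separates the two opposite facets, it meets every edge between
them. -/
lemma CubeSystem.exists_cut_vertex (H : CubeSystem ⊤ h X) (i : Fin n) {ε : ℝ} (hε : 0 < ε)
    (hsep : ∀ x ∈ X, h i false x = 0 → ε < h i true x) (σ : Fin n → Bool) (hσ : σ i = false) :
    ∃ x ∈ X, h i true x = ε ∧ ∀ j, j ≠ i → h j (σ j) x = 0 := by
  obtain ⟨x₀, hx₀, h0⟩ := H.vert (Function.update σ i true)
  obtain ⟨x₁, hx₁, h1⟩ := H.vert σ
  have h0i : h i true x₀ = 0 := by simpa using h0 i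
  have h1i : ε < h i true x₁ := hsep x₁ hx₁ (by rw [← hσ]; exact h1 i)
  have hpos : 0 < h i true x₁ := hε.trans h1i
  set t := ε / h i true x₁ with ht
  have ht0 : 0 ≤ t := by positivity
  have ht1 : t ≤ 1 := by rw [ht, div_le_one hpos]; exact h1i.le
  refine ⟨(1 - t) • x₀ + t • x₁, H.convex hx₀ hx₁ (by linarith) ht0 (by ring), ?_, fun j hj => ?_⟩
  · rw [affine_combo _ _ _ (by ring), h0i, ht]
    field_simp
    ring
  · have h2 := h0 j
    rw [Function.update_of_ne hj] at h2
    rw [affine_combo _ _ _ (by ring), h2, h1 j]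
    ring

/-- A slice `h i true = ε` separating the two opposite facets cuts off a cube. -/
lemma CubeSystem.cut (H : CubeSystem ⊤ h X) (i : Fin n) {ε : ℝ} (hε : 0 < ε)
    (hsep : ∀ x ∈ X, h i false x = 0 → ε < h i true x) :
    CubeSystem ⊤ (cutSystem h i ε) {x ∈ X | h i true x ≤ ε} := by
  refine ⟨?_, ?_, ?_⟩
  · apply Subset.antisymm
    · rintro x ⟨hx, hxε⟩
      refine ⟨trivial, fun j b => ?_⟩
      by_cases hj : j = i ∧ b = false
      · obtain ⟨rfl, rfl⟩ := hj
        rw [cutSystem_self]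
        simpa using hxε
      · simp only [cutSystem, hj, if_false]
        exact H.nonneg hx j b
    · rintro y ⟨-, hy⟩
      have hyε : h i true y ≤ ε := by
        have := hy i false
        rw [cutSystem_self] at this
        simpa using this
      have hy' : ∀ j b, ¬(j = i ∧ b = false) → 0 ≤ h j b y := fun j b hjb => by
        have := hy j b
        simpa only [cutSystem, hjb, if_false] using this
      have hmem : ∀ z, (∀ j b, ¬(j = i ∧ b = false) → 0 ≤ h j b z) → 0 ≤ h i false z → z ∈ X := by
        intro z hz hzi
        rw [H.eq]
        refine ⟨trivial, fun j b => ?_⟩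
        by_cases hj : j = i ∧ b = false
        · obtain ⟨rfl, rfl⟩ := hj; exact hzi
        · exact hz j b hj
      refine ⟨hmem y hy' (not_lt.1 fun hneg => ?_), hyε⟩
      -- otherwise the dropped constraint becomes active at a point of `X` below the cut
      obtain ⟨x₀, hx₀, h0⟩ := H.vert fun _ => true
      obtain ⟨t, ht0, ht1, hz0, -, hz⟩ := exists_first_zero (fun _ : Unit => h i false)
        (fun _ => H.pos_of_eq_zero hx₀ (h0 i)) ⟨(), hneg⟩
      have hzX := hmem _ (fun j b hjb => by
        rw [affine_combo _ _ _ (by ring)]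
        have h1 := H.nonneg hx₀ j b
        have h2 := hy' j b hjb
        have : 0 ≤ 1 - t := by linarith
        positivity) hz.ge
      have h3 := hsep _ hzX hz
      rw [affine_combo _ _ _ (by ring), h0 i] at h3
      nlinarith
  · rintro x ⟨hx, hxε⟩ j h1 h2
    rw [cutSystem_true] at h1
    by_cases hj : j = i
    · subst hj
      rw [cutSystem_self] at h2
      simp [h1] at h2
      exact hε.ne' h2
    · rw [cutSystem_of_ne h ε hj] at h2
      exact H.disj x hx j h1 h2
  · intro σ
    cases hσ : σ i with
    | true =>
      obtain ⟨x, hx, h0⟩ := H.vert σ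
      have h0i := h0 i
      rw [hσ] at h0i
      refine ⟨x, ⟨hx, by rw [h0i]; exact hε.le⟩, fun j => ?_⟩
      have : ¬(j = i ∧ σ j = false) := by rintro ⟨rfl, h2⟩; rw [hσ] at h2; cases h2
      simp only [cutSystem, this, if_false]
      exact h0 j
    | false =>
      obtain ⟨x, hx, hxi, h0⟩ := H.exists_cut_vertex i hε hsep σ hσ
      refine ⟨x, ⟨hx, hxi.le⟩, fun j => ?_⟩
      by_cases hj : j = i
      · subst hj
        rw [hσ, cutSystem_self]
        simp [hxi]
      · rw [cutSystem_of_ne h ε hj]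
        exact h0 j hj

/-- The inequalities of the cube over `X` between the graphs of `0` and `l`, whose facet over
`h i false = 0` is tilted to `t ≤ h i false`. -/
noncomputable def wedgeSystem {n : ℕ} (h : Fin n → Bool → (Fin n → ℝ) →ᵃ[ℝ] ℝ) (i : Fin n)
    (l : (Fin n → ℝ) →ᵃ[ℝ] ℝ) : Fin (n + 1) → Bool → (Fin (n + 1) → ℝ) →ᵃ[ℝ] ℝ :=
  Fin.cases (fun b => if b then (LinearMap.proj 0).toAffineMap
      else liftTail l - (LinearMap.proj 0).toAffineMap)
    fun j b => if j = i ∧ b = false then liftTail (h i false) - (LinearMap.proj 0).toAffineMap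
      else liftTail (h j b)

@[simp] lemma wedgeSystem_zero_true (i : Fin n) (l : (Fin n → ℝ) →ᵃ[ℝ] ℝ) (y : Fin (n + 1) → ℝ) :
    wedgeSystem h i l 0 true y = y 0 := rfl

@[simp] lemma wedgeSystem_zero_false (i : Fin n) (l : (Fin n → ℝ) →ᵃ[ℝ] ℝ) (y : Fin (n + 1) → ℝ) :
    wedgeSystem h i l 0 false y = l (Fin.tail y) - y 0 := rfl

lemma wedgeSystem_succ_self (i : Fin n) (l : (Fin n → ℝ) →ᵃ[ℝ] ℝ) (y : Fin (n + 1) → ℝ) :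
    wedgeSystem h i l i.succ false y = h i false (Fin.tail y) - y 0 := by
  simp [wedgeSystem]

lemma wedgeSystem_succ_of_ne {i j : Fin n} {b : Bool} (hjb : ¬(j = i ∧ b = false))
    (l : (Fin n → ℝ) →ᵃ[ℝ] ℝ) (y : Fin (n + 1) → ℝ) :
    wedgeSystem h i l j.succ b y = h j b (Fin.tail y) := by
  simp [wedgeSystem, hjb]

/-- The wedge over `X` with `l = h i false - c (ε - h i true)`: its top facet is the graph of `l`
over the part of `X` cut off by `h i true ≤ ε`. -/
lemma CubeSystem.wedge (H : CubeSystem ⊤ h X) (i : Fin n) {ε c : ℝ} (hε : 0 < ε) (hc : 0 < c)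
    (hsep : ∀ x ∈ X, h i false x = 0 → ε < h i true x) {l : (Fin n → ℝ) →ᵃ[ℝ] ℝ}
    (hl : ∀ x, l x = h i false x - c * (ε - h i true x)) (hlpos : ∀ x ∈ X, 0 < l x) :
    CubeSystem ⊤ (wedgeSystem h i l)
      {y | Fin.tail y ∈ X ∧ 0 ≤ y 0 ∧ y 0 ≤ l (Fin.tail y) ∧ y 0 ≤ h i false (Fin.tail y)} := by
  refine ⟨?_, ?_, ?_⟩
  · apply Subset.antisymm
    · rintro y ⟨hy, h1, h2, h3⟩
      refine ⟨trivial, fun j b => ?_⟩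
      refine Fin.cases ?_ (fun j => ?_) j
      · cases b
        · simpa using h2
        · simpa using h1
      · by_cases hjb : j = i ∧ b = false
        · obtain ⟨rfl, rfl⟩ := hjb
          rw [wedgeSystem_succ_self]
          linarith
        · rw [wedgeSystem_succ_of_ne hjb]
          exact H.nonneg hy j b
    · rintro y ⟨-, hy⟩
      have h1 : 0 ≤ y 0 := hy 0 true
      have h2 := hy 0 false
      rw [wedgeSystem_zero_false] at h2
      have h3 := hy i.succ false
      rw [wedgeSystem_succ_self] at h3
      refine ⟨?_, h1, by linarith, by linarith⟩
      rw [H.eq]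
      refine ⟨trivial, fun j b => ?_⟩
      by_cases hjb : j = i ∧ b = false
      · obtain ⟨rfl, rfl⟩ := hjb; linarith
      · have := hy j.succ b
        rwa [wedgeSystem_succ_of_ne hjb] at this
  · rintro y ⟨hy, h1, h2, h3⟩ j hj1 hj2
    induction j using Fin.cases with
    | zero =>
      simp only [wedgeSystem_zero_true] at hj1
      rw [wedgeSystem_zero_false, hj1] at hj2
      have := hlpos _ hy
      linarith
    | succ j =>
      rw [wedgeSystem_succ_of_ne (by simp)] at hj1
      by_cases hj : j = i
      · subst hj
        rw [wedgeSystem_succ_self] at hj2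
        rw [hl, hj1] at h2
        nlinarith [mul_pos hc hε]
      · rw [wedgeSystem_succ_of_ne (by simp [hj])] at hj2
        exact H.disj _ hy j hj1 hj2
  · intro σ
    cases h0 : σ 0 with
    | true =>
      obtain ⟨x, hx, hv⟩ := H.vert fun j => σ j.succ
      refine ⟨graphMap 0 x, ⟨hx, le_rfl, (hlpos x hx).le, H.nonneg hx i false⟩, fun j => ?_⟩
      induction j using Fin.cases with
      | zero => rw [h0]; rfl
      | succ j =>
        by_cases hjb : j = i ∧ σ j.succ = false
        · have hvj := hv j
          obtain ⟨rfl, hb⟩ := hjb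
          rw [hb] at hvj ⊢
          rw [wedgeSystem_succ_self, tail_graphMap, hvj]
          simp
        · rw [wedgeSystem_succ_of_ne hjb]
          exact hv j
    | false =>
      cases hi : σ i.succ with
      | true =>
        obtain ⟨x, hx, hv⟩ := H.vert fun j => σ j.succ
        have hvi := hv i
        simp only [hi] at hvi
        refine ⟨graphMap l x, ⟨hx, (hlpos x hx).le, le_rfl, ?_⟩, fun j => ?_⟩
        · rw [graphMap_zero, tail_graphMap, hl, hvi]
          nlinarith [mul_pos hc hε]
        · induction j using Fin.cases with
          | zero => rw [h0]; simp
          | succ j =>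
            rw [wedgeSystem_succ_of_ne]
            · exact hv j
            · rintro ⟨rfl, h2⟩; rw [hi] at h2; cases h2
      | false =>
        obtain ⟨x, hx, hxi, hv⟩ := H.exists_cut_vertex i hε hsep (fun j => σ j.succ) hi
        have hlx : l x = h i false x := by rw [hl, hxi]; ring
        refine ⟨graphMap l x, ⟨hx, (hlpos x hx).le, le_rfl, hlx.le⟩, fun j => ?_⟩
        induction j using Fin.cases with
        | zero => rw [h0]; simp
        | succ j =>
          by_cases hj : j = i
          · subst hj
            rw [hi, wedgeSystem_succ_self, tail_graphMap, graphMap_zero, hlx, sub_self]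
          · rw [wedgeSystem_succ_of_ne (by simp [hj])]
            exact hv j hj

lemma isCompact_cut (hX : IsCompact X) (i : Fin n) (ε : ℝ) :
    IsCompact {x ∈ X | h i true x ≤ ε} :=
  hX.inter_right (isClosed_le (continuous_affine _) continuous_const)

/-- A cut close to the facet `h i true = 0` is a step. -/
lemma CubeSystem.exists_cut (H : CubeSystem ⊤ h X) (hX : IsCompact X) (i : Fin n) :
    ∃ ε > 0, CubeSystem ⊤ (cutSystem h i ε) {x ∈ X | h i true x ≤ ε} ∧
      Step X {x ∈ X | h i true x ≤ ε} := by
  -- the cut must separate the two facets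
  obtain ⟨ε, hε, hsep⟩ : ∃ ε > 0, ∀ x ∈ X, h i false x = 0 → ε < h i true x := by
    have hcomp : IsCompact {x ∈ X | h i false x = 0} :=
      hX.inter_right (isClosed_eq (continuous_affine _) continuous_const)
    obtain ⟨x₁, hx₁, h1⟩ := H.vert fun _ => false
    obtain ⟨z, hz, hmin⟩ := hcomp.exists_isMinOn ⟨x₁, hx₁, h1 i⟩
      (continuous_affine (h i true)).continuousOn
    have hzpos : 0 < h i true z := H.pos_of_eq_zero hz.1 hz.2
    refine ⟨h i true z / 2, by positivity, fun x hx hx0 => ?_⟩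
    have h2 : h i true z ≤ h i true x := hmin (show x ∈ {x ∈ X | h i false x = 0} from ⟨hx, hx0⟩)
    linarith
  -- the height function of the wedge must be positive on `X`
  obtain ⟨c, hc, hcpos⟩ : ∃ c > 0, ∀ x ∈ X, 0 < h i false x - c * (ε - h i true x) := by
    obtain ⟨x₀, hx₀, h0⟩ := H.vert fun _ => true
    obtain ⟨z, hz, hmin⟩ := (isCompact_cut (h := h) hX i ε).exists_isMinOn
      ⟨x₀, hx₀, by rw [h0 i]; exact hε.le⟩ (continuous_affine (h i false)).continuousOn
    have hzpos : 0 < h i false z := by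
      refine lt_of_le_of_ne (H.nonneg hz.1 i false) fun heq => ?_
      have h2 := hsep z hz.1 heq.symm
      have h3 : h i true z ≤ ε := hz.2
      linarith
    refine ⟨h i false z / (2 * ε), by positivity, fun x hx => ?_⟩
    have hx0 := H.nonneg hx i true
    have hx1 := H.nonneg hx i false
    have hcpos : 0 < h i false z / (2 * ε) := by positivity
    rcases le_or_gt (h i true x) ε with hle | hlt
    · have h2 : h i false z ≤ h i false x := hmin (show x ∈ {x ∈ X | h i true x ≤ ε} from ⟨hx, hle⟩)
      have h3 : h i false z / (2 * ε) * (ε - h i true x) ≤ h i false z / (2 * ε) * ε := by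
        gcongr; linarith
      have h4 : h i false z / (2 * ε) * ε = h i false z / 2 := by field_simp
      linarith
    · nlinarith [mul_pos hcpos (sub_pos.2 hlt)]
  have Hcut := H.cut i hε hsep
  refine ⟨ε, hε, Hcut, ?_⟩
  let l : (Fin n → ℝ) →ᵃ[ℝ] ℝ := h i false - c • (AffineMap.const ℝ _ ε - h i true)
  have hl : ∀ x, l x = h i false x - c * (ε - h i true x) := fun x => by simp [l]
  have hlpos : ∀ x ∈ X, 0 < l x := fun x hx => by rw [hl]; exact hcpos x hx
  have HW := H.wedge i hε hc hsep hl hlpos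
  have hcont : Continuous (Fin.tail : (Fin (n + 1) → ℝ) → Fin n → ℝ) :=
    continuous_pi fun j => continuous_apply j.succ
  have hWc : IsCompact {y : Fin (n + 1) → ℝ | Fin.tail y ∈ X ∧ 0 ≤ y 0 ∧ y 0 ≤ l (Fin.tail y) ∧
      y 0 ≤ h i false (Fin.tail y)} := by
    obtain ⟨C, hC⟩ := (hX.image (continuous_affine (h i false))).bddAbove
    have hbox : IsCompact ((fun p : ℝ × (Fin n → ℝ) => (Fin.cons p.1 p.2 : Fin (n + 1) → ℝ)) ''
        (Icc 0 C ×ˢ X)) := by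
      refine (isCompact_Icc.prod hX).image ?_
      refine continuous_pi fun j => ?_
      induction j using Fin.cases with
      | zero => exact continuous_fst
      | succ j => exact (continuous_apply j).comp continuous_snd
    refine hbox.of_isClosed_subset ?_ ?_
    · refine (hX.isClosed.preimage hcont).inter (IsClosed.inter ?_ (IsClosed.inter ?_ ?_))
      · exact isClosed_le continuous_const (continuous_apply 0)
      · exact isClosed_le (continuous_apply 0) ((continuous_affine l).comp hcont)
      · exact isClosed_le (continuous_apply 0) ((continuous_affine _).comp hcont)
    · rintro y ⟨hy, h1, -, h3⟩
      refine ⟨(y 0, Fin.tail y), ⟨⟨h1, h3.trans (hC (mem_image_of_mem _ hy))⟩, hy⟩, ?_⟩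
      exact Fin.cons_self_tail y
  refine step_of_cubeSystem HW hWc (H.isCube_of_isCompact hX).1.2
    (Hcut.isCube_of_isCompact (isCompact_cut hX i ε)).1.2 ?_ ?_
  · have h1 := HomEquiv.of_affine (graphMap (0 : (Fin n → ℝ) →ᵃ[ℝ] ℝ)) (graphMap_injective _) X
    convert h1 using 1
    ext y
    constructor
    · rintro ⟨⟨hy, -, -, -⟩, h0⟩
      exact ⟨Fin.tail y, hy, eq_graphMap h0⟩
    · rintro ⟨x, hx, rfl⟩
      exact ⟨⟨hx, le_rfl, (hlpos x hx).le, H.nonneg hx i false⟩, rfl⟩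
  · have h1 := HomEquiv.of_affine (graphMap l) (graphMap_injective _) {x ∈ X | h i true x ≤ ε}
    convert h1 using 1
    ext y
    constructor
    · rintro ⟨⟨hy, -, -, h3⟩, h0⟩
      rw [wedgeSystem_zero_false, sub_eq_zero] at h0
      refine ⟨Fin.tail y, ⟨hy, ?_⟩, eq_graphMap h0.symm⟩
      rw [← h0, hl] at h3
      by_contra hcon
      push Not at hcon
      nlinarith [mul_pos hc (sub_pos.2 hcon)]
    · rintro ⟨x, ⟨hx, hxε⟩, rfl⟩
      refine ⟨⟨hx, (hlpos x hx).le, le_rfl, ?_⟩, by simp⟩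
      rw [graphMap_zero, tail_graphMap, hl]
      nlinarith [mul_nonneg hc.le (sub_nonneg.2 hxε)]

end cut

/-! ### Chains of cubes -/

/-- `X` and `Y` are joined by a sequence of `k` cubes, each with bottom projectively equivalent to
the top of its predecessor. -/
def Chain {n : ℕ} : ℕ → Set (Fin n → ℝ) → Set (Fin n → ℝ) → Prop
  | 0, X, Y => HomEquiv X Y
  | k + 1, X, Y => ∃ Z, Chain k X Z ∧ Step Z Y

namespace Chain

variable {n : ℕ} {X Y Z : Set (Fin n → ℝ)}

lemma trans_homEquiv {k : ℕ} (h : Chain k X Y) (h' : HomEquiv Y Z) : Chain k X Z := by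
  cases k with
  | zero => exact HomEquiv.trans h h'
  | succ k =>
    obtain ⟨R, hR, hS⟩ := h
    exact ⟨R, hR, hS.trans_homEquiv h'⟩

lemma trans {k l : ℕ} (h : Chain k X Y) (h' : Chain l Y Z) : Chain (k + l) X Z := by
  induction l generalizing Z with
  | zero => exact h.trans_homEquiv h'
  | succ l ih =>
    obtain ⟨R, hR, hS⟩ := h'
    exact ⟨R, ih hR, hS⟩

lemma of_step (h : Step X Y) : Chain 1 X Y := ⟨X, HomEquiv.refl X, h⟩

lemma symm {k : ℕ} (h : Chain k X Y) : Chain k Y X := by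
  induction k generalizing Y with
  | zero => exact HomEquiv.symm h
  | succ k ih =>
    obtain ⟨R, hR, hS⟩ := h
    have := (of_step hS.symm).trans (ih hR)
    rwa [add_comm] at this

end Chain

/-- After `k` cuts, the two constraints of each of the first `k` pairs bound the same functional. -/
lemma CubeSystem.exists_chain {n : ℕ} {h : Fin n → Bool → (Fin n → ℝ) →ᵃ[ℝ] ℝ}
    {X : Set (Fin n → ℝ)} (H : CubeSystem ⊤ h X) (hX : IsCompact X) (k : ℕ) (hk : k ≤ n) :
    ∃ (Y : Set (Fin n → ℝ)) (h' : Fin n → Bool → (Fin n → ℝ) →ᵃ[ℝ] ℝ), Chain k X Y ∧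
      IsCompact Y ∧ CubeSystem ⊤ h' Y ∧
      ∀ j : Fin n, j.val < k → ∃ ε > 0, h' j false = AffineMap.const ℝ _ ε - h' j true := by
  induction k with
  | zero => exact ⟨X, h, HomEquiv.refl X, hX, H, fun j hj => absurd hj (Nat.not_lt_zero _)⟩
  | succ k ih =>
    obtain ⟨Y, h', hXY, hY, H', hε⟩ := ih (by omega)
    obtain ⟨ε, hε0, Hcut, hstep⟩ := H'.exists_cut hY ⟨k, hk⟩
    refine ⟨_, _, ⟨Y, hXY, hstep⟩, isCompact_cut hY _ ε, Hcut, fun j hj => ?_⟩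
    rw [cutSystem_true]
    by_cases hjk : j = ⟨k, hk⟩
    · subst hjk
      exact ⟨ε, hε0, cutSystem_self _ _ _⟩
    · rw [cutSystem_of_ne _ _ hjk]
      exact hε j (by have : j.val ≠ k := fun h => hjk (Fin.ext h)
                     omega)

/-- If the two constraints of each pair bound one and the same functional, the set is a
parallelotope. -/
lemma CubeSystem.homEquiv_unitCube {n : ℕ} {h : Fin n → Bool → (Fin n → ℝ) →ᵃ[ℝ] ℝ}
    {X : Set (Fin n → ℝ)} (H : CubeSystem ⊤ h X)
    (hε : ∀ j, ∃ ε > 0, h j false = AffineMap.const ℝ _ ε - h j true) :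
    HomEquiv X (Icc (0 : Fin n → ℝ) 1) := by
  choose ε hε0 hε using hε
  let ψ : (Fin n → ℝ) →ᵃ[ℝ] (Fin n → ℝ) := AffineMap.pi fun j => (ε j)⁻¹ • h j true
  have hψ : ∀ x j, ψ x j = (ε j)⁻¹ * h j true x := fun x j => rfl
  have hlin : Function.Surjective ψ.linear := by
    intro z
    obtain ⟨x₀, hx₀, h0⟩ := H.vert fun _ => true
    have hv : ∀ j : Fin n, ∃ v, ψ.linear v = Pi.single j 1 := by
      intro j
      obtain ⟨x, hx, h1⟩ := H.vert (Function.update (fun _ => true) j false)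
      refine ⟨x -ᵥ x₀, ?_⟩
      rw [ψ.linearMap_vsub, vsub_eq_sub]
      ext i
      rw [Pi.sub_apply, hψ, hψ, h0 i, mul_zero, sub_zero]
      have h1i := h1 i
      by_cases hij : i = j
      · subst hij
        rw [Function.update_self, hε] at h1i
        simp only [AffineMap.coe_sub, AffineMap.coe_const, Pi.sub_apply,
          Function.const_apply] at h1i
        rw [← sub_eq_zero.1 h1i, Pi.single_eq_same, inv_mul_cancel₀ (hε0 i).ne']
      · rw [Function.update_of_ne hij] at h1i
        rw [h1i, mul_zero, Pi.single_eq_of_ne hij]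
    choose v hv using hv
    refine ⟨∑ j, z j • v j, ?_⟩
    rw [map_sum]
    simp only [map_smul, hv]
    exact (pi_eq_sum_univ' z).symm
  have hinj : Function.Injective ψ :=
    (AffineMap.linear_injective_iff ψ).1 (LinearMap.injective_iff_surjective.2 hlin)
  have hsurj : Function.Surjective ψ := (AffineMap.linear_surjective_iff ψ).1 hlin
  have hX : X = ψ ⁻¹' Icc 0 1 := by
    conv_lhs => rw [H.eq]
    ext x
    simp only [mem_ofPred_eq, AffineSubspace.mem_top, true_and, Bool.forall_bool, mem_preimage,
      mem_Icc, Pi.le_def, hψ, Pi.zero_apply, Pi.one_apply, hε, AffineMap.coe_sub,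
      AffineMap.coe_const, Pi.sub_apply, Function.const_apply, sub_nonneg]
    rw [← forall_and]
    refine forall_congr' fun j => ?_
    rw [and_comm, inv_mul_le_iff₀ (hε0 j), mul_one]
    exact and_congr_left fun _ => ⟨fun h0 => mul_nonneg (inv_nonneg.2 (hε0 j).le) h0,
      fun h0 => nonneg_of_mul_nonneg_right h0 (inv_pos.2 (hε0 j))⟩
  have := HomEquiv.of_affine ψ hinj X
  rwa [hX, image_preimage_eq _ hsurj, ← hX] at this

lemma IsCube.chain_unitCube {n : ℕ} {X : Set (Fin n → ℝ)} (hX : IsCube n X) :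
    Chain n X (Icc (0 : Fin n → ℝ) 1) := by
  obtain ⟨h, H⟩ := hX.exists_cubeSystem
  obtain ⟨Y, h', hXY, -, H', hε⟩ := H.exists_chain hX.1.isCompact n le_rfl
  exact hXY.trans_homEquiv (H'.homEquiv_unitCube fun j => hε j j.2)

/-! ### Towers -/

lemma IsConnectedSum.isCubicalPolytope {n : ℕ} {P Q F : Set (Fin n → ℝ)}
    (h : IsConnectedSum P Q F) (hP : IsCubicalPolytope n P) (hQ : IsCubicalPolytope n Q) :
    IsCubicalPolytope n (P ∪ Q) := by
  refine ⟨⟨?_, le_antisymm ?_ ?_⟩, fun E hE hne => ?_⟩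
  · obtain ⟨⟨V, hV, hVne, hPV⟩, -⟩ := hP.1
    obtain ⟨⟨V', hV', -, hQV⟩, -⟩ := hQ.1
    refine ⟨V ∪ V', hV.union hV', hVne.mono subset_union_left, Subset.antisymm ?_ ?_⟩
    · refine union_subset ?_ ?_
      · rw [hPV]; exact convexHull_mono subset_union_left
      · rw [hQV]; exact convexHull_mono subset_union_right
    · refine convexHull_min (union_subset_union ?_ ?_) h.convex
      · rw [hPV]; exact subset_convexHull ℝ V
      · rw [hQV]; exact subset_convexHull ℝ V'
  · simpa using Submodule.finrank_le (vectorSpan ℝ (P ∪ Q))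
  · conv_lhs => rw [← hP.1.2]
    exact Submodule.finrank_mono (vectorSpan_mono ℝ subset_union_left)
  · rw [h.properFaces_eq] at hE
    rcases hE.1 with hE | hE
    exacts [hP.2 E hE hne, hQ.2 E hE hne]

lemma IsConnectedSum.symm {n : ℕ} {P Q F : Set (Fin n → ℝ)} (h : IsConnectedSum P Q F) :
    IsConnectedSum Q P F where
  facet_left := h.facet_right
  facet_right := h.facet_left
  inter_eq := by rw [inter_comm, h.inter_eq]
  convex := by rw [union_comm]; exact h.convex
  properFaces_eq := by rw [union_comm, h.properFaces_eq, union_comm (properFaces P)]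

lemma IsConnectedSum.isFacet {n : ℕ} {P Q F E : Set (Fin n → ℝ)} (h : IsConnectedSum P Q F)
    (hP : IsCubicalPolytope n P) (hQ : IsCubicalPolytope n Q) (hE : IsFacet P E) (hEF : E ≠ F) :
    IsFacet (P ∪ Q) E := by
  have hmem : E ∈ properFaces (P ∪ Q) := by
    rw [h.properFaces_eq]
    exact ⟨Or.inl hE.mem_properFaces, hEF⟩
  refine ⟨hmem.1, hE.2.1, ?_⟩
  rw [hE.2.2, hP.1.2, (h.isCubicalPolytope hP hQ).1.2]

lemma IsTower.properties {n m : ℕ} {T B U : Set (Fin n → ℝ)} (h : IsTower n m T B U) :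
    IsCubicalPolytope n T ∧ IsFacet T B ∧ IsFacet T U ∧ B ≠ U := by
  induction h with
  | cube hQ hB hU hBU =>
    refine ⟨hQ.isCubicalPolytope, hB, hU, fun heq => ?_⟩
    rw [heq, disjoint_self] at hBU
    exact hU.2.1.ne_empty hBU
  | @stack m T Q B U U' hT hQ hTQ hU' hUU' ih =>
    obtain ⟨hTc, hB, hU, hBU⟩ := ih
    have hne : U' ≠ U := by
      rintro rfl
      exact hU'.2.1.ne_empty (disjoint_self.1 hUU')
    refine ⟨hTQ.isCubicalPolytope hTc hQ.isCubicalPolytope,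
      hTQ.isFacet hTc hQ.isCubicalPolytope hB hBU, ?_, ?_⟩
    · rw [union_comm]
      exact hTQ.symm.isFacet hQ.isCubicalPolytope hTc hU' hne
    · rintro rfl
      have hsub : B ⊆ U := by
        rw [← hTQ.inter_eq]
        exact subset_inter (subset_of_mem_faces hB.1) (subset_of_mem_faces hU'.1)
      obtain ⟨x, hx⟩ := hB.2.1
      exact disjoint_left.1 hUU' (hsub hx) hx

lemma affineSpan_eq_top_of_homEquiv_facet {n : ℕ} {X : Set (Fin n → ℝ)}
    {W B : Set (Fin (n + 1) → ℝ)} (hW : IsPolytope (n + 1) W) (hB : IsFacet W B)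
    (h : HomEquiv X B) : affineSpan ℝ X = ⊤ := by
  have hne : X.Nonempty := by
    obtain ⟨L, -, -, rfl⟩ := h
    exact hB.2.1.of_image
  refine (AffineSubspace.affineSpan_eq_top_iff_vectorSpan_eq_top_of_nonempty ℝ _ _ hne).2
    (vectorSpan_eq_top_of_finrank ?_)
  have h1 := hB.2.2
  rw [hW.2, finrank_vectorSpan_of_homEquiv h] at h1
  omega

lemma Chain.exists_tower {n m : ℕ} {X Y : Set (Fin n → ℝ)} (h : Chain (m + 1) X Y) :
    ∃ T B U : Set (Fin (n + 1) → ℝ), IsTower (n + 1) (m + 1) T B U ∧ HomEquiv X B ∧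
      HomEquiv Y U := by
  induction m generalizing Y with
  | zero =>
    obtain ⟨Z, hXZ, W, B, U, hW, hB, hU, hd, hZB, hYU⟩ := h
    exact ⟨W, B, U, .cube hW hB hU hd, HomEquiv.trans hXZ hZB, hYU⟩
  | succ m ih =>
    obtain ⟨Z, hXZ, W, B', U', hW, hB', hU', hd, hZB, hYU⟩ := h
    obtain ⟨T, B, U, hT, hXB, hZU⟩ := ih hXZ
    obtain ⟨hTc, hB, hU, -⟩ := hT.properties
    obtain ⟨M, hM, hpos, himg, hsum⟩ := exists_projective_gluing
      (affineSpan_eq_top_of_homEquiv_facet hW.1 hB' hZB) hTc.1 hW.1 hU hB' hZU hZB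
    refine ⟨_, B, pmap M '' U', .stack hT (hW.image_pmap hM hpos) hsum
      (hU'.image_pmap hM hpos) ?_, hXB,
      hYU.image_pmap hM (hpos.mono (subset_of_mem_faces hU'.1))⟩
    rw [← himg]
    exact disjoint_image_pmap hM hpos (subset_of_mem_faces hB'.1) (subset_of_mem_faces hU'.1) hd

/-- Cut both cubes down to parallelotopes and join these by a prism. -/
lemma exists_tower_between_cubes {n : ℕ} {X Y : Set (Fin n → ℝ)} (hX : IsCube n X)
    (hY : IsCube n Y) : ∃ T B U : Set (Fin (n + 1) → ℝ),
      IsTower (n + 1) (2 * n + 1) T B U ∧ HomEquiv X B ∧ HomEquiv Y U := by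
  have h := (hX.chain_unitCube.trans (Chain.of_step (step_unitCube n))).trans hY.chain_unitCube.symm
  rw [show n + 1 + n = 2 * n + 1 by ring] at h
  exact h.exists_tower

lemma IsFacet.isCube {n : ℕ} {P F : Set (Fin (n + 1) → ℝ)} (hP : IsCubicalPolytope (n + 1) P)
    (hF : IsFacet P F) : IsCube n F := by
  obtain ⟨k, hk⟩ := hP.2 F hF.mem_properFaces hF.2.1
  have h1 := hF.2.2
  rw [hk.1.2, hP.1.2] at h1
  obtain rfl : k = n := by omega
  exact hk

end CubicalSum

theorem theorem1p2 (d : ℕ) (hd : 1 ≤ d) :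
    -- (a) bounded towers
    (∀ C₁ C₂ : Set (Fin (d - 1) → ℝ), IsCube (d - 1) C₁ → IsCube (d - 1) C₂ →
      ∃ (m : ℕ) (C B U : Set (Fin d → ℝ)),
        m ≤ 4 * d ∧ IsTower d m C B U ∧ IsCubicalPolytope d C ∧
        ProjEquiv C₁ B ∧ ProjEquiv C₂ U) ∧
    -- (b) cubical connected sum
    (∀ P₁ P₂ F₁ F₂ : Set (Fin d → ℝ),
      IsCubicalPolytope d P₁ → IsCubicalPolytope d P₂ → IsFacet P₁ F₁ → IsFacet P₂ F₂ →
      ∃ (φ : ProjTransf d) (m : ℕ) (T : Set (Fin d → ℝ)),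
        φ.DefinedOn P₂ ∧ m ≤ 4 * d ∧ IsTower d m T (φ.map '' F₂) F₁ ∧
        P₁ ∩ T = F₁ ∧ (φ.map '' P₂) ∩ T = φ.map '' F₂ ∧
        Convex ℝ (P₁ ∪ T ∪ φ.map '' P₂) ∧
        IsCubicalPolytope d (P₁ ∪ T ∪ φ.map '' P₂) ∧
        IsConnectedSum P₁ T F₁ ∧
        IsConnectedSum (P₁ ∪ T) (φ.map '' P₂) (φ.map '' F₂)) := by
  obtain ⟨n, rfl⟩ := Nat.exists_eq_add_of_le' hd
  refine ⟨fun C₁ C₂ h₁ h₂ => ?_, fun P₁ P₂ F₁ F₂ hP₁ hP₂ hF₁ hF₂ => ?_⟩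
  · obtain ⟨T, B, U, hT, hB, hU⟩ := exists_tower_between_cubes (n := n) h₁ h₂
    exact ⟨2 * n + 1, T, B, U, by omega, hT, hT.properties.1, hB.projEquiv h₁.1.nonempty,
      hU.projEquiv h₂.1.nonempty⟩
  · obtain ⟨C₁, hC₁, hCF₁⟩ := (hF₁.isCube hP₁).exists_chart
    obtain ⟨C₂, hC₂, hCF₂⟩ := (hF₂.isCube hP₂).exists_chart
    obtain ⟨T₀, B₀, U₀, hT₀, hB₀, hU₀⟩ := exists_tower_between_cubes hC₂ hC₁
    obtain ⟨hT₀c, hB₀f, hU₀f, hBU⟩ := hT₀.properties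
    -- attach the tower to `P₁` along its top
    obtain ⟨M, hM, hMpos, hMU, hsum₁⟩ := exists_projective_gluing hC₁.1.affineSpan_eq_top hP₁.1
      hT₀c.1 hF₁ hU₀f hCF₁ hU₀
    have hT := hT₀.image_pmap hM hMpos
    rw [hMU] at hT
    obtain ⟨hTc, hBf, -, hBF⟩ := hT.properties
    have hsum₁c := hsum₁.isCubicalPolytope hP₁ hTc
    have hBf' : IsFacet (P₁ ∪ pmap M '' T₀) (pmap M '' B₀) := by
      rw [Set.union_comm]
      exact hsum₁.symm.isFacet hTc hP₁ hBf hBF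
    -- attach `P₂` to its bottom
    obtain ⟨N, hN, hNpos, hNF, hsum₂⟩ := exists_projective_gluing hC₂.1.affineSpan_eq_top hsum₁c.1
      hP₂.1 hBf' hF₂ (hB₀.image_pmap hM (hMpos.mono (subset_of_mem_faces hB₀f.1))) hCF₂
    obtain ⟨φ, hφ, hφmap⟩ := exists_projTransf hN
    have hsub : pmap M '' B₀ ⊆ pmap M '' T₀ := subset_of_mem_faces hBf.1
    refine ⟨φ, 2 * n + 1, pmap M '' T₀, fun x hx => ?_, by omega, ?_⟩
    · rw [hφ]; exact (hNpos x hx).ne'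
    · rw [hφmap, hNF]
      refine ⟨hT, hsum₁.inter_eq, Set.Subset.antisymm ?_ ?_, hsum₂.convex,
        hsum₂.isCubicalPolytope hsum₁c (hP₂.image_pmap hN hNpos), hsum₁, hsum₂⟩
      · rw [← hsum₂.inter_eq]
        exact fun x hx => ⟨Or.inr hx.2, hx.1⟩
      · refine Set.subset_inter ?_ hsub
        rw [← hNF]
        exact Set.image_mono (subset_of_mem_faces hF₂.1)
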